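/- Let $\omega=\sum_{i=1}^n\omega_i\delta_{x_i}$ and $v=\sum_{i=1}^n v_i\delta_{x_i}$ be finitely supported discrete measures on $\mathbb R$ with $\omega_i\in\mathbb R$, $v_i\ge 0$, $|\omega_i|+v_i>0$. Consider the equation $-f''+\tfrac14 f=z\omega f+z^2 v f$ on $\mathbb R$, meaning that $f$ is continuous, $-f''+\tfrac14f=0$ off $\{x_1,\dots,x_n\}$, and $f'(x_i-)=f'(x_i+)+z\omega_if(x_i)+z^2v_if(x_i)$. The eigenvalues of $(\omega,v)$ are the $z\in\mathbb C$ for which there is a nontrivial bounded solution; they are real, nonzero, and finite in number: $\lambda_1<\dots<\lambda_N$. Let $\phi_+(\lambda,\cdot)$ be the solution with $z=\lambda$ that equals $e^{-x/2}$ near $+\infty$, and put $$\gamma_{\lambda}^2=\int|\phi_+(\lambda,x)|^2\,d\omega(x)+2\lambda\int|\phi_+(\lambda,x)|^2\,dv(x),\qquad \varphi_i(x)=\frac{\phi_+(\lambda_i,x)}{\sqrt{\lambda_i\gamma_{\lambda_i}^2}} .$$ For fixed $a\in\mathbb R$, $\{\lambda_i,\varphi_i(a)\}_{i=1}^N$ is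 called the interior spectral data of $(\omega,v)$ at $a$, and $\{\lambda_i,\lambda_i\gamma_{\lambda_i}^2\}_{i=1}^N$ its spectral data. **Theorem.** Fix $a\in\mathbb R$ and $N\ge 1$, and suppose that $\{\lambda_i,\varphi_i(a)\}_{i=1}^N$ is the interior spectral data at $a$ of some $(\omega,v)$, with $$\alpha:=1-\sum_{i=1}^N|\varphi_i(a)|^2\ne 0 .$$ Assume that $\lambda_1>0$ (respectively $\lambda_N<0$), and let $k$ be the number of indices $i$ with $\varphi_i(a)=0$. Let $\mathcal F\subset\mathbb R^{2N}$ be the set of the spectral data $(\lambda_1,\dots,\lambda_N,\lambda_1\gamma_{\lambda_1}^2,\dots,\lambda_N\gamma_{\lambda_N}^2)$ of all pairs $(\omega,v)$ that have the given interior spectral data at $a$. If $k\ge 1$, then infinitely many pairs $(\omega,v)$ have the given interior spectral data. Moreover: (i) if $\varphi_N(a)=0$ (respectively $\varphi_1(a)=0$), then $\mathcal F$ is a connected smooth submanifold of $\mathbb R^{2N}$ of dimension $k$; (ii) if $\varphi_N(a)\ne0$ (respectively $\varphi_1(a)\neq0$), then $\mathcal F$ is the union of two disjoint connected smooth submanifolds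 of $\mathbb R^{2N}$, each of dimension $k$, which have disjoint open neighbourhoods (so they are the two connected components of $\mathcal F$). -/

import Mathlib

open Filter Topology

namespace InteriorInverse

/-- A pair of discrete measures `omega = ∑ ω_i δ_{x_i}`, `v = ∑ v_i δ_{x_i}` on the real line, with
finitely many atoms, real `ω_i` and `v_i ≥ 0`.  Each measure is recorded by the masses of its
atoms, so that two pairs are equal exactly when the measures are.  The points `x_i` (at which
`ω_i ≠ 0` or `v_i ≠ 0`) are the elements of `supp`. -/
@[ext]
structure DiscretePair where
  omega : ℝ →₀ ℝ
  v : ℝ →₀ ℝ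
  v_nonneg : ∀ x, 0 ≤ v x

/-- The points `x_1, …, x_n`, that is, those carrying an atom of `omega` or of `v`. -/
def DiscretePair.supp (p : DiscretePair) : Set ℝ :=
  {x | p.omega x ≠ 0 ∨ p.v x ≠ 0}

/-- `f` solves `-f'' + f / 4 = z ω f + z² v f` on the real line: it solves `-f'' + f / 4 = 0` off
the points `x_i`, is continuous, and has at every `x_i` one-sided derivatives with
`f'(x_i-) = f'(x_i+) + z ω_i f(x_i) + z² v_i f(x_i)`. -/
structure IsSolution {𝕜 : Type*} [RCLike 𝕜] (p : DiscretePair) (z : 𝕜) (f : ℝ → 𝕜) : Prop where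
  continuous : Continuous f
  ode : ∀ x ∉ p.supp, DifferentiableAt ℝ f x ∧ HasDerivAt (deriv f) (f x / 4) x
  jump : ∀ x ∈ p.supp, ∃ dl dr : 𝕜,
    Tendsto (deriv f) (𝓝[<] x) (𝓝 dl) ∧ Tendsto (deriv f) (𝓝[>] x) (𝓝 dr) ∧
      dl = dr + z * (p.omega x : 𝕜) * f x + z ^ 2 * (p.v x : 𝕜) * f x

/-- The spectrum: the complex parameters for which there is a nontrivial bounded solution. -/
def spectrumH (p : DiscretePair) : Set ℂ :=
  {z | ∃ f : ℝ → ℂ, IsSolution p z f ∧ f ≠ 0 ∧ ∃ C : ℝ, ∀ x, ‖f x‖ ≤ C}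

/-- `f` is the solution `φ₊(lam, ·)` for the real parameter `lam`: the (unique) solution that equals
`e^{-x/2}` for all `x` near `+∞`. -/
def IsPhiPlus (p : DiscretePair) (lam : ℝ) (f : ℝ → ℝ) : Prop :=
  IsSolution p lam f ∧ ∀ᶠ x in atTop, f x = Real.exp (-x / 2)

/-- `γ² = ∫ |f|² dω + 2 lam ∫ |f|² dv`, to be used with `f = φ₊(lam, ·)`. -/
noncomputable def gammaSq (p : DiscretePair) (lam : ℝ) (f : ℝ → ℝ) : ℝ :=
  (p.omega.sum fun x m => |f x| ^ 2 * m) + 2 * lam * (p.v.sum fun x m => |f x| ^ 2 * m)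

/-- The eigenvalues are exactly `lam 0 < lam 1 < … < lam (N - 1)`. -/
def HasEigenvalues (p : DiscretePair) {N : ℕ} (lam : Fin N → ℝ) : Prop :=
  StrictMono lam ∧ spectrumH p = Set.range fun i => (lam i : ℂ)

/-- `{lam i, nu i}` is the spectral data of `p`: the eigenvalues `lam i` together with the norming
constants `nu i = lam i * γ²`. -/
def IsSpectralData (p : DiscretePair) {N : ℕ} (lam nu : Fin N → ℝ) : Prop :=
  HasEigenvalues p lam ∧
    ∀ i, ∃ f, IsPhiPlus p (lam i) f ∧ nu i = lam i * gammaSq p (lam i) f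

/-- `{lam i, c i}` is the interior spectral data of `p` at `a`: the eigenvalues `lam i` together with
the values `c i = φ_i(a)` of the normalized eigenfunctions
`φ_i = φ₊(lam i, ·) / √(lam i * γ²)`. -/
def IsInteriorSpectralData (p : DiscretePair) (a : ℝ) {N : ℕ} (lam c : Fin N → ℝ) : Prop :=
  HasEigenvalues p lam ∧
    ∀ i, ∃ f, IsPhiPlus p (lam i) f ∧ c i = f a / √(lam i * gammaSq p (lam i) f)

/-- The family `ℱ ⊆ ℝ^N × ℝ^N = ℝ^{2N}`: the spectral data `(lam_1, …, lam_N, nu_1, …, nu_N)` of all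
the pairs that yield the given interior spectral data at `a`. -/
def spectralFamily (a : ℝ) {N : ℕ} (lam c : Fin N → ℝ) : Set ((Fin N → ℝ) × (Fin N → ℝ)) :=
  {q | ∃ p : DiscretePair, IsInteriorSpectralData p a lam c ∧ IsSpectralData p q.1 q.2}

/-- `S` is a smooth embedded submanifold of dimension `k` of the finite-dimensional space `E`: near
each of its points some smooth diffeomorphism `e` between open subsets of `E` straightens `S` to
an open piece of a `k`-dimensional linear subspace.  (`((⊤ : ℕ∞) : WithTop ℕ∞)` is the
differentiability class `C^∞`.) -/
def IsSubmanifold {E : Type*} [NormedAddCommGroup E] [NormedSpace ℝ E] [FiniteDimensional ℝ E]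
    (k : ℕ) (S : Set E) : Prop :=
  ∀ p ∈ S, ∃ (W : Submodule ℝ E) (e : OpenPartialHomeomorph E E),
    Module.finrank ℝ W = k ∧ p ∈ e.source ∧
      ContDiffOn ℝ ((⊤ : ℕ∞) : WithTop ℕ∞) e e.source ∧
      ContDiffOn ℝ ((⊤ : ℕ∞) : WithTop ℕ∞) e.symm e.target ∧
      e '' (S ∩ e.source) = (W : Set E) ∩ e.target

/-- `S` is a connected (in particular nonempty) `k`-dimensional submanifold of `E`. -/
def IsConnectedSubmanifold {E : Type*} [NormedAddCommGroup E] [NormedSpace ℝ E]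
    [FiniteDimensional ℝ E] (k : ℕ) (S : Set E) : Prop :=
  IsConnected S ∧ IsSubmanifold k S

/-- `S` is the union of two connected `k`-dimensional submanifolds of `E` that are disjoint, and
indeed lie in disjoint open subsets of `E`, so that they are the two components of `S`. -/
def IsUnionOfTwoDisjointSubmanifolds {E : Type*} [NormedAddCommGroup E] [NormedSpace ℝ E]
    [FiniteDimensional ℝ E] (k : ℕ) (S : Set E) : Prop :=
  ∃ S₁ S₂ : Set E, S = S₁ ∪ S₂ ∧ SeparatedNhds S₁ S₂ ∧
    IsConnectedSubmanifold k S₁ ∧ IsConnectedSubmanifold k S₂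

end InteriorInverse

/-! All objects are treated as polynomials in the spectral parameter z. For fixed x, the solution
normalized at +∞ (`phi`) and the one normalized at -∞ (`phiL`) satisfy finite Volterra equations, so
both are polynomials. Their Wronskian W (`charPoly`) has W(0) = 1, and its zeros are the eigenvalues
(`mem_spectrumH_iff`). At an eigenvalue λ one has `phiL` = κ `phi`, and -λ W'(λ) equals κ times the
norming constant (`neg_mul_derivative_charPoly`). Norming constants are positive (`norming_pos`), so
the zeros of W are simple and the spectrum determines W.

Let A and B be the values of `phi` and `phiL` at a. The diagonal Green's function is AB/W = 1 + z ∑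
c_i² / (λ_i - z), so the interior data determine the product AB (`isFactorPair_of_interior_data`).
Call λ_i hidden if c_i = 0 and visible otherwise. Let H and V have the hidden and the visible
eigenvalues as roots, so that W = HV and AB = HG with G = `greenNum`. Since H divides both A and B,
G = H A₀ B₀. The quotient G/V is a Herglotz function with limit α ≥ 0 at infinity. Hence the roots
of G are positive and simple, and any two of them are separated by a visible eigenvalue
(`greenNum_roots`).

It remains to decide which roots of G belong to A. A hidden eigenvalue is a root of both A and B.
The sign of A is known at 0 and at each visible eigenvalue, and this settles every root below the
largest visible eigenvalue (`IsFactorPair.lt_of_root`). By separation at most one root lies beyond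
it. If the largest eigenvalue is hidden, it is that root and A is unique
(`IsFactorPair.eq_of_hidden_max`). If it is visible, α > 0 produces a root μ beyond it, which may be
given to A or to B, so there are exactly two choices (`IsFactorPair.exists_second`).

The relation ν_i c_i² = A(λ_i)² fixes the norming constants at visible eigenvalues. At hidden ones
every positive value occurs (`exists_pair_of_isFactorPair`). There one prescribes the exponential
coefficients of the two half-line solutions at a so that the Wronskian is W and κ has the required
value at each hidden eigenvalue, and each half-line is then recovered by a continued-fraction
expansion of Stieltjes type (`exists_string`). Thus the family is {λ} times one or two slices of an
affine space, cut out by positivity of the k free coordinates. Two slices differ in the coordinate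
of the largest eigenvalue. The negative case follows by changing the sign of ω. -/

namespace InteriorInverse

open Polynomial

/-! ### Polynomials with simple positive roots and Herglotz quotients -/

/-- All complex roots of the real polynomial `A` are real, positive and simple. -/
structure PosSimpleRoots (A : ℝ[X]) : Prop where
  pos : ∀ z : ℂ, aeval z A = 0 → z.im = 0 ∧ 0 < z.re
  simple : ∀ x : ℝ, A.eval x = 0 → A.derivative.eval x ≠ 0

lemma aeval_ofReal_eq (A : ℝ[X]) (x : ℝ) : aeval (x : ℂ) A = ((A.eval x : ℝ) : ℂ) := by
  have := aeval_algebraMap_apply ℂ x A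
  simpa using this

namespace PosSimpleRoots

variable {A B : ℝ[X]}

lemma ne_zero (h : PosSimpleRoots A) : A ≠ 0 := by
  rintro rfl
  simpa using (h.pos 0 (by simp)).2

lemma root_pos (h : PosSimpleRoots A) {x : ℝ} (hx : A.eval x = 0) : 0 < x := by
  simpa using (h.pos x (by rw [aeval_ofReal_eq, hx]; simp)).2

lemma splits (h : PosSimpleRoots A) : A.Splits := by
  refine Splits.of_splits_map (algebraMap ℝ ℂ) (IsAlgClosed.splits _) fun z hz => ?_
  have hz0 : aeval z A = 0 := by
    have := (mem_roots'.1 hz).2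
    rwa [IsRoot.def, eval_map_algebraMap] at this
  exact ⟨z.re, by apply Complex.ext <;> simp [(h.pos z hz0).1]⟩

lemma nodup_roots (h : PosSimpleRoots A) : A.roots.Nodup := by
  classical
  rw [Multiset.nodup_iff_count_le_one]
  intro x
  rw [count_roots]
  by_contra hlt
  push Not at hlt
  have := (one_lt_rootMultiplicity_iff_isRoot h.ne_zero).1 hlt
  exact h.simple x this.1 this.2

lemma card_roots (h : PosSimpleRoots A) : A.roots.toFinset.card = A.natDegree := by
  classical
  rw [Multiset.toFinset_card_of_nodup h.nodup_roots, h.splits.natDegree_eq_card_roots]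

lemma mem_roots (h : PosSimpleRoots A) {x : ℝ} : x ∈ A.roots.toFinset ↔ A.eval x = 0 := by
  simp [h.ne_zero]

lemma dvd (hA : PosSimpleRoots A) (hB : B ≠ 0) (h : ∀ x, A.eval x = 0 → B.eval x = 0) : A ∣ B := by
  refine hA.splits.dvd_of_roots_le_roots hA.ne_zero ?_
  rw [Multiset.le_iff_subset hA.nodup_roots]
  intro x hx
  rw [mem_roots'] at hx ⊢
  exact ⟨hB, h x hx.2⟩

lemma eq_C_mul_of_roots (hA : PosSimpleRoots A) (hB : B ≠ 0) (hd : B.natDegree ≤ A.natDegree)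
    (h : ∀ x, A.eval x = 0 → B.eval x = 0) : ∃ c : ℝ, B = C c * A := by
  obtain ⟨R, rfl⟩ := hA.dvd hB h
  have hR : R ≠ 0 := right_ne_zero_of_mul hB
  rw [natDegree_mul hA.ne_zero hR] at hd
  obtain ⟨c, rfl⟩ := natDegree_eq_zero.1 (show R.natDegree = 0 by omega)
  exact ⟨c, mul_comm _ _⟩

lemma ext (hA : PosSimpleRoots A) (hB : PosSimpleRoots B)
    (h : ∀ x, A.eval x = 0 ↔ B.eval x = 0) (h0 : A.eval 0 = B.eval 0) : A = B := by
  have hroots : A.roots.toFinset = B.roots.toFinset := by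
    ext x; rw [hA.mem_roots, hB.mem_roots, h]
  obtain ⟨c, rfl⟩ := hA.eq_C_mul_of_roots hB.ne_zero
    (by rw [← hA.card_roots, ← hB.card_roots, hroots]) fun x hx => (h x).1 hx
  have : A.eval 0 ≠ 0 := fun h0 => (hA.root_pos h0).false
  have hc : c = 1 := by
    simp only [eval_mul, eval_C] at h0
    field_simp at h0
    exact h0.symm
  simp [hc]

/-- Partial fractions for `q / A`. -/
lemma exists_partial_fractions (hA : PosSimpleRoots A) {q : ℝ[X]}
    (hq : q.natDegree ≤ A.natDegree) (hq0 : q.eval 0 = 0) :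
    ∃ D : ℝ → ℝ[X], (∀ x ∈ A.roots.toFinset, (X - C x) * D x = A) ∧
      q = X * ∑ x ∈ A.roots.toFinset, C (q.eval x / (x * A.derivative.eval x)) * D x ∧
      q.coeff A.natDegree =
        A.leadingCoeff * ∑ x ∈ A.roots.toFinset, q.eval x / (x * A.derivative.eval x) := by
  classical
  set Z := A.roots.toFinset with hZ
  have hmul : ∀ x ∈ Z, (X - C x) * (A /ₘ (X - C x)) = A := fun x hx =>
    mul_divByMonic_eq_iff_isRoot.2 (hA.mem_roots.1 hx)
  have hDx : ∀ x ∈ Z, (A /ₘ (X - C x)).eval x = A.derivative.eval x := by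
    intro x hx
    conv_rhs => rw [← hmul x hx]
    simp
  have hDy : ∀ x ∈ Z, ∀ y ∈ Z, x ≠ y → (A /ₘ (X - C x)).eval y = 0 := by
    intro x hx y hy hxy
    have := congrArg (eval y) (hmul x hx)
    rw [hA.mem_roots.1 hy] at this
    simpa [sub_eq_zero, hxy.symm] using this
  have hdeg : ∀ x ∈ Z, (A /ₘ (X - C x)).natDegree < Z.card := by
    intro x hx
    rw [hA.card_roots, natDegree_divByMonic _ (monic_X_sub_C x), natDegree_X_sub_C]
    have : 0 < Z.card := Finset.card_pos.2 ⟨x, hx⟩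
    rw [hA.card_roots] at this
    omega
  obtain ⟨p, rfl⟩ : X ∣ q := X_dvd_iff.2 (by rwa [coeff_zero_eq_eval_zero])
  -- Lagrange interpolation at the roots of `A`: dividing out the zero of `q` at the origin brings
  -- the degree below the number of nodes.
  have hp : p = ∑ x ∈ Z, C ((X * p).eval x / (x * A.derivative.eval x)) * (A /ₘ (X - C x)) := by
    rcases eq_or_ne p 0 with rfl | hp0
    · simp
    have hZ0 : p.natDegree < Z.card := by
      rw [natDegree_X_mul hp0] at hq
      rw [hA.card_roots]; omega
    rw [← sub_eq_zero]
    refine eq_zero_of_natDegree_lt_card_of_eval_eq_zero' _ Z (fun y hy => ?_) ?_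
    · rw [eval_sub, eval_finsetSum, Finset.sum_eq_single y]
      · have h1 := hA.simple y (hA.mem_roots.1 hy)
        have h2 := (hA.root_pos (hA.mem_roots.1 hy)).ne'
        rw [eval_mul, hDx y hy]
        simp only [eval_C, eval_mul, eval_X]
        field_simp
        ring
      · intro x hx hxy
        rw [eval_mul, hDy x hx y hy hxy, mul_zero]
      · exact fun h => (h hy).elim
    · refine lt_of_le_of_lt (natDegree_sub_le _ _) (max_lt hZ0 ?_)
      refine lt_of_le_of_lt (natDegree_sum_le _ _) ?_
      rw [Finset.fold_max_lt]
      refine ⟨by omega, fun x hx => ?_⟩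
      exact lt_of_le_of_lt (natDegree_C_mul_le _ _) (hdeg x hx)
  refine ⟨fun x => A /ₘ (X - C x), hmul, ?_, ?_⟩
  · conv_lhs => rw [hp]
  · rcases Nat.eq_zero_or_pos A.natDegree with h0 | hpos
    · have : Z = ∅ := by rw [← Finset.card_eq_zero, hA.card_roots, h0]
      simp [this, h0]
    obtain ⟨m, hm⟩ : ∃ m, A.natDegree = m + 1 := ⟨_, (Nat.succ_pred_eq_of_pos hpos).symm⟩
    rw [hm, coeff_X_mul]
    conv_lhs => rw [hp]
    rw [finsetSum_coeff, Finset.mul_sum]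
    refine Finset.sum_congr rfl fun x hx => ?_
    rw [coeff_C_mul, mul_comm]
    congr 1
    rw [leadingCoeff, hm]
    conv_rhs => rw [← hmul x hx]
    rw [sub_mul, coeff_sub, coeff_X_mul, coeff_C_mul,
      coeff_eq_zero_of_natDegree_lt (n := m + 1)]
    · simp
    · have := hdeg x hx
      rw [hA.card_roots, hm] at this
      exact this

/-- A positive combination of `A` and `q`, where `q / A` is a Herglotz-Nevanlinna function vanishing
at the origin. -/
lemma add_mul (hA : PosSimpleRoots A) {q : ℝ[X]} (hq : q.natDegree ≤ A.natDegree)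
    (hq0 : q.eval 0 = 0) (hsign : ∀ x, A.eval x = 0 → A.derivative.eval x * q.eval x < 0)
    {c d : ℝ} (hc : 0 < c) (hd : 0 < d)
    (hlead : 0 ≤ (C c * A + C d * q).coeff A.natDegree * A.leadingCoeff) :
    PosSimpleRoots (C c * A + C d * q) ∧
      (∀ x, (C c * A + C d * q).eval x = 0 →
        0 < (C c * A + C d * q).derivative.eval x * A.eval x) ∧
      ∀ x y, x < y → (C c * A + C d * q).eval x = 0 → (C c * A + C d * q).eval y = 0 →
        ∃ z, A.eval z = 0 ∧ x < z ∧ z < y := by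
  classical
  obtain ⟨D, hD, hqD, hcoeff⟩ := hA.exists_partial_fractions hq hq0
  set Z := A.roots.toFinset with hZ
  set t : ℝ → ℝ := fun x => q.eval x / (x * A.derivative.eval x) with ht
  have htneg : ∀ x ∈ Z, t x < 0 := by
    intro x hx
    have h1 := hsign x (hA.mem_roots.1 hx)
    have h2 := hA.root_pos (hA.mem_roots.1 hx)
    have h3 := hA.simple x (hA.mem_roots.1 hx)
    have : t x = (A.derivative.eval x * q.eval x) / (x * A.derivative.eval x ^ 2) := by
      simp only [ht]; field_simp
    rw [this]
    exact div_neg_of_neg_of_pos h1 (by positivity)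
  set Q := C c * A + C d * q with hQ
  have hQA : ∀ x, Q.eval x = 0 → A.eval x ≠ 0 := by
    intro x hx hAx
    have := hsign x hAx
    simp only [hQ, eval_add, eval_mul, eval_C, hAx, mul_zero, zero_add] at hx
    rcases mul_eq_zero.1 hx with h | h
    · exact hd.ne' h
    · simp [h] at this
  -- This number is the limit of `Q / A` at infinity; `hlead` says that it is nonnegative.
  have hQlead : 0 ≤ c + d * ∑ x ∈ Z, t x := by
    have h1 : Q.coeff A.natDegree = A.leadingCoeff * (c + d * ∑ x ∈ Z, t x) := by
      simp only [hQ, coeff_add, coeff_C_mul, hcoeff, coeff_natDegree]; ring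
    rw [h1] at hlead
    have h2 : A.leadingCoeff ≠ 0 := leadingCoeff_ne_zero.2 hA.ne_zero
    have h3 : 0 < A.leadingCoeff ^ 2 := by positivity
    by_contra hcon
    push Not at hcon
    nlinarith
  have evalQ : ∀ x, A.eval x ≠ 0 → Q.eval x = A.eval x * (c + d * ∑ y ∈ Z, t y * (x / (x - y))) := by
    intro x hx
    have h1 : q.eval x = A.eval x * ∑ y ∈ Z, t y * (x / (x - y)) := by
      rw [hqD, eval_mul, eval_X, eval_finsetSum, Finset.mul_sum, Finset.mul_sum]
      refine Finset.sum_congr rfl fun y hy => ?_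
      have h2 : x - y ≠ 0 := by
        intro h; rw [sub_eq_zero] at h; subst h; exact hx (hA.mem_roots.1 hy)
      have h3 := congrArg (eval x) (hD y hy)
      simp only [eval_mul, eval_sub, eval_X, eval_C] at h3
      rw [eval_mul, eval_C, ← h3]
      field_simp
      simp only [ht]
      ring
    simp only [hQ, eval_add, eval_mul, eval_C, h1]; ring
  have aevalQ : ∀ z : ℂ, aeval z A ≠ 0 →
      aeval z Q = aeval z A * (c + d * ∑ y ∈ Z, (t y : ℂ) * (z / (z - y))) := by
    intro z hz
    have h1 : aeval z q = aeval z A * ∑ y ∈ Z, (t y : ℂ) * (z / (z - y)) := by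
      rw [hqD, map_mul, aeval_X, map_sum, Finset.mul_sum, Finset.mul_sum]
      refine Finset.sum_congr rfl fun y hy => ?_
      have h2 : z - y ≠ 0 := by
        intro h; rw [sub_eq_zero] at h; subst h
        exact hz (by rw [aeval_ofReal_eq, hA.mem_roots.1 hy]; simp)
      have h3 := congrArg (aeval z) (hD y hy)
      simp only [map_mul, map_sub, aeval_X, aeval_C, Complex.coe_algebraMap] at h3
      rw [map_mul, aeval_C, ← h3, Complex.coe_algebraMap]
      field_simp
      simp only [ht]
      ring
    simp only [hQ, map_add, map_mul, aeval_C, h1, Complex.coe_algebraMap]; ring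
  have hderiv : ∀ x, Q.eval x = 0 → 0 < Q.derivative.eval x * A.eval x := by
    intro x hx
    have hAx := hQA x hx
    -- The numerator of the derivative of z / (z - y), written without denominators. It has a fixed
    -- sign, which makes `Q / A` strictly increasing between its poles.
    have hterm : ∀ y ∈ Z, (X * D y).derivative.eval x * A.eval x -
        (X * D y).eval x * A.derivative.eval x = -(y * (D y).eval x ^ 2) := by
      intro y hy
      rw [← hD y hy]
      simp only [derivative_mul, derivative_X, derivative_sub, derivative_C, eval_add, eval_mul,
        eval_X, eval_sub, eval_C, eval_one, eval_zero]
      ring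
    have h1 : q.derivative.eval x * A.eval x - q.eval x * A.derivative.eval x =
        ∑ y ∈ Z, -(t y * y * (D y).eval x ^ 2) := by
      have h2 : q = ∑ y ∈ Z, C (t y) * (X * D y) := by
        conv_lhs => rw [hqD, Finset.mul_sum]
        exact Finset.sum_congr rfl fun y _ => by ring
      rw [h2, derivative_sum, eval_finsetSum, eval_finsetSum, Finset.sum_mul, Finset.sum_mul,
        ← Finset.sum_sub_distrib]
      refine Finset.sum_congr rfl fun y hy => ?_
      rw [derivative_C_mul, eval_C_mul, eval_C_mul]
      linear_combination t y * hterm y hy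
    have h3 : Q.derivative.eval x * A.eval x =
        d * ∑ y ∈ Z, -(t y * y * (D y).eval x ^ 2) := by
      rw [← h1]
      simp only [hQ, eval_add, eval_mul, eval_C] at hx
      simp only [hQ, derivative_add, derivative_C_mul, eval_add, eval_mul, eval_C]
      linear_combination A.derivative.eval x * hx
    rw [h3]
    refine mul_pos hd (Finset.sum_pos (fun y hy => ?_) ?_)
    · have h4 : (D y).eval x ≠ 0 := by
        intro h
        apply hAx
        rw [← hD y hy, eval_mul, h, mul_zero]
      have h5 := htneg y hy
      have h6 := hA.root_pos (hA.mem_roots.1 hy)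
      have : 0 < -t y * y * (D y).eval x ^ 2 := by
        have : 0 < -t y := by linarith
        positivity
      linarith
    · by_contra hne
      rw [Finset.not_nonempty_iff_eq_empty] at hne
      have := evalQ x hAx
      rw [hne, hx] at this
      simp [hc.ne', hAx] at this
  have himg : ∀ z : ℂ, aeval z Q = 0 → z.im = 0 := by
    intro z hz
    by_contra him
    have hAz : aeval z A ≠ 0 := fun h => him (hA.pos z h).1
    have h1 : (c + d * ∑ y ∈ Z, (t y : ℂ) * (z / (z - y)) : ℂ) = 0 := by
      have := aevalQ z hAz
      rw [hz] at this
      exact (mul_eq_zero.1 this.symm).resolve_left hAz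
    -- Each summand t z / (z - y) with t < 0 < y has imaginary part of the sign of Im z, so the sum
    -- cannot equal a real number at a nonreal point.
    have h2 : ∀ y : ℝ, ((t y : ℂ) * (z / (z - y))).im
        = - z.im * (t y * y / Complex.normSq (z - y)) := by
      intro y
      rw [Complex.im_ofReal_mul, Complex.div_im]
      simp only [Complex.sub_re, Complex.sub_im, Complex.ofReal_re, Complex.ofReal_im]
      ring
    have h3 : ∑ y ∈ Z, t y * y / Complex.normSq (z - y) = 0 := by
      have := congrArg Complex.im h1
      simp only [Complex.add_im, Complex.ofReal_im, Complex.im_ofReal_mul, Complex.im_sum, h2,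
        ← Finset.mul_sum, Complex.zero_im, zero_add] at this
      simpa [hd.ne', him] using this
    have hterm : ∀ y ∈ Z, t y * y / Complex.normSq (z - y) < 0 := by
      intro y hy
      refine div_neg_of_neg_of_pos
        (mul_neg_of_neg_of_pos (htneg y hy) (hA.root_pos (hA.mem_roots.1 hy))) ?_
      rw [Complex.normSq_pos, sub_ne_zero]
      rintro rfl
      exact him (by simp)
    rcases Z.eq_empty_or_nonempty with hZe | hne
    · rw [hZe] at h1
      simp at h1
      exact hc.ne' h1
    · exact (Finset.sum_neg hterm hne).ne h3
  refine ⟨⟨fun z hz => ⟨himg z hz, ?_⟩, fun x hx h => ?_⟩, hderiv, ?_⟩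
  · have hzr : z = (z.re : ℂ) := by apply Complex.ext <;> simp [himg z hz]
    set x := z.re
    have hx : Q.eval x = 0 := by
      rw [hzr, aeval_ofReal_eq] at hz; exact_mod_cast hz
    by_contra hx0
    push Not at hx0
    have h1 := evalQ x (hQA x hx)
    rw [hx] at h1
    have h2 := (mul_eq_zero.1 h1.symm).resolve_left (hQA x hx)
    -- On x ≤ 0 the factor x / (x - y) is less than 1, so `Q / A` strictly exceeds its nonnegative
    -- limit at infinity there (or is the constant `c` if there are no poles).
    have hterm : ∀ y ∈ Z, t y ≤ t y * (x / (x - y)) := by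
      intro y hy
      have h3 := hA.root_pos (hA.mem_roots.1 hy)
      have h4 : x / (x - y) ≤ 1 := by
        rw [div_le_one_of_neg (by linarith)]; linarith
      nlinarith [htneg y hy]
    rcases Z.eq_empty_or_nonempty with hZe | ⟨y0, hy0⟩
    · rw [hZe] at h2
      simp at h2
      exact hc.ne' h2
    · have : ∑ y ∈ Z, t y < ∑ y ∈ Z, t y * (x / (x - y)) := by
        refine Finset.sum_lt_sum hterm ⟨y0, hy0, ?_⟩
        have h3 := hA.root_pos (hA.mem_roots.1 hy0)
        have h4 : x / (x - y0) < 1 := by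
          rw [div_lt_one_of_neg (by linarith)]; linarith
        nlinarith [htneg y0 hy0]
      nlinarith
  · have := hderiv x hx
    simp [h] at this
  · intro x y hxy hx hy
    by_contra! hcon
    have h1 := evalQ x (hQA x hx)
    rw [hx] at h1
    have h1 := (mul_eq_zero.1 h1.symm).resolve_left (hQA x hx)
    have h2 := evalQ y (hQA y hy)
    rw [hy] at h2
    have h2 := (mul_eq_zero.1 h2.symm).resolve_left (hQA y hy)
    -- If no pole lies between `x` and `y`, every summand increases strictly from `x` to `y`, so the
    -- quotient cannot vanish at both.
    have hterm : ∀ w ∈ Z, t w * (x / (x - w)) < t w * (y / (y - w)) := by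
      intro w hw
      have h3 := hA.root_pos (hA.mem_roots.1 hw)
      have h4 := hcon w (hA.mem_roots.1 hw)
      have hxw : x ≠ w := by rintro rfl; exact hQA x hx (hA.mem_roots.1 hw)
      have hyw : y ≠ w := by rintro rfl; exact hQA y hy (hA.mem_roots.1 hw)
      have h5 : y / (y - w) < x / (x - w) := by
        rw [← sub_pos, div_sub_div _ _ (sub_ne_zero.2 hxw) (sub_ne_zero.2 hyw)]
        have h6 : x * (y - w) - (x - w) * y = w * (y - x) := by ring
        rw [h6]
        refine div_pos (mul_pos h3 (sub_pos.2 hxy)) ?_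
        rcases lt_or_gt_of_ne hxw with h | h
        · exact mul_pos_of_neg_of_neg (by linarith)
            (sub_neg.2 (lt_of_le_of_ne (h4 h) hyw))
        · exact mul_pos (by linarith) (by linarith)
      nlinarith [htneg w hw]
    rcases Z.eq_empty_or_nonempty with hZe | hne
    · rw [hZe] at h2
      simp at h2
      exact hc.ne' h2
    · have := Finset.sum_lt_sum_of_nonempty hne hterm
      nlinarith

end PosSimpleRoots

/-! ### The Volterra solutions as polynomials in the spectral parameter -/

/-- The fundamental solution `2 sinh (t / 2)` of `-f'' + f / 4 = 0`, cut off at the origin. -/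
noncomputable def kern (t : ℝ) : ℝ := if 0 < t then 2 * Real.sinh (t / 2) else 0

lemma kern_of_nonpos {t : ℝ} (h : t ≤ 0) : kern t = 0 := if_neg h.not_gt

lemma kern_of_nonneg {t : ℝ} (h : 0 ≤ t) : kern t = 2 * Real.sinh (t / 2) := by
  rcases h.eq_or_lt with rfl | h
  · simp [kern]
  · exact if_pos h

lemma kern_pos {t : ℝ} (h : 0 < t) : 0 < kern t := by
  rw [kern_of_nonneg h.le]
  have := Real.sinh_pos_iff.2 (half_pos h)
  positivity

lemma kern_sub_of_le {x y : ℝ} (h : x ≤ y) : kern (y - x) =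
    Real.exp (y / 2) * Real.exp (-x / 2) - Real.exp (-y / 2) * Real.exp (x / 2) := by
  rw [kern_of_nonneg (sub_nonneg.2 h), Real.sinh_eq, ← Real.exp_add, ← Real.exp_add]
  ring_nf

lemma kern_sub_kern (x y : ℝ) : kern (y - x) - kern (x - y) =
    Real.exp (y / 2) * Real.exp (-x / 2) - Real.exp (-y / 2) * Real.exp (x / 2) := by
  rcases le_total x y with h | h
  · rw [kern_sub_of_le h, kern_of_nonpos (sub_nonpos.2 h), sub_zero]
  · rw [kern_sub_of_le h, kern_of_nonpos (sub_nonpos.2 h)]; ring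

/-- The solution of the Volterra equation
`φ(x) = e^{-x/2} - ∑_{y > x} 2 sinh ((y - x) / 2) σ(y) φ(y)`, as a polynomial in the spectral
parameter. -/
noncomputable def phi (σ : ℝ →₀ ℝ[X]) (x : ℝ) : ℝ[X] :=
  C (Real.exp (-x / 2)) -
    ∑ y : {y // y ∈ σ.support.filter (x < ·)}, C (kern (y - x)) * (σ y * phi σ y)
termination_by (σ.support.filter (x < ·)).card
decreasing_by
  refine Finset.card_lt_card ⟨fun z hz => ?_, fun h => ?_⟩
  · have := (Finset.mem_filter.1 y.2).2
    rw [Finset.mem_filter] at hz ⊢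
    exact ⟨hz.1, this.trans hz.2⟩
  · exact lt_irrefl _ (Finset.mem_filter.1 (h y.2)).2

section PhiPolynomial

variable (σ τ : ℝ →₀ ℝ[X]) (x : ℝ)

lemma phi_eq_sum_filter : phi σ x = C (Real.exp (-x / 2)) -
    ∑ y ∈ σ.support.filter (x < ·), C (kern (y - x)) * (σ y * phi σ y) := by
  rw [phi, Finset.sum_coe_sort (σ.support.filter (x < ·))
    fun y => C (kern (y - x)) * (σ y * phi σ y)]

lemma phi_eq_sum : phi σ x = C (Real.exp (-x / 2)) -
    ∑ y ∈ σ.support, C (kern (y - x)) * (σ y * phi σ y) := by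
  rw [phi_eq_sum_filter, Finset.sum_filter]
  congr 1
  refine Finset.sum_congr rfl fun y _ => ?_
  split_ifs with h
  · rfl
  · rw [kern_of_nonpos (by linarith)]; simp

variable {σ τ x}

lemma support_filter_congr (h : ∀ y, x < y → σ y = τ y) :
    σ.support.filter (x < ·) = τ.support.filter (x < ·) := by
  ext y
  simp only [Finset.mem_filter, Finsupp.mem_support_iff]
  constructor <;> rintro ⟨h1, h2⟩ <;> refine ⟨?_, h2⟩
  · rwa [← h y h2]
  · rwa [h y h2]

/-- The Volterra equation at x only involves the atoms to the right of x. This locality is what lets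
two half-line strings be glued without disturbing each other's solution. -/
lemma phi_congr (h : ∀ y, x < y → σ y = τ y) : phi σ x = phi τ x := by
  induction hn : (σ.support.filter (x < ·)).card using Nat.strong_induction_on generalizing x with
  | _ n ih =>
    rw [phi_eq_sum_filter, phi_eq_sum_filter, ← support_filter_congr h]
    congr 1
    refine Finset.sum_congr rfl fun y hy => ?_
    have hxy := (Finset.mem_filter.1 hy).2
    rw [h y hxy, ih _ ?_ (fun z hz => h z (hxy.trans hz)) rfl]
    rw [← hn]
    refine Finset.card_lt_card ⟨fun z hz => ?_, fun hss => ?_⟩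
    · rw [Finset.mem_filter] at hz ⊢
      exact ⟨hz.1, hxy.trans hz.2⟩
    · exact lt_irrefl _ (Finset.mem_filter.1 (hss hy)).2

/-- Reflection at the origin. -/
noncomputable def mirror {M : Type*} [Zero M] (σ : ℝ →₀ M) : ℝ →₀ M :=
  σ.equivMapDomain (Equiv.neg ℝ)

lemma mirror_apply {M : Type*} [Zero M] (σ : ℝ →₀ M) (x : ℝ) : mirror σ x = σ (-x) := by
  simp [mirror, Finsupp.equivMapDomain_apply]

lemma sum_mirror_support {M R : Type*} [Zero M] [AddCommMonoid R] (σ : ℝ →₀ M) (F : ℝ → R) :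
    ∑ y ∈ (mirror σ).support, F y = ∑ y ∈ σ.support, F (-y) := by
  refine Finset.sum_bij' (fun y _ => -y) (fun y _ => -y) ?_ ?_ ?_ ?_ ?_ <;>
    simp [mirror_apply]

lemma sum_mirror_support_filter {M R : Type*} [Zero M] [AddCommMonoid R] (σ : ℝ →₀ M) (F : ℝ → R)
    (a : ℝ) : ∑ y ∈ (mirror σ).support.filter (-a < ·), F y =
      ∑ y ∈ σ.support.filter (· < a), F (-y) := by
  refine Finset.sum_bij' (fun y _ => -y) (fun y _ => -y) ?_ ?_ ?_ ?_ ?_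
  · simp only [Finset.mem_filter, Finsupp.mem_support_iff, mirror_apply]
    exact fun y h => ⟨h.1, by linarith [h.2]⟩
  · simp only [Finset.mem_filter, Finsupp.mem_support_iff, mirror_apply]
    exact fun y h => ⟨by simpa using h.1, by linarith [h.2]⟩
  all_goals simp

variable (σ x)

/-- The mirror image of `phi`, equal to `e^{x/2}` near `-∞`. -/
noncomputable def phiL : ℝ[X] := phi (mirror σ) (-x)

lemma phiL_eq_sum : phiL σ x = C (Real.exp (x / 2)) -
    ∑ y ∈ σ.support, C (kern (x - y)) * (σ y * phiL σ y) := by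
  rw [phiL, phi_eq_sum, sum_mirror_support]
  simp only [mirror_apply, neg_neg, phiL]
  congr 1
  refine Finset.sum_congr rfl fun y _ => ?_
  congr 3
  ring

/-- The characteristic polynomial: the coefficient of `e^{-x/2}` in `phi` near `-∞`. -/
noncomputable def charPoly : ℝ[X] :=
  1 - ∑ y ∈ σ.support, C (Real.exp (y / 2)) * (σ y * phi σ y)

/-- The coefficient of `e^{-y/2}` in `phi` immediately to the right of `x`. -/
noncomputable def coefP : ℝ[X] :=
  1 - ∑ y ∈ σ.support.filter (x < ·), C (Real.exp (y / 2)) * (σ y * phi σ y)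

/-- The coefficient of `e^{y/2}` in `phi` immediately to the right of `x`. -/
noncomputable def coefQ : ℝ[X] :=
  ∑ y ∈ σ.support.filter (x < ·), C (Real.exp (-y / 2)) * (σ y * phi σ y)

variable {σ x} in
lemma coefP_congr (h : ∀ y, x < y → σ y = τ y) : coefP σ x = coefP τ x := by
  rw [coefP, coefP, ← support_filter_congr h]
  congr 1
  refine Finset.sum_congr rfl fun y hy => ?_
  have hxy := (Finset.mem_filter.1 hy).2
  rw [h y hxy, phi_congr fun z hz => h z (hxy.trans hz)]

variable {σ x} in
lemma coefQ_congr (h : ∀ y, x < y → σ y = τ y) : coefQ σ x = coefQ τ x := by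
  rw [coefQ, coefQ, ← support_filter_congr h]
  refine Finset.sum_congr rfl fun y hy => ?_
  have hxy := (Finset.mem_filter.1 hy).2
  rw [h y hxy, phi_congr fun z hz => h z (hxy.trans hz)]

lemma phi_eq_coef : phi σ x =
    C (Real.exp (-x / 2)) * coefP σ x + C (Real.exp (x / 2)) * coefQ σ x := by
  rw [phi_eq_sum_filter, coefP, coefQ, mul_sub, mul_one, Finset.mul_sum, Finset.mul_sum, sub_add,
    ← Finset.sum_sub_distrib]
  congr 1
  refine Finset.sum_congr rfl fun y hy => ?_
  rw [kern_sub_of_le (Finset.mem_filter.1 hy).2.le, C_sub, C_mul, C_mul]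
  ring

/-- Discrete Green's identity: for a Volterra equation and its transpose, the double sum ∑∑ u k v
occurs on both sides and cancels, so only the inhomogeneous terms survive. -/
lemma dual_sum {R : Type*} [CommRing R] (T : Finset ℝ) (u v f g e e' : ℝ → R) (k : ℝ → ℝ → R)
    (hf : ∀ x ∈ T, f x = e x - ∑ y ∈ T, k x y * u y)
    (hg : ∀ x ∈ T, g x = e' x - ∑ y ∈ T, k y x * v y) :
    ∑ x ∈ T, u x * g x - ∑ x ∈ T, v x * f x = ∑ x ∈ T, u x * e' x - ∑ x ∈ T, v x * e x := by
  have h1 : ∑ x ∈ T, u x * g x = ∑ x ∈ T, u x * e' x - ∑ x ∈ T, ∑ y ∈ T, u x * (k y x * v y) := by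
    rw [← Finset.sum_sub_distrib]
    exact Finset.sum_congr rfl fun x hx => by rw [hg x hx, mul_sub, Finset.mul_sum]
  have h2 : ∑ x ∈ T, v x * f x = ∑ x ∈ T, v x * e x - ∑ x ∈ T, ∑ y ∈ T, u x * (k y x * v y) := by
    rw [Finset.sum_comm, ← Finset.sum_sub_distrib]
    refine Finset.sum_congr rfl fun x hx => ?_
    rw [hf x hx, mul_sub, Finset.mul_sum]
    congr 1
    exact Finset.sum_congr rfl fun y _ => by ring
  rw [h1, h2]; ring

/-- The Wronskian is the same number read off at either end of the line; this makes `charPoly`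
symmetric under reflection. -/
lemma charPoly_eq_left :
    charPoly σ = 1 - ∑ y ∈ σ.support, C (Real.exp (-y / 2)) * (σ y * phiL σ y) := by
  have := dual_sum σ.support (fun y => σ y * phi σ y) (fun y => σ y * phiL σ y) (phi σ) (phiL σ)
    (fun x => C (Real.exp (-x / 2))) (fun x => C (Real.exp (x / 2))) (fun x y => C (kern (y - x)))
    (fun x _ => phi_eq_sum σ x) (fun x _ => phiL_eq_sum σ x)
  rw [← Finset.sum_sub_distrib, Finset.sum_eq_zero (fun y _ => by ring)] at this
  rw [charPoly, sub_right_inj, ← sub_eq_zero, this]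
  congr 1 <;> exact Finset.sum_congr rfl fun y _ => mul_comm _ _

/-- The Wronskian of `phi` and `phiL` for two spectral parameters. -/
lemma charPoly_sub (z w : ℝ) : (charPoly σ).eval w - (charPoly σ).eval z =
    ∑ x ∈ σ.support, ((σ x).eval z - (σ x).eval w) * ((phi σ x).eval z * (phiL σ x).eval w) := by
  have h1 : ∀ x, (phi σ x).eval z = Real.exp (-x / 2) -
      ∑ y ∈ σ.support, kern (y - x) * ((σ y).eval z * (phi σ y).eval z) := by
    intro x
    conv_lhs => rw [phi_eq_sum]
    simp only [eval_sub, eval_C, eval_finsetSum, eval_mul]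
  have h2 : ∀ x, (phiL σ x).eval w = Real.exp (x / 2) -
      ∑ y ∈ σ.support, kern (x - y) * ((σ y).eval w * (phiL σ y).eval w) := by
    intro x
    conv_lhs => rw [phiL_eq_sum]
    simp only [eval_sub, eval_C, eval_finsetSum, eval_mul]
  have := dual_sum σ.support (fun y => (σ y).eval z * (phi σ y).eval z)
    (fun y => (σ y).eval w * (phiL σ y).eval w) (fun x => (phi σ x).eval z)
    (fun x => (phiL σ x).eval w) (fun x => Real.exp (-x / 2)) (fun x => Real.exp (x / 2))
    (fun x y => kern (y - x)) (fun x _ => h1 x) (fun x _ => h2 x)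
  have h3 : ∑ x ∈ σ.support, ((σ x).eval z - (σ x).eval w) *
      ((phi σ x).eval z * (phiL σ x).eval w) =
      ∑ x ∈ σ.support, (σ x).eval z * (phi σ x).eval z * (phiL σ x).eval w -
      ∑ x ∈ σ.support, (σ x).eval w * (phiL σ x).eval w * (phi σ x).eval z := by
    rw [← Finset.sum_sub_distrib]
    exact Finset.sum_congr rfl fun y _ => by ring
  rw [h3, this]
  have h4 : (charPoly σ).eval w =
      1 - ∑ x ∈ σ.support, (σ x).eval w * (phiL σ x).eval w * Real.exp (-x / 2) := by
    rw [charPoly_eq_left]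
    simp only [eval_sub, eval_one, eval_finsetSum, eval_mul, eval_C, mul_comm]
  have h5 : (charPoly σ).eval z =
      1 - ∑ x ∈ σ.support, (σ x).eval z * (phi σ x).eval z * Real.exp (x / 2) := by
    rw [charPoly]
    simp only [eval_sub, eval_one, eval_finsetSum, eval_mul, eval_C, mul_comm]
  rw [h4, h5]; ring

variable {σ x}

/-- The characteristic polynomial in terms of the solutions on both sides of a point. -/
lemma charPoly_eq_coef {a : ℝ} (ha : a ∉ σ.support) : charPoly σ =
    coefP σ a * coefP (mirror σ) (-a) - coefQ σ a * coefQ (mirror σ) (-a) := by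
  have hsplit : ∀ F : ℝ → ℝ[X], ∑ y ∈ σ.support, F y =
      ∑ y ∈ σ.support.filter (· < a), F y + ∑ y ∈ σ.support.filter (a < ·), F y := by
    intro F
    rw [← Finset.sum_filter_add_sum_filter_not σ.support (· < a)]
    congr 2
    ext y
    simp only [Finset.mem_filter, not_lt, and_congr_right_iff]
    exact fun hy => ⟨fun h => lt_of_le_of_ne h fun h => ha (h ▸ hy), le_of_lt⟩
  have hr : coefP (mirror σ) (-a) =
      1 - ∑ y ∈ σ.support.filter (· < a), C (Real.exp (-y / 2)) * (σ y * phiL σ y) := by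
    rw [coefP, sum_mirror_support_filter]
    simp [mirror_apply, phiL]
  have hs : coefQ (mirror σ) (-a) =
      ∑ y ∈ σ.support.filter (· < a), C (Real.exp (y / 2)) * (σ y * phiL σ y) := by
    rw [coefQ, sum_mirror_support_filter]
    simp [mirror_apply, phiL]
  -- To the left of `a`, the atoms on the right act only through the two exponential coefficients at
  -- `a`, so `phi` solves a Volterra equation over the left atoms with this new inhomogeneity.
  have hphi : ∀ x ∈ σ.support.filter (· < a), phi σ x =
      (C (Real.exp (-x / 2)) * coefP σ a + C (Real.exp (x / 2)) * coefQ σ a) -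
        ∑ y ∈ σ.support.filter (· < a), C (kern (y - x)) * (σ y * phi σ y) := by
    intro x hx
    have hxa := (Finset.mem_filter.1 hx).2
    rw [phi_eq_sum, hsplit, coefP, coefQ, mul_sub, mul_one, Finset.mul_sum, Finset.mul_sum]
    have : ∑ y ∈ σ.support.filter (a < ·), C (kern (y - x)) * (σ y * phi σ y) =
        ∑ y ∈ σ.support.filter (a < ·),
          C (Real.exp (-x / 2)) * (C (Real.exp (y / 2)) * (σ y * phi σ y)) -
        ∑ y ∈ σ.support.filter (a < ·),
          C (Real.exp (x / 2)) * (C (Real.exp (-y / 2)) * (σ y * phi σ y)) := by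
      rw [← Finset.sum_sub_distrib]
      refine Finset.sum_congr rfl fun y hy => ?_
      rw [kern_sub_of_le (hxa.trans (Finset.mem_filter.1 hy).2).le, C_sub, C_mul, C_mul]
      ring
    rw [this]; ring
  have hphiL : ∀ x ∈ σ.support.filter (· < a), phiL σ x = C (Real.exp (x / 2)) -
        ∑ y ∈ σ.support.filter (· < a), C (kern (x - y)) * (σ y * phiL σ y) := by
    intro x hx
    have hxa := (Finset.mem_filter.1 hx).2
    rw [phiL_eq_sum, hsplit, Finset.sum_eq_zero (s := σ.support.filter (a < ·)), add_zero]
    intro y hy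
    rw [kern_of_nonpos (by linarith [(Finset.mem_filter.1 hy).2])]; simp
  have := dual_sum (σ.support.filter (· < a)) (fun y => σ y * phi σ y) (fun y => σ y * phiL σ y)
    (phi σ) (phiL σ) _ (fun x => C (Real.exp (x / 2))) (fun x y => C (kern (y - x))) hphi hphiL
  rw [← Finset.sum_sub_distrib, Finset.sum_eq_zero (fun y _ => by ring)] at this
  have h1 : ∑ y ∈ σ.support.filter (· < a), σ y * phi σ y * C (Real.exp (y / 2)) =
      coefP σ a * (1 - coefP (mirror σ) (-a)) + coefQ σ a * coefQ (mirror σ) (-a) := by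
    rw [sub_eq_zero.1 this.symm, hr, hs, sub_sub_cancel, Finset.mul_sum, Finset.mul_sum,
      ← Finset.sum_add_distrib]
    exact Finset.sum_congr rfl fun y _ => by ring
  have h2 : charPoly σ = coefP σ a -
      ∑ y ∈ σ.support.filter (· < a), σ y * phi σ y * C (Real.exp (y / 2)) := by
    rw [charPoly, hsplit, coefP, sub_sub, add_comm]
    congr 2
    exact Finset.sum_congr rfl fun y _ => mul_comm _ _
  rw [h2, h1]; ring

/-- This form is suited to the inverse problem: with the values of both solutions at `a` fixed, the
Wronskian is affine in the coefficients `coefQ` on the two sides. -/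
lemma charPoly_eq_phi {a : ℝ} (ha : a ∉ σ.support) : charPoly σ = phi σ a * phiL σ a -
    C (Real.exp (-a / 2)) * phi σ a * coefQ (mirror σ) (-a) -
    C (Real.exp (a / 2)) * phiL σ a * coefQ σ a := by
  have h1 := phi_eq_coef σ a
  have h2 := phi_eq_coef (mirror σ) (-a)
  rw [neg_neg] at h2
  have h3 : C (Real.exp (-a / 2)) * C (Real.exp (a / 2)) = (1 : ℝ[X]) := by
    rw [← C_mul, ← Real.exp_add, ← C_1]; congr 1; rw [← Real.exp_zero]; congr 1; ring
  rw [charPoly_eq_coef ha, phiL, h1, h2]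
  linear_combination (coefQ σ a * coefQ (mirror σ) (-a) - coefP σ a * coefP (mirror σ) (-a)) * h3

/-! ### Degrees and leading coefficients -/

section Degree

variable (hσ : ∀ y ∈ σ.support, 0 < (σ y).natDegree)

include hσ in
-- The leftmost atom of an upward closed set dominates: its term contains `phi` at that atom, which
-- already has the full degree of the atoms further right, times a nonconstant factor. Induction
-- peels off this atom. General positive `e` and `k` cover `phi` and `charPoly` at once.
lemma natDegree_volterra (T : Finset ℝ) (hT : T ⊆ σ.support)
    (hup : ∀ y ∈ T, ∀ z ∈ σ.support, y < z → z ∈ T) {e : ℝ} (he : 0 < e) {k : ℝ → ℝ}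
    (hk : ∀ y ∈ T, 0 < k y) :
    (C e - ∑ y ∈ T, C (k y) * (σ y * phi σ y)).natDegree = ∑ y ∈ T, (σ y).natDegree ∧
    0 < (C e - ∑ y ∈ T, C (k y) * (σ y * phi σ y)).leadingCoeff *
      ∏ y ∈ T, -(σ y).leadingCoeff := by
  classical
  induction hn : T.card using Nat.strong_induction_on generalizing T e k with
  | _ n ih =>
    rcases T.eq_empty_or_nonempty with rfl | hne
    · simpa using he
    set m := T.min' hne with hm
    have hmT : m ∈ T := T.min'_mem hne
    have hmσ : m ∈ σ.support := hT hmT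
    have hcard : (T.erase m).card < n := by
      rw [← hn]; exact Finset.card_erase_lt_of_mem hmT
    have hsub : T.erase m ⊆ σ.support := (Finset.erase_subset _ _).trans hT
    have hup' : ∀ y ∈ T.erase m, ∀ z ∈ σ.support, y < z → z ∈ T.erase m := by
      intro y hy z hz hyz
      have hy' := Finset.mem_erase.1 hy
      refine Finset.mem_erase.2 ⟨?_, hup y hy'.2 z hz hyz⟩
      exact ((T.min'_le y hy'.2).trans_lt hyz).ne'
    have hlt : ∀ y ∈ T.erase m, m < y := fun y hy =>
      lt_of_le_of_ne (T.min'_le y (Finset.mem_of_mem_erase hy)) (Finset.ne_of_mem_erase hy).symm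
    have hfilter : σ.support.filter (m < ·) = T.erase m := by
      ext z
      simp only [Finset.mem_filter]
      refine ⟨fun h => Finset.mem_erase.2 ⟨h.2.ne', hup m hmT z h.1 h.2⟩, fun h => ⟨hsub h, hlt z h⟩⟩
    obtain ⟨ih1, ih2⟩ := ih _ hcard (T.erase m) hsub hup' he
      (fun y hy => hk y (Finset.mem_of_mem_erase hy)) rfl
    obtain ⟨jh1, jh2⟩ := ih _ hcard (T.erase m) hsub hup' (Real.exp_pos (-m / 2))
      (k := fun y => kern (y - m)) (fun y hy => kern_pos (sub_pos.2 (hlt y hy))) rfl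
    rw [← hfilter, ← phi_eq_sum_filter, hfilter] at jh1 jh2
    have hphi0 : phi σ m ≠ 0 := by
      intro h; rw [h] at jh2; simp at jh2
    have hσ0 : σ m ≠ 0 := Finsupp.mem_support_iff.1 hmσ
    have hkm := hk m hmT
    set U := C e - ∑ y ∈ T.erase m, C (k y) * (σ y * phi σ y) with hU
    have hU' : C e - ∑ y ∈ T, C (k y) * (σ y * phi σ y) = U - C (k m) * (σ m * phi σ m) := by
      rw [hU, ← Finset.add_sum_erase _ _ hmT]; ring
    have hdeg : (C (k m) * (σ m * phi σ m)).natDegree = ∑ y ∈ T, (σ y).natDegree := by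
      rw [natDegree_C_mul hkm.ne', natDegree_mul hσ0 hphi0, jh1,
        Finset.add_sum_erase _ (fun y => (σ y).natDegree) hmT]
    have hlt' : U.natDegree < (C (k m) * (σ m * phi σ m)).natDegree := by
      rw [hdeg, ih1, ← Finset.add_sum_erase T (fun y => (σ y).natDegree) hmT]
      have := hσ m hmσ
      omega
    rw [hU']
    refine ⟨by rw [natDegree_sub_eq_right_of_natDegree_lt hlt', hdeg], ?_⟩
    rw [leadingCoeff_sub_of_degree_lt' (degree_lt_degree hlt'), ← Finset.mul_prod_erase _ _ hmT,
      leadingCoeff_mul, leadingCoeff_mul, leadingCoeff_C]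
    have h0 : (σ m).leadingCoeff ≠ 0 := leadingCoeff_ne_zero.2 hσ0
    have : 0 < k m * (σ m).leadingCoeff ^ 2 *
        ((phi σ m).leadingCoeff * ∏ y ∈ T.erase m, -(σ y).leadingCoeff) := by positivity
    calc _ < _ := this
      _ = _ := by ring

include hσ in
lemma natDegree_phi (a : ℝ) :
    (phi σ a).natDegree = ∑ y ∈ σ.support.filter (a < ·), (σ y).natDegree ∧
    0 < (phi σ a).leadingCoeff * ∏ y ∈ σ.support.filter (a < ·), -(σ y).leadingCoeff := by
  have := natDegree_volterra hσ (σ.support.filter (a < ·)) (Finset.filter_subset _ _)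
    (fun y hy z hz hyz => Finset.mem_filter.2 ⟨hz, (Finset.mem_filter.1 hy).2.trans hyz⟩)
    (Real.exp_pos (-a / 2)) (k := fun y => kern (y - a))
    (fun y hy => kern_pos (sub_pos.2 (Finset.mem_filter.1 hy).2))
  rwa [← phi_eq_sum_filter] at this

include hσ in
lemma natDegree_phiL (a : ℝ) :
    (phiL σ a).natDegree = ∑ y ∈ σ.support.filter (· < a), (σ y).natDegree ∧
    0 < (phiL σ a).leadingCoeff * ∏ y ∈ σ.support.filter (· < a), -(σ y).leadingCoeff := by
  have hσ' : ∀ y ∈ (mirror σ).support, 0 < (mirror σ y).natDegree := by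
    intro y hy
    rw [mirror_apply]
    exact hσ _ (by simpa [mirror_apply] using hy)
  have := natDegree_phi hσ' (-a)
  rw [sum_mirror_support_filter] at this
  have hprod : ∏ y ∈ (mirror σ).support.filter (-a < ·), -(mirror σ y).leadingCoeff =
      ∏ y ∈ σ.support.filter (· < a), -(σ y).leadingCoeff := by
    have := sum_mirror_support_filter (R := Additive ℝ) σ
      (fun y => Additive.ofMul (-(mirror σ y).leadingCoeff)) a
    rw [← ofMul_prod, ← ofMul_prod] at this
    simpa [mirror_apply] using Additive.ofMul.injective this
  rw [hprod] at this
  simpa [mirror_apply, phiL] using this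

include hσ in
lemma natDegree_charPoly :
    (charPoly σ).natDegree = ∑ y ∈ σ.support, (σ y).natDegree ∧
    0 < (charPoly σ).leadingCoeff * ∏ y ∈ σ.support, -(σ y).leadingCoeff := by
  have := natDegree_volterra hσ σ.support subset_rfl (fun y hy z hz hyz => hz) one_pos
    (k := fun y => Real.exp (y / 2)) (fun y hy => Real.exp_pos _)
  rwa [C_1] at this

include hσ in
lemma natDegree_phi_mul_phiL_le (a : ℝ) :
    (phi σ a * phiL σ a).natDegree ≤ (charPoly σ).natDegree := by
  refine natDegree_mul_le.trans ?_
  rw [(natDegree_phi hσ a).1, (natDegree_phiL hσ a).1, (natDegree_charPoly hσ).1,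
    ← Finset.sum_union]
  · exact Finset.sum_le_sum_of_subset (Finset.union_subset (Finset.filter_subset _ _)
      (Finset.filter_subset _ _))
  · rw [Finset.disjoint_left]
    intro y h1 h2
    linarith [(Finset.mem_filter.1 h1).2, (Finset.mem_filter.1 h2).2]

include hσ in
/-- The diagonal of the Green's function has a nonnegative limit at infinity. -/
lemma coeff_phi_mul_phiL_nonneg (a : ℝ) :
    0 ≤ (phi σ a * phiL σ a).coeff (charPoly σ).natDegree * (charPoly σ).leadingCoeff := by
  obtain ⟨h1, h1'⟩ := natDegree_phi hσ a
  obtain ⟨h2, h2'⟩ := natDegree_phiL hσ a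
  obtain ⟨h3, h3'⟩ := natDegree_charPoly hσ
  have hdisj : Disjoint (σ.support.filter (a < ·)) (σ.support.filter (· < a)) := by
    rw [Finset.disjoint_left]
    intro y h1 h2
    linarith [(Finset.mem_filter.1 h1).2, (Finset.mem_filter.1 h2).2]
  by_cases ha : a ∈ σ.support
  -- An atom at `a` itself contributes to neither one-sided solution at `a` but does contribute to
  -- the Wronskian, so the quotient tends to zero.
  · rw [coeff_eq_zero_of_natDegree_lt, zero_mul]
    refine lt_of_le_of_lt natDegree_mul_le ?_
    rw [h1, h2, h3, ← Finset.sum_union hdisj]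
    refine Finset.sum_lt_sum_of_subset (i := a) (Finset.union_subset (Finset.filter_subset _ _)
      (Finset.filter_subset _ _)) ha (by simp) (hσ a ha) (fun _ _ _ => Nat.zero_le _)
  · have hunion : σ.support.filter (a < ·) ∪ σ.support.filter (· < a) = σ.support := by
      ext y
      simp only [Finset.mem_union, Finset.mem_filter]
      refine ⟨fun h => h.elim And.left And.left, fun h => ?_⟩
      rcases lt_trichotomy a y with h' | rfl | h'
      · exact Or.inl ⟨h, h'⟩
      · exact (ha h).elim
      · exact Or.inr ⟨h, h'⟩
    rw [← hunion, Finset.sum_union hdisj, ← h1, ← h2] at h3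
    rw [← hunion, Finset.prod_union hdisj] at h3'
    rw [h3, coeff_mul_degree_add_degree]
    set s := ∏ y ∈ σ.support.filter (a < ·), -(σ y).leadingCoeff
    set t := ∏ y ∈ σ.support.filter (· < a), -(σ y).leadingCoeff
    have h4 := mul_pos (mul_pos h1' h2') h3'
    have h5 : 0 < (s * t) ^ 2 := by
      have : s * t ≠ 0 := right_ne_zero_of_mul h3'.ne'
      positivity
    by_contra hcon
    push Not at hcon
    have h6 := mul_neg_of_neg_of_pos hcon h5
    nlinarith

end Degree

end PhiPolynomial

/-! ### Regularity across atoms and the potential of point masses -/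

section Calculus

variable {E : Type*} [NormedAddCommGroup E] [NormedSpace ℝ E]

lemma hasDerivAt_of_tendsto_punctured {g g' : ℝ → E} {y : ℝ} {d : E} (hc : ContinuousAt g y)
    (hd : ∀ᶠ x in 𝓝[≠] y, HasDerivAt g (g' x) x) (hlim : Tendsto g' (𝓝[≠] y) (𝓝 d)) :
    HasDerivAt g d y := by
  have hlim' : Tendsto (deriv g) (𝓝[≠] y) (𝓝 d) :=
    hlim.congr' (hd.mono fun x hx => hx.deriv.symm)
  have hR : HasDerivWithinAt g d (Set.Ici y) y := by
    refine hasDerivWithinAt_Ici_of_tendsto_deriv (s := {x | HasDerivAt g (g' x) x})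
      (fun x hx => (HasDerivAt.differentiableAt hx).differentiableWithinAt) hc.continuousWithinAt
      (nhdsWithin_mono _ (fun x hx => ne_of_gt hx) hd)
      (hlim'.mono_left (nhdsWithin_mono _ fun x hx => ne_of_gt hx))
  have hL : HasDerivWithinAt g d (Set.Iic y) y := by
    refine hasDerivWithinAt_Iic_of_tendsto_deriv (s := {x | HasDerivAt g (g' x) x})
      (fun x hx => (HasDerivAt.differentiableAt hx).differentiableWithinAt) hc.continuousWithinAt
      (nhdsWithin_mono _ (fun x hx => ne_of_lt hx) hd)
      (hlim'.mono_left (nhdsWithin_mono _ fun x hx => ne_of_lt hx))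
  simpa using hL.union hR

lemma eventually_notMem_finset (S : Finset ℝ) (y : ℝ) : ∀ᶠ x in 𝓝[≠] y, x ∉ S := by
  have h : ∀ᶠ x in 𝓝 y, x ∈ ((S.erase y : Finset ℝ) : Set ℝ)ᶜ :=
    (Finset.finite_toSet _).isClosed.isOpen_compl.mem_nhds (by simp)
  filter_upwards [h.filter_mono nhdsWithin_le_nhds, self_mem_nhdsWithin] with x hx hxy hxS
  exact hx (Finset.mem_coe.2 (Finset.mem_erase.2 ⟨hxy, hxS⟩))

lemma eventually_nhds_notMem_finset {S : Finset ℝ} {y : ℝ} (hy : y ∉ S) :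
    ∀ᶠ x in 𝓝 y, x ∉ S := by
  have : (S : Set ℝ)ᶜ ∈ 𝓝 y := S.finite_toSet.isClosed.isOpen_compl.mem_nhds (by simpa using hy)
  filter_upwards [this] with x hx using by simpa using hx

/-- A `C¹` function with `g'' = g / 4` off a finite set is a combination of exponentials. -/
lemma exists_eq_exp_add_exp {S : Finset ℝ} {g g' : ℝ → E} (hc : Continuous g)
    (hg : ∀ x ∉ S, HasDerivAt g (g' x) x) (hg' : ∀ x ∉ S, HasDerivAt g' ((1 / 4 : ℝ) • g x) x)
    (hS : ∀ y ∈ S, ∃ d, Tendsto g' (𝓝[≠] y) (𝓝 d)) :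
    ∃ a b : E, ∀ x, g x = Real.exp (x / 2) • a + Real.exp (-x / 2) • b := by
  have h1 : ∀ x, HasDerivAt g (deriv g x) x := by
    intro x
    refine DifferentiableAt.hasDerivAt ?_
    by_cases hx : x ∈ S
    · obtain ⟨d, hd⟩ := hS x hx
      exact (hasDerivAt_of_tendsto_punctured hc.continuousAt
        ((eventually_notMem_finset S x).mono hg) hd).differentiableAt
    · exact (hg x hx).differentiableAt
  have heq : ∀ x ∉ S, deriv g =ᶠ[𝓝 x] g' := fun x hx =>
    (eventually_nhds_notMem_finset hx).mono fun w hw => (hg w hw).deriv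
  have h2' : ∀ x ∉ S, HasDerivAt (deriv g) ((1 / 4 : ℝ) • g x) x := fun x hx =>
    (hg' x hx).congr_of_eventuallyEq (heq x hx)
  have h2 : ∀ x, HasDerivAt (deriv g) ((1 / 4 : ℝ) • g x) x := by
    intro x
    by_cases hx : x ∈ S
    · obtain ⟨d, hd⟩ := hS x hx
      have hdx := hasDerivAt_of_tendsto_punctured hc.continuousAt
        ((eventually_notMem_finset S x).mono hg) hd
      have hcont : ContinuousAt (deriv g) x := by
        rw [continuousAt_iff_punctured_nhds, hdx.deriv]
        exact hd.congr' ((eventually_notMem_finset S x).mono fun w hw => (hg w hw).deriv.symm)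
      refine hasDerivAt_of_tendsto_punctured hcont
        ((eventually_notMem_finset S x).mono h2') ?_
      exact ((hc.const_smul (1 / 4 : ℝ)).tendsto x).mono_left nhdsWithin_le_nhds
    · exact h2' x hx
  have hexp : ∀ x : ℝ, HasDerivAt (fun x : ℝ => Real.exp (x / 2)) (Real.exp (x / 2) * (1 / 2)) x :=
    fun x => ((hasDerivAt_id x).div_const 2).exp
  have hexp' : ∀ x : ℝ, HasDerivAt (fun x : ℝ => Real.exp (-x / 2))
      (Real.exp (-x / 2) * (-1 / 2)) x :=
    fun x => ((hasDerivAt_id x).neg.div_const 2).exp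
  have hu : ∀ x, HasDerivAt (fun x => Real.exp (-x / 2) • (deriv g x + (1 / 2 : ℝ) • g x)) 0 x := by
    intro x
    refine ((hexp' x).smul ((h2 x).add ((h1 x).const_smul (1 / 2 : ℝ)))).congr_deriv ?_
    simp only [Pi.add_apply, Pi.smul_apply]
    module
  have hw : ∀ x, HasDerivAt (fun x => Real.exp (x / 2) • (deriv g x - (1 / 2 : ℝ) • g x)) 0 x := by
    intro x
    refine ((hexp x).smul ((h2 x).sub ((h1 x).const_smul (1 / 2 : ℝ)))).congr_deriv ?_
    simp only [Pi.sub_apply, Pi.smul_apply]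
    module
  have hu0 := is_const_of_deriv_eq_zero (fun x => (hu x).differentiableAt) fun x => (hu x).deriv
  have hw0 := is_const_of_deriv_eq_zero (fun x => (hw x).differentiableAt) fun x => (hw x).deriv
  refine ⟨Real.exp (-0 / 2) • (deriv g 0 + (1 / 2 : ℝ) • g 0),
    -(Real.exp (0 / 2) • (deriv g 0 - (1 / 2 : ℝ) • g 0)), fun x => ?_⟩
  have e1 := hu0 x 0
  have e2 := hw0 x 0
  rw [← e1, ← e2, smul_neg, smul_smul, smul_smul, ← Real.exp_add, ← Real.exp_add,
    show x / 2 + -x / 2 = 0 by ring, show -x / 2 + x / 2 = 0 by ring, Real.exp_zero]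
  module

/-- The value at 0 is arbitrary: `kern` has a corner there, and only the one-sided limits 1 and 0
enter. -/
noncomputable def kernDeriv (t : ℝ) : ℝ := if 0 < t then Real.cosh (t / 2) else 0

lemma hasDerivAt_kern {t : ℝ} (ht : t ≠ 0) :
    HasDerivAt kern (kernDeriv t) t ∧ HasDerivAt kernDeriv (1 / 4 * kern t) t := by
  rcases ht.lt_or_gt with h | h
  · have h1 : kern =ᶠ[𝓝 t] fun _ => 0 :=
      (eventually_lt_nhds h).mono fun s hs => kern_of_nonpos hs.le
    have h2 : kernDeriv =ᶠ[𝓝 t] fun _ => 0 :=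
      (eventually_lt_nhds h).mono fun s hs => if_neg hs.not_gt
    rw [h1.eq_of_nhds, h2.eq_of_nhds, mul_zero]
    exact ⟨(hasDerivAt_const t 0).congr_of_eventuallyEq h1,
      (hasDerivAt_const t 0).congr_of_eventuallyEq h2⟩
  · have h1 : kern =ᶠ[𝓝 t] fun s => 2 * Real.sinh (s / 2) :=
      (eventually_gt_nhds h).mono fun s hs => if_pos hs
    have h2 : kernDeriv =ᶠ[𝓝 t] fun s => Real.cosh (s / 2) :=
      (eventually_gt_nhds h).mono fun s hs => if_pos hs
    rw [h1.eq_of_nhds, h2.eq_of_nhds]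
    have h3 : HasDerivAt (fun s : ℝ => s / 2) (1 / 2) t := (hasDerivAt_id t).div_const 2
    exact ⟨((h3.sinh.const_mul 2).congr_deriv (by ring)).congr_of_eventuallyEq h1,
      (h3.cosh.congr_deriv (by ring)).congr_of_eventuallyEq h2⟩

lemma continuous_kern : Continuous kern := by
  have : kern = fun t => 2 * Real.sinh (max t 0 / 2) := by
    ext t
    rcases le_total t 0 with h | h
    · simp [kern_of_nonpos h, h]
    · simp [kern_of_nonneg h, h]
  rw [this]
  fun_prop

lemma tendsto_kernDeriv_right : Tendsto kernDeriv (𝓝[>] 0) (𝓝 1) := by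
  have h : Tendsto (fun t : ℝ => Real.cosh (t / 2)) (𝓝 0) (𝓝 1) := by
    have : Continuous fun t : ℝ => Real.cosh (t / 2) := by fun_prop
    simpa using this.tendsto 0
  refine (h.mono_left nhdsWithin_le_nhds).congr' ?_
  filter_upwards [self_mem_nhdsWithin] with t ht using (if_pos ht).symm

lemma tendsto_kernDeriv_left : Tendsto kernDeriv (𝓝[<] 0) (𝓝 0) := by
  refine tendsto_const_nhds.congr' ?_
  filter_upwards [self_mem_nhdsWithin] with t ht using (if_neg (not_lt.2 (le_of_lt ht))).symm

/-- The potential generated by the point masses `c y` at the points `y ∈ S`. -/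
noncomputable def volt (S : Finset ℝ) (c : ℝ → E) (x : ℝ) : E := ∑ y ∈ S, kern (y - x) • c y

noncomputable def voltDeriv (S : Finset ℝ) (c : ℝ → E) (x : ℝ) : E :=
  ∑ y ∈ S, (-kernDeriv (y - x)) • c y

variable (S : Finset ℝ) (c : ℝ → E)

lemma continuous_volt : Continuous (volt S c) :=
  continuous_finsetSum _ fun _ _ =>
    (continuous_kern.comp (continuous_const.sub continuous_id)).smul continuous_const

lemma hasDerivAt_volt {x : ℝ} (hx : x ∉ S) : HasDerivAt (volt S c) (voltDeriv S c x) x ∧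
    HasDerivAt (voltDeriv S c) ((1 / 4 : ℝ) • volt S c x) x := by
  have hne : ∀ y ∈ S, y - x ≠ 0 := fun y hy => sub_ne_zero.2 fun h => hx (h ▸ hy)
  have hsub : ∀ y, HasDerivAt (fun x : ℝ => y - x) (-1) x := fun y =>
    (hasDerivAt_id x).const_sub y
  constructor
  · refine HasDerivAt.fun_sum fun y hy => HasDerivAt.smul_const ?_ _
    exact ((hasDerivAt_kern (hne y hy)).1.comp x (hsub y)).congr_deriv (by ring)
  · rw [volt, Finset.smul_sum]
    refine HasDerivAt.fun_sum fun y hy => ?_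
    rw [smul_smul]
    refine HasDerivAt.smul_const ?_ _
    exact ((hasDerivAt_kern (hne y hy)).2.comp x (hsub y)).neg.congr_deriv (by ring)

/-- Only the summand centred at `y` is singular at `y`, and its derivative jumps by exactly the mass
`c y`. -/
lemma tendsto_voltDeriv {y : ℝ} (hy : y ∈ S) : ∃ e : E,
    Tendsto (voltDeriv S c) (𝓝[<] y) (𝓝 (e - c y)) ∧
      Tendsto (voltDeriv S c) (𝓝[>] y) (𝓝 e) := by
  classical
  have hsplit : voltDeriv S c = fun x => (-kernDeriv (y - x)) • c y + voltDeriv (S.erase y) c x := by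
    ext x
    rw [voltDeriv, ← Finset.add_sum_erase _ _ hy, voltDeriv]
  have hcont : Tendsto (voltDeriv (S.erase y) c) (𝓝 y) (𝓝 (voltDeriv (S.erase y) c y)) :=
    (hasDerivAt_volt (S.erase y) c (by simp)).2.continuousAt
  have hsub : Tendsto (fun x => y - x) (𝓝 y) (𝓝 0) := by
    have : Continuous fun x : ℝ => y - x := by fun_prop
    simpa using this.tendsto y
  refine ⟨voltDeriv (S.erase y) c y, ?_, ?_⟩ <;> rw [hsplit]
  · have h1 : Tendsto (fun x => kernDeriv (y - x)) (𝓝[<] y) (𝓝 1) := by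
      refine tendsto_kernDeriv_right.comp (tendsto_nhdsWithin_iff.2
        ⟨hsub.mono_left nhdsWithin_le_nhds, ?_⟩)
      filter_upwards [self_mem_nhdsWithin] with x hx using sub_pos.2 (Set.mem_Iio.1 hx)
    have := (h1.neg.smul_const (c y)).add (hcont.mono_left nhdsWithin_le_nhds)
    convert this using 2
    module
  · have h1 : Tendsto (fun x => kernDeriv (y - x)) (𝓝[>] y) (𝓝 0) := by
      refine tendsto_kernDeriv_left.comp (tendsto_nhdsWithin_iff.2
        ⟨hsub.mono_left nhdsWithin_le_nhds, ?_⟩)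
      filter_upwards [self_mem_nhdsWithin] with x hx using sub_neg.2 (Set.mem_Ioi.1 hx)
    have := (h1.neg.smul_const (c y)).add (hcont.mono_left nhdsWithin_le_nhds)
    convert this using 2
    module

end Calculus

/-! ### Solutions of the differential equation and the spectrum -/

/-- The atoms of `z ω + z² v`, as polynomials in `z`. -/
noncomputable def DiscretePair.sigma (p : DiscretePair) : ℝ →₀ ℝ[X] :=
  p.omega.mapRange (fun m => C m * X) (by simp) + p.v.mapRange (fun m => C m * X ^ 2) (by simp)

lemma sigma_apply (p : DiscretePair) (y : ℝ) :
    p.sigma y = C (p.omega y) * X + C (p.v y) * X ^ 2 := by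
  simp [DiscretePair.sigma]

lemma sigma_eq_zero_iff (p : DiscretePair) (y : ℝ) :
    p.sigma y = 0 ↔ p.omega y = 0 ∧ p.v y = 0 := by
  rw [sigma_apply]
  refine ⟨fun h => ⟨?_, ?_⟩, fun h => by simp [h.1, h.2]⟩
  · simpa [coeff_X] using congrArg (fun q => coeff q 1) h
  · simpa [coeff_X] using congrArg (fun q => coeff q 2) h

lemma mem_support_sigma (p : DiscretePair) {y : ℝ} : y ∈ p.sigma.support ↔ y ∈ p.supp := by
  rw [Finsupp.mem_support_iff, Ne, sigma_eq_zero_iff, DiscretePair.supp, Set.mem_ofPred_eq]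
  tauto

lemma natDegree_sigma_pos (p : DiscretePair) : ∀ y ∈ p.sigma.support, 0 < (p.sigma y).natDegree := by
  intro y hy
  rw [Finsupp.mem_support_iff] at hy
  by_contra h
  obtain ⟨c, hc⟩ := natDegree_eq_zero.1 (by omega : (p.sigma y).natDegree = 0)
  have h0 : c = 0 := by
    have := congrArg (eval 0) hc
    simpa [sigma_apply] using this
  exact hy (by rw [← hc, h0, C_0])

section Solutions

variable {𝕜 : Type*} [RCLike 𝕜] (p : DiscretePair) (z : 𝕜)

lemma aeval_sigma_mul (y : ℝ) (w : 𝕜) : aeval z (p.sigma y) * w =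
    z * (p.omega y : 𝕜) * w + z ^ 2 * (p.v y : 𝕜) * w := by
  rw [sigma_apply]
  simp only [map_add, map_mul, map_pow, aeval_X, aeval_C, RCLike.algebraMap_eq_ofReal]
  ring

lemma quarter_smul (w : 𝕜) : w / 4 = (1 / 4 : ℝ) • w := by
  rw [RCLike.real_smul_eq_coe_mul]; push_cast; ring

/-- Adding the potential of the masses σ(y) f(y) cancels the jumps of f' exactly, so the sum solves
the free equation on the whole line and is a combination of two exponentials. The jump problem
thereby becomes a finite Volterra equation. -/
lemma isSolution_iff (f : ℝ → 𝕜) : IsSolution p z f ↔ ∃ a b : 𝕜, ∀ x,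
    f x = Real.exp (x / 2) • a + Real.exp (-x / 2) • b -
      volt p.sigma.support (fun y => aeval z (p.sigma y) * f y) x := by
  set S := p.sigma.support with hS
  set c : ℝ → 𝕜 := fun y => aeval z (p.sigma y) * f y with hc
  constructor
  · intro h
    have hf : ∀ x ∉ S, DifferentiableAt ℝ f x ∧ HasDerivAt (deriv f) (f x / 4) x :=
      fun x hx => h.ode x (fun hx' => hx ((mem_support_sigma p).2 hx'))
    obtain ⟨a, b, hab⟩ := exists_eq_exp_add_exp (S := S) (g := fun x => f x + volt S c x)
      (g' := fun x => deriv f x + voltDeriv S c x) (h.continuous.add (continuous_volt S c))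
      (fun x hx => (hf x hx).1.hasDerivAt.add (hasDerivAt_volt S c hx).1)
      (fun x hx => by
        rw [smul_add, ← quarter_smul]
        exact (hf x hx).2.add (hasDerivAt_volt S c hx).2)
      (fun y hy => by
        obtain ⟨dl, dr, h1, h2, h3⟩ := h.jump y ((mem_support_sigma p).1 hy)
        obtain ⟨e, h4, h5⟩ := tendsto_voltDeriv S c hy
        refine ⟨dr + e, ?_⟩
        rw [← nhdsLT_sup_nhdsGT, tendsto_sup]
        refine ⟨?_, h2.add h5⟩
        convert h1.add h4 using 2
        simp only [hc]
        rw [h3, aeval_sigma_mul]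
        ring)
    exact ⟨a, b, fun x => eq_sub_of_add_eq (hab x)⟩
  · rintro ⟨a, b, hab⟩
    set g : ℝ → 𝕜 := fun x => Real.exp (x / 2) • a + Real.exp (-x / 2) • b with hg
    set g' : ℝ → 𝕜 := fun x => (Real.exp (x / 2) * (1 / 2)) • a + (Real.exp (-x / 2) * (-1 / 2)) • b
      with hg'
    have hexp : ∀ x : ℝ, HasDerivAt (fun x : ℝ => Real.exp (x / 2)) (Real.exp (x / 2) * (1 / 2)) x :=
      fun x => ((hasDerivAt_id x).div_const 2).exp
    have hexp' : ∀ x : ℝ, HasDerivAt (fun x : ℝ => Real.exp (-x / 2))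
        (Real.exp (-x / 2) * (-1 / 2)) x :=
      fun x => ((hasDerivAt_id x).neg.div_const 2).exp
    have hgd : ∀ x, HasDerivAt g (g' x) x := fun x =>
      ((hexp x).smul_const a).add ((hexp' x).smul_const b)
    have hgd' : ∀ x, HasDerivAt g' ((1 / 4 : ℝ) • g x) x := fun x => by
      refine ((((hexp x).mul_const (1 / 2)).smul_const a).add
        (((hexp' x).mul_const (-1 / 2)).smul_const b)).congr_deriv ?_
      simp only [hg]
      module
    have hf : f = fun x => g x - volt S c x := funext hab
    have hfd : ∀ x ∉ S, HasDerivAt f (g' x - voltDeriv S c x) x := fun x hx => by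
      rw [hf]; exact (hgd x).sub (hasDerivAt_volt S c hx).1
    refine ⟨?_, fun x hx => ?_, fun y hy => ?_⟩
    · rw [hf]
      exact (continuous_iff_continuousAt.2 fun x => (hgd x).continuousAt).sub (continuous_volt S c)
    · have hx' : x ∉ S := fun h => hx ((mem_support_sigma p).1 h)
      refine ⟨(hfd x hx').differentiableAt, ?_⟩
      have h1 : deriv f =ᶠ[𝓝 x] fun x => g' x - voltDeriv S c x :=
        (eventually_nhds_notMem_finset hx').mono fun w hw => (hfd w hw).deriv
      refine HasDerivAt.congr_of_eventuallyEq ?_ h1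
      refine ((hgd' x).sub (hasDerivAt_volt S c hx').2).congr_deriv ?_
      have hfx : f x = g x - volt S c x := hab x
      rw [hfx, quarter_smul (g x - volt S c x)]
      exact (smul_sub (1 / 4 : ℝ) (g x) (volt S c x)).symm
    · have hy' : y ∈ S := (mem_support_sigma p).2 hy
      obtain ⟨e, h4, h5⟩ := tendsto_voltDeriv S c hy'
      have h1 : deriv f =ᶠ[𝓝[≠] y] fun x => g' x - voltDeriv S c x :=
        (eventually_notMem_finset S y).mono fun w hw => (hfd w hw).deriv
      have hgc : Tendsto g' (𝓝 y) (𝓝 (g' y)) := (hgd' y).continuousAt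
      refine ⟨g' y - (e - c y), g' y - e, ?_, ?_, ?_⟩
      · exact ((hgc.mono_left nhdsWithin_le_nhds).sub h4).congr'
          (h1.symm.filter_mono (nhdsWithin_mono _ fun x hx => ne_of_lt hx))
      · exact ((hgc.mono_left nhdsWithin_le_nhds).sub h5).congr'
          (h1.symm.filter_mono (nhdsWithin_mono _ fun x hx => ne_of_gt hx))
      · rw [add_assoc, ← aeval_sigma_mul]
        simp only [hc]
        ring

lemma aeval_phi_eq (x : ℝ) : aeval z (phi p.sigma x) = Real.exp (x / 2) • (0 : 𝕜) +
    Real.exp (-x / 2) • (1 : 𝕜) -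
      volt p.sigma.support (fun y => aeval z (p.sigma y) * aeval z (phi p.sigma y)) x := by
  conv_lhs => rw [phi_eq_sum]
  simp [volt, map_sum, Algebra.smul_def]

lemma isSolution_phi : IsSolution p z fun x => aeval z (phi p.sigma x) :=
  (isSolution_iff p z _).2 ⟨0, 1, aeval_phi_eq p z⟩

/-- The value at x is determined by the values at nodes strictly to the right of x, so induction on
their number applies. -/
lemma volterra_unique {R : Type*} [Ring R] [Module ℝ R] {S : Finset ℝ} {s e f g : ℝ → R}
    (hf : ∀ x, f x = e x - ∑ y ∈ S, kern (y - x) • (s y * f y))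
    (hg : ∀ x, g x = e x - ∑ y ∈ S, kern (y - x) • (s y * g y)) : f = g := by
  funext x
  induction hn : (S.filter (x < ·)).card using Nat.strong_induction_on generalizing x with
  | _ n ih =>
    rw [hf, hg]
    congr 1
    refine Finset.sum_congr rfl fun y hy => ?_
    rcases le_or_gt y x with h | h
    · simp [kern_of_nonpos (sub_nonpos.2 h)]
    rw [ih _ ?_ y rfl]
    rw [← hn]
    refine Finset.card_lt_card ⟨fun w hw => ?_, fun hss => ?_⟩
    · rw [Finset.mem_filter] at hw ⊢
      exact ⟨hw.1, h.trans hw.2⟩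
    · exact lt_irrefl _ (Finset.mem_filter.1 (hss (Finset.mem_filter.2 ⟨hy, h⟩))).2

lemma eq_phi_mul {f : ℝ → 𝕜} {b : 𝕜} (hf : ∀ x, f x = Real.exp (x / 2) • (0 : 𝕜) +
    Real.exp (-x / 2) • b - volt p.sigma.support (fun y => aeval z (p.sigma y) * f y) x) :
    f = fun x => aeval z (phi p.sigma x) * b := by
  refine volterra_unique (S := p.sigma.support) (s := fun y => aeval z (p.sigma y)) hf fun x => ?_
  rw [aeval_phi_eq, sub_mul, volt, Finset.sum_mul]
  congr 1
  · simp
  · refine Finset.sum_congr rfl fun y _ => ?_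
    rw [smul_mul_assoc, mul_assoc]

lemma volt_eq_zero {S : Finset ℝ} {c : ℝ → 𝕜} {x : ℝ} (h : ∀ y ∈ S, y ≤ x) : volt S c x = 0 :=
  Finset.sum_eq_zero fun y hy => by rw [kern_of_nonpos (sub_nonpos.2 (h y hy)), zero_smul]

lemma eventually_forall_le_atTop (S : Finset ℝ) : ∀ᶠ x in atTop, ∀ y ∈ S, y ≤ x :=
  (Finset.eventually_all S).2 fun y _ => eventually_ge_atTop y

lemma eventually_forall_le_atBot (S : Finset ℝ) : ∀ᶠ x in atBot, ∀ y ∈ S, x ≤ y :=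
  (Finset.eventually_all S).2 fun y _ => eventually_le_atBot y

lemma isPhiPlus_iff (lam : ℝ) (f : ℝ → ℝ) :
    IsPhiPlus p lam f ↔ f = fun x => (phi p.sigma x).eval lam := by
  constructor
  · rintro ⟨h1, h2⟩
    obtain ⟨a, b, hab⟩ := (isSolution_iff p lam f).1 h1
    have h3 : ∀ᶠ x in atTop, Real.exp x * a + b = 1 := by
      filter_upwards [h2, eventually_forall_le_atTop p.sigma.support] with x hx hS
      rw [hab x, volt_eq_zero hS, sub_zero, smul_eq_mul, smul_eq_mul] at hx
      have h4 : Real.exp (x / 2) = Real.exp x * Real.exp (-x / 2) := by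
        rw [← Real.exp_add]; congr 1; ring
      rw [h4] at hx
      have := Real.exp_pos (-x / 2)
      refine mul_right_cancel₀ this.ne' ?_
      linear_combination hx
    obtain ⟨x, hx1, hx2⟩ := (h3.and ((tendsto_atTop_add_const_right atTop (1 : ℝ)
      tendsto_id).eventually h3)).exists
    have ha : a = 0 := by
      have h5 : Real.exp x < Real.exp (x + 1) := Real.exp_lt_exp.2 (by linarith)
      have h6 : (Real.exp (x + 1) - Real.exp x) * a = 0 := by
        simp only [id] at hx2; linear_combination hx2 - hx1
      exact (mul_eq_zero.1 h6).resolve_left (sub_pos.2 h5).ne'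
    have hb : b = 1 := by simpa [ha] using hx1
    subst ha hb
    have := eq_phi_mul p lam hab
    simpa [coe_aeval_eq_eval] using this
  · rintro rfl
    have h1 := isSolution_phi p lam
    simp only [coe_aeval_eq_eval] at h1
    refine ⟨h1, ?_⟩
    filter_upwards [eventually_forall_le_atTop p.sigma.support] with x hS
    have := aeval_phi_eq p lam x
    rw [volt_eq_zero hS] at this
    simpa [coe_aeval_eq_eval] using this

lemma volt_left {S : Finset ℝ} {c : ℝ → 𝕜} {x : ℝ} (h : ∀ y ∈ S, x ≤ y) :
    volt S c x = Real.exp (-x / 2) • ∑ y ∈ S, Real.exp (y / 2) • c y -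
      Real.exp (x / 2) • ∑ y ∈ S, Real.exp (-y / 2) • c y := by
  rw [volt, Finset.smul_sum, Finset.smul_sum, ← Finset.sum_sub_distrib]
  refine Finset.sum_congr rfl fun y hy => ?_
  rw [kern_sub_of_le (h y hy)]
  module

lemma tendsto_exp_half_atTop : Tendsto (fun x : ℝ => Real.exp (x / 2)) atTop atTop :=
  Real.tendsto_exp_atTop.comp (tendsto_id.atTop_div_const two_pos)

lemma tendsto_exp_neg_half_atBot : Tendsto (fun x : ℝ => Real.exp (-x / 2)) atBot atTop :=
  Real.tendsto_exp_atTop.comp (tendsto_neg_atBot_atTop.atTop_div_const two_pos)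

lemma aeval_charPoly : aeval z (charPoly p.sigma) = 1 - ∑ y ∈ p.sigma.support,
    Real.exp (y / 2) • (aeval z (p.sigma y) * aeval z (phi p.sigma y)) := by
  simp [charPoly, map_sum, Algebra.smul_def]

/-- Boundedness at +∞ kills the growing exponential, leaving a multiple of `phi`; boundedness at -∞
then demands that the coefficient of e^{-x/2} there, a nonzero multiple of `charPoly`, vanish. -/
lemma mem_spectrumH_iff (z : ℂ) : z ∈ spectrumH p ↔ aeval z (charPoly p.sigma) = 0 := by
  set S := p.sigma.support with hS
  constructor
  · rintro ⟨f, hf, hf0, K, hK⟩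
    obtain ⟨a, b, hab⟩ := (isSolution_iff p z f).1 hf
    have ha : a = 0 := by
      by_contra ha
      have h1 : Tendsto (fun x : ℝ => Real.exp (x / 2) * ‖a‖) atTop atTop :=
        tendsto_exp_half_atTop.atTop_mul_const (norm_pos_iff.2 ha)
      obtain ⟨x, hx1, hx2, hx3⟩ := ((h1.eventually_gt_atTop (K + ‖b‖)).and
        ((eventually_forall_le_atTop S).and (eventually_ge_atTop 0))).exists
      have h2 := hab x
      rw [volt_eq_zero hx2, sub_zero] at h2
      have h3 : ‖Real.exp (x / 2) • a‖ ≤ ‖f x‖ + ‖Real.exp (-x / 2) • b‖ := by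
        rw [eq_sub_of_add_eq h2.symm]; exact norm_sub_le _ _
      rw [norm_smul, norm_smul, Real.norm_of_nonneg (Real.exp_pos _).le,
        Real.norm_of_nonneg (Real.exp_pos _).le] at h3
      have h4 : Real.exp (-x / 2) ≤ 1 := Real.exp_le_one_iff.2 (by linarith)
      nlinarith [hK x, norm_nonneg b]
    subst ha
    have hfb := eq_phi_mul p z hab
    have hb : b ≠ 0 := by
      rintro rfl
      exact hf0 (by rw [hfb]; ext; simp)
    have hsum : b - ∑ y ∈ S, Real.exp (y / 2) • (aeval z (p.sigma y) * f y) =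
        aeval z (charPoly p.sigma) * b := by
      rw [aeval_charPoly, sub_mul, one_mul, Finset.sum_mul, hfb]
      congr 1
      exact Finset.sum_congr rfl fun y _ => by rw [smul_mul_assoc, mul_assoc]
    set b' := b - ∑ y ∈ S, Real.exp (y / 2) • (aeval z (p.sigma y) * f y) with hb'
    set a' := ∑ y ∈ S, Real.exp (-y / 2) • (aeval z (p.sigma y) * f y) with ha'
    have hb0 : b' = 0 := by
      by_contra hb0
      have h1 : Tendsto (fun x : ℝ => Real.exp (-x / 2) * ‖b'‖) atBot atTop :=
        tendsto_exp_neg_half_atBot.atTop_mul_const (norm_pos_iff.2 hb0)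
      obtain ⟨x, hx1, hx2, hx3⟩ := ((h1.eventually_gt_atTop (K + ‖a'‖)).and
        ((eventually_forall_le_atBot S).and (eventually_le_atBot 0))).exists
      have h2 : f x = Real.exp (-x / 2) • b' + Real.exp (x / 2) • a' := by
        rw [hab x, volt_left hx2, hb', ha', smul_sub, smul_zero, zero_add]; abel
      have h3 : ‖Real.exp (-x / 2) • b'‖ ≤ ‖f x‖ + ‖Real.exp (x / 2) • a'‖ := by
        rw [eq_sub_of_add_eq h2.symm]; exact norm_sub_le _ _
      rw [norm_smul, norm_smul, Real.norm_of_nonneg (Real.exp_pos _).le,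
        Real.norm_of_nonneg (Real.exp_pos _).le] at h3
      have h4 : Real.exp (x / 2) ≤ 1 := Real.exp_le_one_iff.2 (by linarith)
      nlinarith [hK x, norm_nonneg a']
    rw [hb0] at hsum
    exact (mul_eq_zero.1 hsum.symm).resolve_right hb
  · intro hz
    have hsol := isSolution_phi p z
    set f : ℝ → ℂ := fun x => aeval z (phi p.sigma x) with hf
    obtain ⟨R, hR1, hR2⟩ := ((eventually_forall_le_atTop S).and (eventually_ge_atTop 0)).exists
    obtain ⟨L, hL1, hL2⟩ := ((eventually_forall_le_atBot S).and (eventually_le_atBot 0)).exists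
    set a' := ∑ y ∈ S, Real.exp (-y / 2) • (aeval z (p.sigma y) * f y) with ha'
    have hright : ∀ x, R ≤ x → f x = Real.exp (-x / 2) • (1 : ℂ) := by
      intro x hx
      have := aeval_phi_eq p z x
      rw [volt_eq_zero fun y hy => (hR1 y hy).trans hx] at this
      simpa using this
    have hleft : ∀ x, x ≤ L → f x = Real.exp (x / 2) • a' := by
      intro x hx
      have h1 := aeval_phi_eq p z x
      rw [volt_left fun y hy => hx.trans (hL1 y hy)] at h1
      have h2 := (aeval_charPoly p z).symm.trans hz
      rw [← sub_eq_zero.1 h2] at h1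
      simp only [hf, ha']
      rw [h1]; simp
    refine ⟨f, hsol, fun h => ?_, ?_⟩
    · have := hright R le_rfl
      rw [h] at this
      simp at this
      exact Complex.exp_ne_zero _ this.symm
    · obtain ⟨K, hK⟩ := (isCompact_Icc (a := L) (b := R)).exists_bound_of_continuousOn
        hsol.continuous.continuousOn
      refine ⟨max K (max 1 ‖a'‖), fun x => ?_⟩
      rcases le_or_gt x L with h | h
      · rw [hleft x h, norm_smul, Real.norm_of_nonneg (Real.exp_pos _).le]
        have h4 : Real.exp (x / 2) ≤ 1 := Real.exp_le_one_iff.2 (by linarith)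
        exact (mul_le_of_le_one_left (norm_nonneg _) h4).trans
          ((le_max_right _ _).trans (le_max_right _ _))
      rcases le_or_gt R x with h' | h'
      · rw [hright x h', norm_smul, Real.norm_of_nonneg (Real.exp_pos _).le, norm_one, mul_one]
        exact (Real.exp_le_one_iff.2 (by linarith)).trans
          ((le_max_left _ _).trans (le_max_right _ _))
      · exact (hK x ⟨h.le, h'.le⟩).trans (le_max_left _ _)

end Solutions

/-! ### Positivity of the norming constants and the derivative of the Wronskian -/

lemma exp_min_kernel_pos (a : ℝ → ℝ) (S : Finset ℝ) : ∀ b, (∀ x ∈ S, b < Real.exp x) →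
    0 ≤ ∑ x ∈ S, ∑ y ∈ S, (Real.exp (min x y) - b) * (a x * a y) ∧
      (∑ x ∈ S, ∑ y ∈ S, (Real.exp (min x y) - b) * (a x * a y) = 0 → ∀ x ∈ S, a x = 0) := by
  classical
  induction S using Finset.induction_on_min with
  | empty => simp
  | insert m S hm ih =>
    intro b hb
    have hmS : m ∉ S := fun h => lt_irrefl _ (hm m h)
    obtain ⟨ih1, ih2⟩ := ih (Real.exp m) fun x hx => Real.exp_lt_exp.2 (hm x hx)
    -- Replacing `b` by e^m makes the row and column of the minimal point `m` vanish; the correction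
    -- is a rank-one square. This is why the induction carries a variable `b`.
    have key : ∑ x ∈ insert m S, ∑ y ∈ insert m S, (Real.exp (min x y) - b) * (a x * a y) =
        ∑ x ∈ S, ∑ y ∈ S, (Real.exp (min x y) - Real.exp m) * (a x * a y) +
          (Real.exp m - b) * (∑ x ∈ insert m S, a x) ^ 2 := by
      have h1 : ∑ x ∈ insert m S, ∑ y ∈ insert m S, (Real.exp (min x y) - b) * (a x * a y) =
          ∑ x ∈ insert m S, ∑ y ∈ insert m S, (Real.exp (min x y) - Real.exp m) * (a x * a y) +
          (Real.exp m - b) * (∑ x ∈ insert m S, a x) ^ 2 := by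
        rw [sq, Finset.sum_mul_sum, Finset.mul_sum, ← Finset.sum_add_distrib]
        refine Finset.sum_congr rfl fun x _ => ?_
        rw [Finset.mul_sum, ← Finset.sum_add_distrib]
        exact Finset.sum_congr rfl fun y _ => by ring
      rw [h1]
      congr 1
      rw [Finset.sum_insert hmS, Finset.sum_eq_zero (s := insert m S), zero_add]
      · refine Finset.sum_congr rfl fun x hx => ?_
        rw [Finset.sum_insert hmS, min_eq_right (hm x hx).le, sub_self, zero_mul, zero_add]
      · intro y hy
        have : m ≤ y := by
          rcases Finset.mem_insert.1 hy with rfl | h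
          · exact le_rfl
          · exact (hm y h).le
        rw [min_eq_left this, sub_self, zero_mul]
    have hbm := sub_pos.2 (hb m (Finset.mem_insert_self _ _))
    rw [key]
    refine ⟨by positivity, fun h => ?_⟩
    have h1 : (Real.exp m - b) * (∑ x ∈ insert m S, a x) ^ 2 = 0 := by
      have : 0 ≤ (Real.exp m - b) * (∑ x ∈ insert m S, a x) ^ 2 := by positivity
      linarith
    have h2 := ih2 (by linarith)
    have h3 : ∑ x ∈ insert m S, a x = 0 := by
      have := (mul_eq_zero.1 h1).resolve_left hbm.ne'
      exact pow_eq_zero_iff two_ne_zero |>.1 this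
    rw [Finset.sum_insert hmS, Finset.sum_eq_zero h2, add_zero] at h3
    intro x hx
    rcases Finset.mem_insert.1 hx with rfl | h
    · exact h3
    · exact h2 x h

lemma exists_eval_phi_eq_exp (σ : ℝ →₀ ℝ[X]) (lam : ℝ) :
    ∃ x, (phi σ x).eval lam = Real.exp (-x / 2) := by
  obtain ⟨x, hx⟩ := (eventually_forall_le_atTop σ.support).exists
  refine ⟨x, ?_⟩
  rw [phi_eq_sum, Finset.sum_eq_zero]
  · simp
  · intro y hy
    rw [kern_of_nonpos (sub_nonpos.2 (hx y hy))]; simp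

lemma eval_phi_eq (σ : ℝ →₀ ℝ[X]) (lam x : ℝ) : (phi σ x).eval lam = Real.exp (-x / 2) -
    ∑ y ∈ σ.support, kern (y - x) * ((σ y).eval lam * (phi σ y).eval lam) := by
  conv_lhs => rw [phi_eq_sum]
  simp [eval_finsetSum]

section Eigenvalue

variable {σ : ℝ →₀ ℝ[X]} {lam : ℝ} (hlam : (charPoly σ).eval lam = 0)

lemma sum_exp_eq_one (hlam : (charPoly σ).eval lam = 0) :
    ∑ y ∈ σ.support, Real.exp (y / 2) * ((σ y).eval lam * (phi σ y).eval lam) = 1 := by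
  simp only [charPoly, eval_sub, eval_one, eval_finsetSum, eval_mul, eval_C] at hlam
  linarith

include hlam in
-- When W vanishes, the kernel of the equation for `phi` can be flipped from the right to the left
-- side, and `phi` satisfies the equation of `phiL` up to a scalar. The scalar is nonzero because
-- `phi` is not identically zero.
lemma exists_phiL_eq_mul :
    ∃ κ : ℝ, κ ≠ 0 ∧ ∀ x, (phiL σ x).eval lam = κ * (phi σ x).eval lam := by
  have hsum := sum_exp_eq_one hlam
  set a := ∑ y ∈ σ.support, Real.exp (-y / 2) * ((σ y).eval lam * (phi σ y).eval lam) with ha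
  have h1 : ∀ x, (phi σ x).eval lam = Real.exp (x / 2) * a -
      ∑ y ∈ σ.support, kern (x - y) * ((σ y).eval lam * (phi σ y).eval lam) := by
    intro x
    have h2 : ∑ y ∈ σ.support, kern (y - x) * ((σ y).eval lam * (phi σ y).eval lam) =
        ∑ y ∈ σ.support, kern (x - y) * ((σ y).eval lam * (phi σ y).eval lam) +
        (Real.exp (-x / 2) *
          ∑ y ∈ σ.support, Real.exp (y / 2) * ((σ y).eval lam * (phi σ y).eval lam) -
        Real.exp (x / 2) * a) := by
      rw [ha, Finset.mul_sum, Finset.mul_sum, ← Finset.sum_sub_distrib, ← Finset.sum_add_distrib]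
      refine Finset.sum_congr rfl fun y _ => ?_
      linear_combination ((σ y).eval lam * (phi σ y).eval lam) * kern_sub_kern x y
    rw [eval_phi_eq, h2, hsum]; ring
  have h3 : (fun x => (phi σ (-x)).eval lam) = fun x => (phi (mirror σ) x).eval lam * a := by
    refine volterra_unique (S := (mirror σ).support) (s := fun y => (mirror σ y).eval lam)
      (e := fun x => Real.exp (-x / 2) * a) (fun x => ?_) fun x => ?_
    · rw [sum_mirror_support, h1]
      congr 1
      refine Finset.sum_congr rfl fun y _ => ?_
      rw [mirror_apply, neg_neg, smul_eq_mul]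
      congr 2; ring
    · rw [eval_phi_eq, sub_mul, Finset.sum_mul]
      congr 1
      exact Finset.sum_congr rfl fun y _ => by rw [smul_eq_mul]; ring
  have ha0 : a ≠ 0 := by
    intro ha0
    obtain ⟨x, hx⟩ := exists_eval_phi_eq_exp σ lam
    have := congrFun h3 (-x)
    simp only [neg_neg, hx, ha0, mul_zero] at this
    exact (Real.exp_pos _).ne' this
  refine ⟨a⁻¹, inv_ne_zero ha0, fun x => ?_⟩
  have := congrFun h3 (-x)
  simp only [neg_neg] at this
  rw [this, phiL]
  field_simp

include hlam in
-- At an eigenvalue, φ(x) = ∑ e^{-|x-y|/2} σ(y) φ(y), so the sum is the quadratic form of the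
-- positive definite kernel e^{-|x-y|/2} = e^{-x/2} e^{min(x,y)} e^{-y/2}. In continuous terms it is
-- the energy ∫ (f'² + f²/4).
lemma sum_mul_sq_phi_pos :
    0 < ∑ y ∈ σ.support, (σ y).eval lam * (phi σ y).eval lam ^ 2 := by
  have hsum := sum_exp_eq_one hlam
  set u : ℝ → ℝ := fun y => (σ y).eval lam * (phi σ y).eval lam with hu
  set a : ℝ → ℝ := fun y => Real.exp (-y / 2) * u y with ha
  obtain ⟨h1, h2⟩ := exp_min_kernel_pos a σ.support 0 fun x _ => Real.exp_pos x
  have hf : ∀ x, (phi σ x).eval lam =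
      ∑ y ∈ σ.support, Real.exp (-x / 2) * Real.exp (min x y) * a y := by
    intro x
    have h3 : (phi σ x).eval lam = Real.exp (-x / 2) * ∑ y ∈ σ.support, Real.exp (y / 2) * u y -
        ∑ y ∈ σ.support, kern (y - x) * u y := by
      rw [hsum, mul_one, eval_phi_eq]
    rw [h3, Finset.mul_sum, ← Finset.sum_sub_distrib]
    refine Finset.sum_congr rfl fun y _ => ?_
    have h4 : Real.exp (y / 2) * Real.exp (-y / 2) = 1 := by
      rw [← Real.exp_add, ← Real.exp_zero]; congr 1; ring
    have h5 : ∀ t : ℝ, Real.exp t = Real.exp (t / 2) * Real.exp (t / 2) := fun t => by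
      rw [← Real.exp_add]; congr 1; ring
    have h6 : Real.exp (x / 2) * Real.exp (-x / 2) = 1 := by
      rw [← Real.exp_add, ← Real.exp_zero]; congr 1; ring
    simp only [ha]
    rcases le_total x y with h | h
    · rw [kern_sub_of_le h, min_eq_left h, h5 x]
      linear_combination -Real.exp (x / 2) * Real.exp (-y / 2) * u y * h6
    · rw [kern_of_nonpos (sub_nonpos.2 h), min_eq_right h, h5 y]
      linear_combination -Real.exp (-x / 2) * Real.exp (y / 2) * u y * h4
  have hS : ∑ y ∈ σ.support, (σ y).eval lam * (phi σ y).eval lam ^ 2 =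
      ∑ x ∈ σ.support, ∑ y ∈ σ.support, (Real.exp (min x y) - 0) * (a x * a y) := by
    refine Finset.sum_congr rfl fun x _ => ?_
    calc (σ x).eval lam * (phi σ x).eval lam ^ 2 = u x * (phi σ x).eval lam := by
          simp only [hu]; ring
      _ = _ := by
          rw [hf, Finset.mul_sum]
          exact Finset.sum_congr rfl fun y _ => by simp only [ha]; ring
  rw [hS]
  refine lt_of_le_of_ne h1 fun h => ?_
  have h3 := h2 h.symm
  obtain ⟨x, hx⟩ := exists_eval_phi_eq_exp σ lam
  rw [hf, Finset.sum_eq_zero fun y hy => by rw [h3 y hy, mul_zero]] at hx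
  exact (Real.exp_pos _).ne hx

end Eigenvalue

lemma eval_sigma (p : DiscretePair) (lam y : ℝ) :
    (p.sigma y).eval lam = lam * p.omega y + lam ^ 2 * p.v y := by
  rw [sigma_apply]; simp; ring

lemma gammaSq_eq (p : DiscretePair) (lam : ℝ) (f : ℝ → ℝ) : gammaSq p lam f =
    ∑ y ∈ p.sigma.support, (p.omega y + 2 * lam * p.v y) * f y ^ 2 := by
  have h1 : p.omega.support ⊆ p.sigma.support := fun y hy => by
    rw [mem_support_sigma]; exact Or.inl (Finsupp.mem_support_iff.1 hy)
  have h2 : p.v.support ⊆ p.sigma.support := fun y hy => by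
    rw [mem_support_sigma]; exact Or.inr (Finsupp.mem_support_iff.1 hy)
  rw [gammaSq, Finsupp.sum_of_support_subset _ h1 _ (by simp),
    Finsupp.sum_of_support_subset _ h2 _ (by simp), Finset.mul_sum, ← Finset.sum_add_distrib]
  exact Finset.sum_congr rfl fun y _ => by rw [sq_abs]; ring

/-- The norming constant `λ γ²` belonging to the parameter `λ`. -/
noncomputable def norming (p : DiscretePair) (lam : ℝ) : ℝ :=
  lam * gammaSq p lam fun x => (phi p.sigma x).eval lam

/-- Compared with the energy ∑ σ(λ) φ², the norming constant counts the term λ² v φ² twice, and that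
term is nonnegative. -/
lemma norming_pos (p : DiscretePair) {lam : ℝ} (hlam : (charPoly p.sigma).eval lam = 0) :
    0 < norming p lam := by
  have h1 := sum_mul_sq_phi_pos hlam
  have h2 : norming p lam = ∑ y ∈ p.sigma.support,
      (p.sigma y).eval lam * (phi p.sigma y).eval lam ^ 2 +
      ∑ y ∈ p.sigma.support, lam ^ 2 * p.v y * (phi p.sigma y).eval lam ^ 2 := by
    rw [norming, gammaSq_eq, Finset.mul_sum, ← Finset.sum_add_distrib]
    exact Finset.sum_congr rfl fun y _ => by rw [eval_sigma]; ring
  rw [h2]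
  refine add_pos_of_pos_of_nonneg h1 (Finset.sum_nonneg fun y _ => ?_)
  have := p.v_nonneg y
  positivity

/-- The derivative of the characteristic polynomial at an eigenvalue. -/
lemma neg_mul_derivative_charPoly (p : DiscretePair) {lam κ : ℝ}
    (hκ : ∀ x, (phiL p.sigma x).eval lam = κ * (phi p.sigma x).eval lam) :
    -(lam * (charPoly p.sigma).derivative.eval lam) = κ * norming p lam := by
  -- The difference quotient of the Wronskian: the factor z - λ has been divided out of σ(z) - σ(λ)
  -- in `charPoly_sub`, so that evaluating at λ gives the derivative.
  set G : ℝ[X] := ∑ y ∈ p.sigma.support, (C (p.omega y) + (X + C lam) * C (p.v y)) *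
    (phi p.sigma y * C ((phiL p.sigma y).eval lam)) with hG
  have h1 : C ((charPoly p.sigma).eval lam) - charPoly p.sigma = (X - C lam) * G := by
    refine Polynomial.funext fun z => ?_
    rw [eval_sub, eval_C, charPoly_sub, hG, eval_mul, eval_finsetSum, Finset.mul_sum]
    refine Finset.sum_congr rfl fun y _ => ?_
    simp only [eval_sigma, eval_sub, eval_X, eval_C, eval_mul, eval_add]
    ring
  have h2 := congrArg (fun q => q.derivative.eval lam) h1
  simp only [derivative_sub, derivative_mul, derivative_C, derivative_X, eval_sub, eval_add,
    eval_mul, eval_X, eval_C, eval_one, eval_zero] at h2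
  have h3 : G.eval lam = κ * gammaSq p lam fun x => (phi p.sigma x).eval lam := by
    rw [hG, eval_finsetSum, gammaSq_eq, Finset.mul_sum]
    refine Finset.sum_congr rfl fun y _ => ?_
    simp only [eval_X, eval_C, eval_mul, eval_add, hκ]
    ring
  rw [norming]
  linear_combination lam * h2 + lam * h3

lemma eval_charPoly_zero (p : DiscretePair) : (charPoly p.sigma).eval 0 = 1 := by
  simp [charPoly, eval_finsetSum, eval_sigma]

lemma eval_phi_zero (p : DiscretePair) (x : ℝ) : (phi p.sigma x).eval 0 = Real.exp (-x / 2) := by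
  rw [eval_phi_eq]
  simp [eval_sigma]

lemma eval_phiL_zero (p : DiscretePair) (x : ℝ) : (phiL p.sigma x).eval 0 = Real.exp (x / 2) := by
  rw [phiL_eq_sum]
  simp [eval_finsetSum, eval_sigma]

/-! ### The inverse problem on a half-line -/

/-- The atoms of `z ω`, as polynomials in `z`. -/
noncomputable def stringAtoms (ω : ℝ →₀ ℝ) : ℝ →₀ ℝ[X] := ω.mapRange (fun m => C m * X) (by simp)

lemma stringAtoms_apply (ω : ℝ →₀ ℝ) (y : ℝ) : stringAtoms ω y = C (ω y) * X := rfl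

lemma mem_support_stringAtoms {ω : ℝ →₀ ℝ} {y : ℝ} : y ∈ (stringAtoms ω).support ↔ ω y ≠ 0 := by
  simp [stringAtoms_apply]

lemma natDegree_le_of_coeff_succ {p : ℝ[X]} {n : ℕ} (h : p.natDegree ≤ n + 1)
    (h' : p.coeff (n + 1) = 0) : p.natDegree ≤ n := by
  rw [natDegree_le_iff_coeff_eq_zero]
  intro m hm
  rcases (Nat.succ_le_of_lt hm).eq_or_lt with rfl | hlt
  · exact h'
  · exact coeff_eq_zero_of_natDegree_lt (h.trans_lt hlt)

/-- Multiplying the equation by e^{x/2} turns it into e^x = e^a - e^{a/2}/T, which exceeds e^a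
because T < 0. -/
lemma exists_position {a T : ℝ} (hT : T < 0) : ∃ x : ℝ, a < x ∧
    0 < Real.exp (x / 2) - Real.exp (a - x / 2) ∧
    Real.exp ((a - x) / 2) + (Real.exp (x / 2) - Real.exp (a - x / 2)) * T = 0 := by
  have hpos : 0 < -(Real.exp (a / 2) / T) := by
    rw [← div_neg]; exact div_pos (Real.exp_pos _) (by linarith)
  have hx := Real.exp_log (show 0 < Real.exp a + -(Real.exp (a / 2) / T) by positivity)
  set x := Real.log (Real.exp a + -(Real.exp (a / 2) / T))
  have hax : a < x := by
    rw [← Real.exp_lt_exp, hx]; linarith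
  refine ⟨x, hax, sub_pos.2 (Real.exp_lt_exp.2 (by linarith)), ?_⟩
  have h1 : Real.exp ((a - x) / 2) = Real.exp (a / 2) * Real.exp (-x / 2) := by
    rw [← Real.exp_add]; congr 1; ring
  have h2 : Real.exp (x / 2) = Real.exp x * Real.exp (-x / 2) := by
    rw [← Real.exp_add]; congr 1; ring
  have h3 : Real.exp (a - x / 2) = Real.exp a * Real.exp (-x / 2) := by
    rw [← Real.exp_add]; congr 1; ring
  have h4 : Real.exp (a / 2) / T * T = Real.exp (a / 2) := div_mul_cancel₀ _ hT.ne
  rw [h1, h2, h3, hx]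
  linear_combination -Real.exp (-x / 2) * h4

/-- Adding an atom at `x` to the left of all the others. -/
lemma coef_update {ω : ℝ →₀ ℝ} {a x w : ℝ} (hax : a < x) (hw : w ≠ 0) (hω : ∀ y, ω y ≠ 0 → x < y) :
    coefP (stringAtoms (ω.update x w)) a = coefP (stringAtoms ω) x -
      C (Real.exp (x / 2)) * (C w * X * phi (stringAtoms ω) x) ∧
    coefQ (stringAtoms (ω.update x w)) a = coefQ (stringAtoms ω) x +
      C (Real.exp (-x / 2)) * (C w * X * phi (stringAtoms ω) x) := by
  classical
  set σ := stringAtoms (ω.update x w) with hσ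
  have hne : ∀ y, y ≠ x → (ω.update x w) y = ω y := fun y hy => by
    simp [Finsupp.coe_update, hy]
  have hx : (ω.update x w) x = w := by simp
  have hcongr : ∀ y, x < y → σ y = stringAtoms ω y := fun y hy => by
    rw [hσ, stringAtoms_apply, stringAtoms_apply, hne y hy.ne']
  have hfilter : σ.support.filter (a < ·) = insert x (σ.support.filter (x < ·)) := by
    ext y
    simp only [Finset.mem_filter, Finset.mem_insert, hσ, mem_support_stringAtoms]
    rcases eq_or_ne y x with rfl | hyx
    · simp [hw, hax]
    · rw [hne y hyx]
      constructor
      · exact fun h => Or.inr ⟨h.1, hω y h.1⟩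
      · rintro (h | h)
        · exact (hyx h).elim
        · exact ⟨h.1, hax.trans h.2⟩
  have hnot : x ∉ σ.support.filter (x < ·) := by simp
  rw [← coefP_congr hcongr, ← coefQ_congr hcongr, ← phi_congr hcongr]
  constructor
  · rw [coefP, hfilter, Finset.sum_insert hnot, coefP, hσ, stringAtoms_apply, hx]
    ring
  · rw [coefQ, hfilter, Finset.sum_insert hnot, coefQ, hσ, stringAtoms_apply, hx]
    ring

/-- The inverse problem on a half-line. -/
lemma exists_string (n : ℕ) : ∀ (a : ℝ) (A q : ℝ[X]), A.natDegree = n → PosSimpleRoots A →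
    A.eval 0 = Real.exp (-a / 2) → q.eval 0 = 0 → q.natDegree ≤ n →
    (∀ x, A.eval x = 0 → A.derivative.eval x * q.eval x < 0) →
    ∃ ω : ℝ →₀ ℝ, (∀ y, ω y ≠ 0 → a < y) ∧ phi (stringAtoms ω) a = A ∧
      coefQ (stringAtoms ω) a = q := by
  induction n with
  | zero =>
    intro a A q hA _ hA0 hq0 hq _
    obtain ⟨c, rfl⟩ := natDegree_eq_zero.1 hA
    obtain ⟨d, rfl⟩ := natDegree_eq_zero.1 (Nat.le_zero.1 hq)
    rw [eval_C] at hA0 hq0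
    subst hA0 hq0
    refine ⟨0, by simp, ?_, ?_⟩
    · rw [phi_eq_sum]; simp [stringAtoms]
    · simp [coefQ, stringAtoms]
  | succ n ih =>
    intro a A q hn hA hA0 hq0 hq hsign
    classical
    obtain ⟨D, hD, hqD, hcoeff⟩ := hA.exists_partial_fractions (hq.trans hn.ge) hq0
    set Z := A.roots.toFinset with hZ
    have hZne : Z.Nonempty := by
      rw [← Finset.card_pos, hA.card_roots, hn]; omega
    set t : ℝ → ℝ := fun x => q.eval x / (x * A.derivative.eval x) with ht
    have htneg : ∀ x ∈ Z, t x < 0 := by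
      intro x hx
      have h1 := hsign x (hA.mem_roots.1 hx)
      have h2 := hA.root_pos (hA.mem_roots.1 hx)
      have h3 := hA.simple x (hA.mem_roots.1 hx)
      have : t x = (A.derivative.eval x * q.eval x) / (x * A.derivative.eval x ^ 2) := by
        simp only [ht]; field_simp
      rw [this]
      exact div_neg_of_neg_of_pos h1 (by positivity)
    have hT : ∑ x ∈ Z, t x < 0 := Finset.sum_neg htneg hZne
    -- The solution with data `A`, `q` at `a`, continued without atoms to `x`, is `c A + d q`. The
    -- nearest atom must sit where the degree of this polynomial drops; `T` is the limit of `q / A`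
    -- at infinity.
    obtain ⟨x, hax, hd, hT0⟩ := exists_position (a := a) hT
    set c := Real.exp ((a - x) / 2) with hc
    set d := Real.exp (x / 2) - Real.exp (a - x / 2) with hd'
    set A' := C c * A + C d * q with hA'
    have hAlead : A.leadingCoeff ≠ 0 := leadingCoeff_ne_zero.2 hA.ne_zero
    have hcoeff0 : A'.coeff (n + 1) = 0 := by
      rw [hA', coeff_add, coeff_C_mul, coeff_C_mul, ← hn, hcoeff, coeff_natDegree]
      linear_combination A.leadingCoeff * hT0
    obtain ⟨hPS, hder, -⟩ := hA.add_mul (hq.trans hn.ge) hq0 hsign (Real.exp_pos ((a - x) / 2)) hd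
      (by rw [hn, hcoeff0, zero_mul])
    have hA'deg : A'.natDegree ≤ n := by
      refine natDegree_le_of_coeff_succ ?_ hcoeff0
      exact (natDegree_add_le _ _).trans (max_le ((natDegree_C_mul_le _ _).trans hn.le)
        ((natDegree_C_mul_le _ _).trans hq))
    have hA'D : A' = C d * ∑ y ∈ Z, C (t y * y) * D y := by
      have h1 : q = C (∑ y ∈ Z, t y) * A + ∑ y ∈ Z, C (t y * y) * D y := by
        conv_lhs => rw [hqD]
        rw [map_sum, Finset.sum_mul, ← Finset.sum_add_distrib, Finset.mul_sum]
        refine Finset.sum_congr rfl fun y hy => ?_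
        conv_rhs => rw [← hD y hy]
        rw [C_mul]; ring
      have h2 := congrArg C hT0
      rw [C_add, C_mul, C_0] at h2
      rw [hA']
      conv_lhs => rw [h1]
      linear_combination A * h2
    have hA'coeff : A'.coeff n = d * (A.leadingCoeff * ∑ y ∈ Z, t y * y) := by
      rw [hA'D, coeff_C_mul, finsetSum_coeff]
      congr 1
      rw [Finset.mul_sum]
      refine Finset.sum_congr rfl fun y hy => ?_
      have hD0 : D y ≠ 0 := by
        intro h; have := hD y hy; rw [h, mul_zero] at this; exact hA.ne_zero this.symm
      have h1 : (D y).natDegree = n := by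
        have := congrArg natDegree (hD y hy)
        rw [natDegree_mul (X_sub_C_ne_zero y) hD0, natDegree_X_sub_C, hn] at this
        omega
      have h2 : (D y).coeff n = A.leadingCoeff := by
        rw [← hD y hy, leadingCoeff_mul, leadingCoeff_X_sub_C, one_mul, leadingCoeff, h1]
      rw [coeff_C_mul, h2]; ring
    have hA'n : A'.coeff n ≠ 0 := by
      rw [hA'coeff]
      refine mul_ne_zero hd.ne' (mul_ne_zero hAlead (Finset.sum_neg (fun y hy => ?_) hZne).ne)
      exact mul_neg_of_neg_of_pos (htneg y hy) (hA.root_pos (hA.mem_roots.1 hy))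
    have hA'deg' : A'.natDegree = n := le_antisymm hA'deg (le_natDegree_of_ne_zero hA'n)
    have hF : Real.exp (x / 2) * Real.exp (-x / 2) = 1 := by
      rw [← Real.exp_add, ← Real.exp_zero]; congr 1; ring
    have hE : Real.exp (a / 2) * Real.exp (-a / 2) = 1 := by
      rw [← Real.exp_add, ← Real.exp_zero]; congr 1; ring
    have hcEF : c = Real.exp (a / 2) * Real.exp (-x / 2) := by
      rw [hc, ← Real.exp_add]; congr 1; ring
    have hdEF : d = Real.exp (x / 2) - Real.exp (a / 2) * Real.exp (a / 2) * Real.exp (-x / 2) := by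
      rw [hd', ← Real.exp_add, ← Real.exp_add]; congr 2; ring
    -- The mass is chosen to cancel the top coefficient of `q'`, the coefficient of the growing
    -- exponential beyond the atom.
    set w := q.coeff (n + 1) * Real.exp (x / 2) / A'.coeff n with hw
    have hw0 : w ≠ 0 := by
      refine div_ne_zero (mul_ne_zero ?_ (Real.exp_pos _).ne') hA'n
      rw [← hn, hcoeff]
      exact mul_ne_zero hAlead hT.ne
    set q' := q - C (Real.exp (-x / 2)) * (C w * X * A') with hq'
    obtain ⟨ω, hω, hphi, hQ⟩ := ih x A' q' hA'deg' hPS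
      (by
        rw [hA', eval_add, eval_mul, eval_mul, eval_C, eval_C, hq0, hA0, hcEF]
        linear_combination Real.exp (-x / 2) * hE)
      (by simp [hq', hq0])
      (by
        refine natDegree_le_of_coeff_succ ?_ ?_
        · refine (natDegree_sub_le _ _).trans (max_le hq ?_)
          refine (natDegree_C_mul_le _ _).trans ?_
          rw [mul_assoc]
          refine (natDegree_C_mul_le _ _).trans ?_
          refine natDegree_mul_le.trans ?_
          rw [natDegree_X]; omega
        · rw [hq', coeff_sub, mul_assoc, coeff_C_mul, coeff_C_mul, coeff_X_mul]
          have hwA : w * A'.coeff n = q.coeff (n + 1) * Real.exp (x / 2) :=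
            div_mul_cancel₀ _ hA'n
          linear_combination -Real.exp (-x / 2) * hwA - q.coeff (n + 1) * hF)
      (fun y hy => by
        have h1 := hder y hy
        have h2 : q'.eval y = q.eval y := by
          rw [hq', eval_sub, eval_mul, eval_mul, hy, mul_zero, mul_zero, sub_zero]
        have h3 : c * A.eval y + d * q.eval y = 0 := by
          rw [hA'] at hy; simpa using hy
        -- At a root of `A'` both `q` and `q'` are negative multiples of `A`, so the Herglotz sign
        -- condition for the shorter string is the derivative condition supplied by `add_mul`.
        have h4 : q.eval y = -(c / d) * A.eval y := by
          field_simp; linear_combination h3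
        rw [h2, h4]
        have h5 : 0 < c / d := div_pos (Real.exp_pos _) hd
        nlinarith)
    obtain ⟨hP1, hQ1⟩ := coef_update hax hw0 hω
    refine ⟨ω.update x w, fun y hy => ?_, ?_, ?_⟩
    · rcases eq_or_ne y x with rfl | hyx
      · exact hax
      · refine hax.trans (hω y ?_)
        simpa [Finsupp.coe_update, hyx] using hy
    · have h1 := phi_eq_coef (stringAtoms ω) x
      rw [hphi, hQ] at h1
      rw [hphi] at hP1 hQ1
      rw [phi_eq_coef, hP1, hQ1, hQ]
      have hF' := congrArg C hF
      have hE' := congrArg C hE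
      rw [C_mul, C_1] at hF' hE'
      have h2 : A' = C (Real.exp (a / 2)) * C (Real.exp (-x / 2)) * A +
          (C (Real.exp (x / 2)) -
            C (Real.exp (a / 2)) * C (Real.exp (a / 2)) * C (Real.exp (-x / 2))) * q := by
        rw [hA', hcEF, hdEF, C_mul, C_sub, C_mul, C_mul]
      generalize C (Real.exp (a / 2)) = E at *
      generalize C (Real.exp (-a / 2)) = E₁ at *
      generalize C (Real.exp (x / 2)) = F at *
      generalize C (Real.exp (-x / 2)) = F₁ at *
      generalize coefP (stringAtoms ω) x = P at *
      rw [hq'] at h1 ⊢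
      have hP : P = F * A' - F * F * q + F * (C w * X * A') := by
        linear_combination (-P + (F * C w * X * A')) * hF' - F * h1
      rw [hP]
      linear_combination E₁ * F * h2 + (E₁ * E * A - E * E * E₁ * q) * hF' + (A - E * q) * hE'
    · rw [hQ1, hphi, hQ, hq']; ring

/-! ### Products over eigenvalues and the numerator of the Green's function -/

section RootPoly

variable {ι : Type*} (lam : ι → ℝ) (s : Finset ι)

/-- The polynomial with simple roots `lam i`, `i ∈ s`, normalized to be one at the origin. -/
noncomputable def rootPoly : ℝ[X] := ∏ i ∈ s, (1 - C (lam i)⁻¹ * X)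

variable {lam s}

lemma eval_rootPoly_zero : (rootPoly lam s).eval 0 = 1 := by
  simp [rootPoly, eval_prod]

lemma rootPoly_ne_zero : rootPoly lam s ≠ 0 := by
  intro h
  have := eval_rootPoly_zero (lam := lam) (s := s)
  simp [h] at this

lemma one_sub_eq_zero_iff {𝕜 : Type*} [Field 𝕜] {l z : 𝕜} (hl : l ≠ 0) :
    1 - l⁻¹ * z = 0 ↔ z = l := by
  rw [sub_eq_zero, eq_comm, inv_mul_eq_one₀ hl, eq_comm]

lemma eval_rootPoly_eq_zero (hl : ∀ i, lam i ≠ 0) {x : ℝ} :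
    (rootPoly lam s).eval x = 0 ↔ ∃ i ∈ s, x = lam i := by
  rw [rootPoly, eval_prod, Finset.prod_eq_zero_iff]
  simp [one_sub_eq_zero_iff (hl _)]

lemma aeval_rootPoly_eq_zero (hl : ∀ i, lam i ≠ 0) {z : ℂ} :
    aeval z (rootPoly lam s) = 0 ↔ ∃ i ∈ s, z = lam i := by
  rw [rootPoly, map_prod, Finset.prod_eq_zero_iff]
  refine exists_congr fun i => and_congr_right fun _ => ?_
  have : (lam i : ℂ) ≠ 0 := by exact_mod_cast hl i
  rw [← one_sub_eq_zero_iff this]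
  simp

lemma natDegree_linear {l : ℝ} (hl : l ≠ 0) : (1 - C l⁻¹ * X : ℝ[X]).natDegree = 1 := by
  rw [← natDegree_neg, neg_sub, ← C_1, natDegree_sub_C, natDegree_C_mul_X _ (inv_ne_zero hl)]

lemma natDegree_rootPoly (hl : ∀ i, lam i ≠ 0) : (rootPoly lam s).natDegree = s.card := by
  rw [rootPoly, natDegree_prod]
  · simp [natDegree_linear (hl _)]
  · intro i _ h
    have := natDegree_linear (hl i)
    rw [h] at this
    simp at this

variable [DecidableEq ι]

variable (lam s) in
/-- `z ∑ w_i / (lam i - z)` times `rootPoly lam s`. -/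
noncomputable def poleSum (w : ι → ℝ) : ℝ[X] :=
  X * ∑ i ∈ s, C (w i * (lam i)⁻¹) * rootPoly lam (s.erase i)

lemma mul_rootPoly_erase {i : ι} (hi : i ∈ s) :
    (1 - C (lam i)⁻¹ * X) * rootPoly lam (s.erase i) = rootPoly lam s :=
  Finset.mul_prod_erase _ _ hi

lemma derivative_rootPoly_eval {i : ι} (hi : i ∈ s) (hl : ∀ i, lam i ≠ 0) :
    (rootPoly lam s).derivative.eval (lam i) =
      -(lam i)⁻¹ * (rootPoly lam (s.erase i)).eval (lam i) := by
  rw [← mul_rootPoly_erase hi]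
  have : (1 - C (lam i)⁻¹ * X : ℝ[X]).eval (lam i) = 0 := by simp [hl i]
  rw [derivative_mul, eval_add, eval_mul, eval_mul, this]
  simp

lemma eval_rootPoly_erase_ne_zero (hl : ∀ i, lam i ≠ 0) (hinj : Function.Injective lam) (i : ι) :
    (rootPoly lam (s.erase i)).eval (lam i) ≠ 0 := by
  rw [Ne, eval_rootPoly_eq_zero hl]
  rintro ⟨j, hj, h⟩
  exact Finset.ne_of_mem_erase hj (hinj h.symm)

lemma posSimpleRoots_rootPoly (hpos : ∀ i, 0 < lam i) (hinj : Function.Injective lam) :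
    PosSimpleRoots (rootPoly lam s) := by
  have hl : ∀ i, lam i ≠ 0 := fun i => (hpos i).ne'
  refine ⟨fun z hz => ?_, fun x hx => ?_⟩
  · obtain ⟨i, _, rfl⟩ := (aeval_rootPoly_eq_zero hl).1 hz
    simpa using hpos i
  · obtain ⟨i, hi, rfl⟩ := (eval_rootPoly_eq_zero hl).1 hx
    rw [derivative_rootPoly_eval hi hl]
    exact mul_ne_zero (neg_ne_zero.2 (inv_ne_zero (hl i))) (eval_rootPoly_erase_ne_zero hl hinj i)

lemma eval_poleSum (hl : ∀ i, lam i ≠ 0) (w : ι → ℝ) {i : ι} (hi : i ∈ s) :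
    (poleSum lam s w).eval (lam i) = -(lam i * w i * (rootPoly lam s).derivative.eval (lam i)) := by
  rw [derivative_rootPoly_eval hi hl, poleSum, eval_mul, eval_X, eval_finsetSum,
    Finset.sum_eq_single i]
  · rw [eval_mul, eval_C]
    ring
  · intro j hj hji
    have : (rootPoly lam (s.erase j)).eval (lam i) = 0 :=
      (eval_rootPoly_eq_zero hl).2 ⟨i, Finset.mem_erase.2 ⟨hji.symm, hi⟩, rfl⟩
    rw [eval_mul, this, mul_zero]
  · exact fun h => (h hi).elim

lemma natDegree_poleSum_le (hl : ∀ i, lam i ≠ 0) (w : ι → ℝ) :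
    (poleSum lam s w).natDegree ≤ s.card := by
  rcases s.eq_empty_or_nonempty with rfl | hne
  · simp [poleSum]
  refine natDegree_mul_le.trans ?_
  rw [natDegree_X]
  have : 0 < s.card := Finset.card_pos.2 hne
  have h2 : (∑ i ∈ s, C (w i * (lam i)⁻¹) * rootPoly lam (s.erase i)).natDegree ≤ s.card - 1 := by
    refine natDegree_sum_le_of_forall_le _ _ fun i hi => ?_
    refine (natDegree_C_mul_le _ _).trans ?_
    rw [natDegree_rootPoly hl, Finset.card_erase_of_mem hi]
  omega

lemma coeff_poleSum (hl : ∀ i, lam i ≠ 0) (w : ι → ℝ) :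
    (poleSum lam s w).coeff s.card = -(rootPoly lam s).leadingCoeff * ∑ i ∈ s, w i := by
  rcases s.eq_empty_or_nonempty with rfl | hne
  · simp [poleSum]
  obtain ⟨m, hm⟩ : ∃ m, s.card = m + 1 :=
    ⟨_, (Nat.succ_pred_eq_of_pos (Finset.card_pos.2 hne)).symm⟩
  rw [leadingCoeff, natDegree_rootPoly hl, hm, poleSum, coeff_X_mul, finsetSum_coeff,
    Finset.mul_sum]
  refine Finset.sum_congr rfl fun i hi => ?_
  have h : (rootPoly lam (s.erase i)).coeff (m + 1) = 0 := by
    refine coeff_eq_zero_of_natDegree_lt ?_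
    rw [natDegree_rootPoly hl, Finset.card_erase_of_mem hi]; omega
  rw [← mul_rootPoly_erase hi, sub_mul, one_mul, coeff_sub, h, mul_assoc, coeff_C_mul, coeff_C_mul,
    coeff_X_mul]
  ring

end RootPoly

section GreenNumerator

variable {ι : Type*} [Fintype ι] (lam c : ι → ℝ)

/-- The polynomial whose roots are the eigenvalues with vanishing interior datum. -/
noncomputable def hiddenPoly : ℝ[X] := rootPoly lam (Finset.univ.filter fun i => c i = 0)

/-- The polynomial whose roots are the eigenvalues with nonvanishing interior datum. -/
noncomputable def visiblePoly : ℝ[X] := rootPoly lam (Finset.univ.filter fun i => c i ≠ 0)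

variable {lam c}

lemma hiddenPoly_mul_visiblePoly :
    hiddenPoly lam c * visiblePoly lam c = rootPoly lam Finset.univ :=
  Finset.prod_filter_mul_prod_filter_not _ _ _

lemma eval_hiddenPoly_eq_zero (hl : ∀ i, lam i ≠ 0) {x : ℝ} :
    (hiddenPoly lam c).eval x = 0 ↔ ∃ i, c i = 0 ∧ x = lam i := by
  rw [hiddenPoly, eval_rootPoly_eq_zero hl]; simp

lemma eval_visiblePoly_eq_zero (hl : ∀ i, lam i ≠ 0) {x : ℝ} :
    (visiblePoly lam c).eval x = 0 ↔ ∃ i, c i ≠ 0 ∧ x = lam i := by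
  rw [visiblePoly, eval_rootPoly_eq_zero hl]; simp

lemma sum_sq_filter : ∑ i ∈ Finset.univ.filter (fun i => c i ≠ 0), |c i| ^ 2 = ∑ i, |c i| ^ 2 := by
  rw [Finset.sum_filter]
  refine Finset.sum_congr rfl fun i _ => ?_
  split_ifs with h
  · rfl
  · rw [not_not] at h; simp [h]

lemma natDegree_visiblePoly (hl : ∀ i, lam i ≠ 0) :
    (visiblePoly lam c).natDegree = (Finset.univ.filter fun i => c i ≠ 0).card :=
  natDegree_rootPoly hl

lemma hiddenPoly_ne_zero : hiddenPoly lam c ≠ 0 := rootPoly_ne_zero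

lemma visiblePoly_ne_zero : visiblePoly lam c ≠ 0 := rootPoly_ne_zero

variable [DecidableEq ι]

variable (lam c) in
/-- The numerator of `1 + z ∑ c_i² / (lam i - z)`. -/
noncomputable def greenNum : ℝ[X] :=
  -- The factors `C 1` match the form of the positive combination in `PosSimpleRoots.add_mul`.
  C 1 * visiblePoly lam c +
    C 1 * poleSum lam (Finset.univ.filter fun i => c i ≠ 0) fun i => |c i| ^ 2

lemma eval_greenNum_zero : (greenNum lam c).eval 0 = 1 := by
  simp [greenNum, visiblePoly, eval_rootPoly_zero, poleSum]

lemma eval_greenNum (hl : ∀ i, lam i ≠ 0) {i : ι} (hi : c i ≠ 0) :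
    (greenNum lam c).eval (lam i) =
      -(lam i * |c i| ^ 2 * (visiblePoly lam c).derivative.eval (lam i)) := by
  have hi' : i ∈ Finset.univ.filter fun i => c i ≠ 0 := by simpa using hi
  have h : (visiblePoly lam c).eval (lam i) = 0 := (eval_visiblePoly_eq_zero hl).2 ⟨i, hi, rfl⟩
  rw [greenNum, eval_add, eval_mul, eval_mul, h, eval_poleSum hl _ hi', visiblePoly]
  simp

lemma coeff_greenNum (hl : ∀ i, lam i ≠ 0) :
    (greenNum lam c).coeff (visiblePoly lam c).natDegree =
      (1 - ∑ i, |c i| ^ 2) * (visiblePoly lam c).leadingCoeff := by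
  rw [greenNum, coeff_add, coeff_C_mul, coeff_C_mul, coeff_natDegree, natDegree_visiblePoly hl,
    coeff_poleSum hl, sum_sq_filter, visiblePoly]
  ring

lemma natDegree_greenNum_le (hl : ∀ i, lam i ≠ 0) :
    (greenNum lam c).natDegree ≤ (visiblePoly lam c).natDegree := by
  refine (natDegree_add_le _ _).trans (max_le (natDegree_C_mul_le _ _) ?_)
  rw [natDegree_visiblePoly hl]
  exact (natDegree_C_mul_le _ _).trans (natDegree_poleSum_le hl _)

lemma natDegree_greenNum (hl : ∀ i, lam i ≠ 0) (hα : 1 - ∑ i, |c i| ^ 2 ≠ 0) :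
    (greenNum lam c).natDegree = (visiblePoly lam c).natDegree := by
  refine le_antisymm (natDegree_greenNum_le hl) (le_natDegree_of_ne_zero ?_)
  rw [coeff_greenNum hl]
  exact mul_ne_zero hα (leadingCoeff_ne_zero.2 rootPoly_ne_zero)

/-- Reality, positivity and interlacing of the roots of `greenNum`. -/
lemma greenNum_roots (hpos : ∀ i, 0 < lam i) (hinj : Function.Injective lam)
    (hα : 0 ≤ 1 - ∑ i, |c i| ^ 2) :
    PosSimpleRoots (greenNum lam c) ∧
      (∀ x, (greenNum lam c).eval x = 0 →
        0 < (greenNum lam c).derivative.eval x * (visiblePoly lam c).eval x) ∧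
      ∀ x y, x < y → (greenNum lam c).eval x = 0 → (greenNum lam c).eval y = 0 →
        ∃ i, c i ≠ 0 ∧ x < lam i ∧ lam i < y := by
  have hl : ∀ i, lam i ≠ 0 := fun i => (hpos i).ne'
  obtain ⟨h1, h2, h3⟩ := (posSimpleRoots_rootPoly (s := Finset.univ.filter fun i => c i ≠ 0)
    hpos hinj).add_mul (q := poleSum lam (Finset.univ.filter fun i => c i ≠ 0) fun i => |c i| ^ 2)
    (c := 1) (d := 1) ((natDegree_poleSum_le hl _).trans (natDegree_rootPoly hl).ge)
    (by simp [poleSum]) (fun x hx => by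
      obtain ⟨i, hi, rfl⟩ := (eval_rootPoly_eq_zero hl).1 hx
      have h4 := (posSimpleRoots_rootPoly hpos hinj).simple _ hx
      rw [eval_poleSum hl _ hi]
      have h5 := hpos i
      have h6 : c i ≠ 0 := by simpa using hi
      have : 0 < lam i * |c i| ^ 2 *
        ((rootPoly lam (Finset.univ.filter fun i => c i ≠ 0)).derivative.eval (lam i)) ^ 2 := by
        positivity
      nlinarith) one_pos one_pos (by
      have h4 := coeff_greenNum (c := c) hl
      rw [greenNum, visiblePoly] at h4
      rw [h4, mul_assoc]
      exact mul_nonneg hα (mul_self_nonneg _))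
  refine ⟨h1, h2, fun x y hxy hx hy => ?_⟩
  obtain ⟨w, hw, h4, h5⟩ := h3 x y hxy hx hy
  obtain ⟨i, hi, rfl⟩ := (eval_visiblePoly_eq_zero hl).1 hw
  exact ⟨i, hi, h4, h5⟩

end GreenNumerator

/-! ### From a pair to the factorization at the interior point -/

section Direct

variable {ι : Type*} [Fintype ι] {lam c : ι → ℝ}

lemma eval_charPoly_eq_zero_iff (p : DiscretePair) (x : ℝ) :
    (charPoly p.sigma).eval x = 0 ↔ (x : ℂ) ∈ spectrumH p := by
  rw [mem_spectrumH_iff, aeval_ofReal_eq]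
  norm_cast

lemma spectrumH_eq_of_charPoly (hl : ∀ i, lam i ≠ 0) {p : DiscretePair}
    (hp : charPoly p.sigma = rootPoly lam Finset.univ) :
    spectrumH p = Set.range fun i => (lam i : ℂ) := by
  ext z
  rw [mem_spectrumH_iff, hp, aeval_rootPoly_eq_zero hl]
  simp [eq_comm]

lemma derivative_hidden_mul (x : ℝ) (hx : (hiddenPoly lam c).eval x = 0) :
    (rootPoly lam Finset.univ).derivative.eval x =
      (hiddenPoly lam c).derivative.eval x * (visiblePoly lam c).eval x := by
  rw [← hiddenPoly_mul_visiblePoly (c := c), derivative_mul, eval_add, eval_mul, eval_mul, hx]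
  ring

lemma derivative_visible_mul (x : ℝ) (hx : (visiblePoly lam c).eval x = 0) :
    (rootPoly lam Finset.univ).derivative.eval x =
      (hiddenPoly lam c).eval x * (visiblePoly lam c).derivative.eval x := by
  rw [← hiddenPoly_mul_visiblePoly (c := c), derivative_mul, eval_add, eval_mul, eval_mul, hx]
  ring

variable [DecidableEq ι]

/-- `A` and `B` are the values at `a` of the solutions `phi` and `phiL` of some pair with the interior
spectral data `lam`, `c`. -/
structure IsFactorPair (lam c : ι → ℝ) (a : ℝ) (A B : ℝ[X]) : Prop where
  mul_eq : A * B = hiddenPoly lam c * greenNum lam c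
  left_eq_zero : ∀ i, c i = 0 → A.eval (lam i) = 0
  right_eq_zero : ∀ i, c i = 0 → B.eval (lam i) = 0
  left_zero : A.eval 0 = Real.exp (-a / 2)
  right_zero : B.eval 0 = Real.exp (a / 2)
  sign : ∀ i, c i ≠ 0 → 0 < c i * A.eval (lam i)

/-- The derivative formula with positive norming constants makes every eigenvalue a simple zero of
the Wronskian, and the normalization at the origin fixes the remaining scalar. -/
lemma charPoly_eq_rootPoly (hpos : ∀ i, 0 < lam i) (hinj : Function.Injective lam)
    {p : DiscretePair} (hp : spectrumH p = Set.range fun i => (lam i : ℂ)) :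
    charPoly p.sigma = rootPoly lam Finset.univ := by
  have hl : ∀ i, lam i ≠ 0 := fun i => (hpos i).ne'
  refine PosSimpleRoots.ext ⟨fun z hz => ?_, fun x hx h => ?_⟩ (posSimpleRoots_rootPoly hpos hinj)
    (fun x => ?_) ?_
  · rw [← mem_spectrumH_iff, hp] at hz
    obtain ⟨i, rfl⟩ := hz
    simpa using hpos i
  · obtain ⟨κ, hκ0, hκ⟩ := exists_phiL_eq_mul hx
    have := neg_mul_derivative_charPoly p hκ
    rw [h, mul_zero, neg_zero] at this
    exact mul_ne_zero hκ0 (norming_pos p hx).ne' this.symm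
  · rw [eval_charPoly_eq_zero_iff, hp, eval_rootPoly_eq_zero hl]
    simp [eq_comm]
  · rw [eval_charPoly_zero, eval_rootPoly_zero]

/-- The residue relation for the Green's function in one formula for hidden and visible eigenvalues;
at a hidden one both sides vanish. -/
lemma eval_hidden_mul_greenNum (hl : ∀ i, lam i ≠ 0) (i : ι) :
    (hiddenPoly lam c * greenNum lam c).eval (lam i) =
      -(lam i * (rootPoly lam Finset.univ).derivative.eval (lam i)) * |c i| ^ 2 := by
  rw [eval_mul]
  by_cases hi : c i = 0
  · rw [(eval_hiddenPoly_eq_zero hl).2 ⟨i, hi, rfl⟩, hi]; simp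
  · rw [eval_greenNum hl hi,
      derivative_visible_mul _ ((eval_visiblePoly_eq_zero hl).2 ⟨i, hi, rfl⟩)]
    ring

/-- The direct problem. -/
theorem isFactorPair_of_interior_data (hpos : ∀ i, 0 < lam i) (hinj : Function.Injective lam)
    {p : DiscretePair} (hp : spectrumH p = Set.range fun i => (lam i : ℂ)) {a : ℝ}
    (hc : ∀ i, c i = (phi p.sigma a).eval (lam i) / √(norming p (lam i))) :
    IsFactorPair lam c a (phi p.sigma a) (phiL p.sigma a) ∧
      (∀ i, 0 < norming p (lam i) ∧
        norming p (lam i) * c i ^ 2 = (phi p.sigma a).eval (lam i) ^ 2) ∧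
      0 ≤ 1 - ∑ i, |c i| ^ 2 := by
  have hl : ∀ i, lam i ≠ 0 := fun i => (hpos i).ne'
  have hW := charPoly_eq_rootPoly hpos hinj hp
  have hroot : ∀ i, (charPoly p.sigma).eval (lam i) = 0 := fun i => by
    rw [eval_charPoly_eq_zero_iff, hp]; exact ⟨i, rfl⟩
  have hν : ∀ i, 0 < norming p (lam i) := fun i => norming_pos p (hroot i)
  have hA : ∀ i, (phi p.sigma a).eval (lam i) = c i * √(norming p (lam i)) := fun i => by
    rw [hc i, div_mul_cancel₀ _ (Real.sqrt_pos.2 (hν i)).ne']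
  have hsq : ∀ i, norming p (lam i) * c i ^ 2 = (phi p.sigma a).eval (lam i) ^ 2 := fun i => by
    rw [hA i, mul_pow, Real.sq_sqrt (hν i).le, mul_comm]
  have hκ := fun i => exists_phiL_eq_mul (hroot i)
  choose κ hκ0 hκ using hκ
  have hdeg : (charPoly p.sigma).natDegree = Fintype.card ι := by
    rw [hW, natDegree_rootPoly hl, Finset.card_univ]
  have hmul : phi p.sigma a * phiL p.sigma a = hiddenPoly lam c * greenNum lam c := by
    classical
    -- Both sides have degree at most the number of eigenvalues, and the origin supplies the one
    -- additional node.
    refine eq_of_natDegree_lt_card_of_eval_eq' _ _ (insert 0 (Finset.univ.image lam))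
      (fun x hx => ?_) ?_
    · rcases Finset.mem_insert.1 hx with rfl | hx
      · rw [eval_mul, eval_mul, eval_phi_zero, eval_phiL_zero, eval_greenNum_zero, hiddenPoly,
          eval_rootPoly_zero, ← Real.exp_add, show -a / 2 + a / 2 = 0 by ring, Real.exp_zero, mul_one]
      · obtain ⟨i, -, rfl⟩ := Finset.mem_image.1 hx
        rw [eval_hidden_mul_greenNum hl, ← hW, neg_mul_derivative_charPoly p (hκ i), eval_mul, hκ,
          sq_abs, mul_assoc, hsq]
        ring
    · have h0 : (0 : ℝ) ∉ Finset.univ.image lam := by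
        simp only [Finset.mem_image, not_exists, not_and]
        exact fun i _ => hl i
      rw [Finset.card_insert_of_notMem h0, Finset.card_image_of_injective _ hinj, Finset.card_univ,
        Nat.lt_succ_iff]
      refine max_le ?_ ?_
      · rw [← hdeg]; exact natDegree_phi_mul_phiL_le (natDegree_sigma_pos p) a
      · refine natDegree_mul_le.trans ((add_le_add_right (natDegree_greenNum_le hl) _).trans ?_)
        rw [← hdeg, hW, ← hiddenPoly_mul_visiblePoly (c := c),
          natDegree_mul hiddenPoly_ne_zero visiblePoly_ne_zero]
  refine ⟨⟨hmul, fun i hi => ?_, fun i hi => ?_, eval_phi_zero p a, eval_phiL_zero p a,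
    fun i hi => ?_⟩, fun i => ⟨hν i, hsq i⟩, ?_⟩
  · rw [hA, hi, zero_mul]
  · rw [hκ i, hA, hi, zero_mul, mul_zero]
  · rw [hA, ← mul_assoc]
    have := Real.sqrt_pos.2 (hν i)
    have := mul_self_pos.2 hi
    positivity
  -- The number α is the limit of the diagonal Green's function at infinity, hence nonnegative.
  · have h := coeff_phi_mul_phiL_nonneg (natDegree_sigma_pos p) a
    rw [hmul, hW, ← hiddenPoly_mul_visiblePoly (c := c),
      natDegree_mul hiddenPoly_ne_zero visiblePoly_ne_zero,
      coeff_mul_add_eq_of_natDegree_le le_rfl (natDegree_greenNum_le hl), coeff_greenNum hl,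
      leadingCoeff_mul, coeff_natDegree] at h
    have h1 : 0 < ((hiddenPoly lam c).leadingCoeff * (visiblePoly lam c).leadingCoeff) ^ 2 := by
      have h2 : (hiddenPoly lam c).leadingCoeff ≠ 0 := leadingCoeff_ne_zero.2 hiddenPoly_ne_zero
      have h3 : (visiblePoly lam c).leadingCoeff ≠ 0 := leadingCoeff_ne_zero.2 visiblePoly_ne_zero
      positivity
    by_contra hcon
    push Not at hcon
    have := mul_neg_of_neg_of_pos hcon h1
    nlinarith

end Direct

/-! ### Splitting off the hidden eigenvalues -/

section Factors

variable {ι : Type*} [Fintype ι] [DecidableEq ι] {lam c : ι → ℝ}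

lemma posSimpleRoots_hidden_mul (hpos : ∀ i, 0 < lam i) (hinj : Function.Injective lam)
    (hα : 0 ≤ 1 - ∑ i, |c i| ^ 2) {A₀ B₀ : ℝ[X]}
    (hQ : hiddenPoly lam c * A₀ * B₀ = greenNum lam c) :
    PosSimpleRoots (hiddenPoly lam c * A₀) := by
  obtain ⟨h1, h2, -⟩ := greenNum_roots hpos hinj hα
  have hdvd : hiddenPoly lam c * A₀ ∣ greenNum lam c := ⟨B₀, hQ.symm⟩
  refine ⟨fun z hz => h1.pos z ?_, fun x hx h => ?_⟩
  · rw [← hQ, map_mul, hz, zero_mul]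
  · refine h1.simple x (by rw [← hQ, eval_mul, hx, zero_mul]) ?_
    rw [← hQ, derivative_mul, eval_add, eval_mul, eval_mul, hx, h]
    ring

variable {a : ℝ} {A B : ℝ[X]}

/-- A hidden eigenvalue is a root of both solutions, so the hidden polynomial divides each of them;
cancelling it once in the product leaves a factorization of `greenNum` that still contains it. -/
lemma IsFactorPair.exists_factors (h : IsFactorPair lam c a A B) (hpos : ∀ i, 0 < lam i)
    (hinj : Function.Injective lam) : ∃ A₀ B₀ : ℝ[X], A = hiddenPoly lam c * A₀ ∧
      B = hiddenPoly lam c * B₀ ∧ hiddenPoly lam c * A₀ * B₀ = greenNum lam c := by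
  have hl : ∀ i, lam i ≠ 0 := fun i => (hpos i).ne'
  have hH : PosSimpleRoots (hiddenPoly lam c) := posSimpleRoots_rootPoly hpos hinj
  have hA : A ≠ 0 := by
    rintro rfl; exact (Real.exp_pos _).ne (by simpa using h.left_zero)
  have hB : B ≠ 0 := by
    rintro rfl; exact (Real.exp_pos _).ne (by simpa using h.right_zero)
  obtain ⟨A₀, rfl⟩ := hH.dvd hA fun x hx => by
    obtain ⟨i, hi, rfl⟩ := (eval_hiddenPoly_eq_zero hl).1 hx
    exact h.left_eq_zero i hi
  obtain ⟨B₀, rfl⟩ := hH.dvd hB fun x hx => by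
    obtain ⟨i, hi, rfl⟩ := (eval_hiddenPoly_eq_zero hl).1 hx
    exact h.right_eq_zero i hi
  refine ⟨A₀, B₀, rfl, rfl, mul_left_cancel₀ (hiddenPoly_ne_zero (lam := lam) (c := c)) ?_⟩
  rw [← h.mul_eq]; ring

end Factors

/-! ### The inverse problem on the line -/

lemma exists_interpolation (Z : Finset ℝ) (hZ : ∀ x ∈ Z, x ≠ 0) (v : ℝ → ℝ) :
    ∃ q : ℝ[X], q.natDegree ≤ Z.card ∧ q.eval 0 = 0 ∧ ∀ x ∈ Z, q.eval x = v x := by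
  classical
  refine ⟨X * Lagrange.interpolate Z id (fun x => v x / x), ?_, by simp, fun x hx => ?_⟩
  · rcases Z.eq_empty_or_nonempty with rfl | hne
    · simp
    refine natDegree_mul_le.trans ?_
    rw [natDegree_X]
    have h1 := natDegree_le_of_degree_le (Lagrange.degree_interpolate_le (fun x => v x / x)
      (Set.injOn_id (Z : Set ℝ)))
    have h2 := Finset.card_pos.2 hne
    omega
  · have := Lagrange.eval_interpolate_at_node (fun x => v x / x) (Set.injOn_id (Z : Set ℝ)) hx
    rw [eval_mul, eval_X]
    simp only [id] at this
    rw [this, mul_div_cancel₀ _ (hZ x hx)]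

/-- The compatibility of the two half-line solutions at an eigenvalue. -/
lemma eval_coefQ_mirror {σ : ℝ →₀ ℝ[X]} {a lam κ : ℝ} (ha : a ∉ σ.support)
    (hlam : (charPoly σ).eval lam = 0)
    (hκ : ∀ x, (phiL σ x).eval lam = κ * (phi σ x).eval lam) :
    (coefQ (mirror σ) (-a)).eval lam = κ * (coefP σ a).eval lam := by
  have h1 : (coefQ (mirror σ) (-a)).eval lam = κ * ∑ y ∈ σ.support.filter (· < a),
      Real.exp (y / 2) * ((σ y).eval lam * (phi σ y).eval lam) := by
    rw [coefQ, sum_mirror_support_filter, eval_finsetSum, Finset.mul_sum]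
    refine Finset.sum_congr rfl fun y _ => ?_
    have := hκ y
    rw [phiL] at this
    simp only [mirror_apply, neg_neg, eval_mul, eval_C, this]
    ring
  have h2 := sum_exp_eq_one hlam
  rw [← Finset.sum_filter_add_sum_filter_not σ.support (· < a)] at h2
  have h3 : σ.support.filter (fun y => ¬ y < a) = σ.support.filter (a < ·) := by
    ext y
    simp only [Finset.mem_filter, not_lt, and_congr_right_iff]
    exact fun hy => ⟨fun h => lt_of_le_of_ne h fun h => ha (h ▸ hy), le_of_lt⟩
  rw [h3] at h2
  rw [h1, coefP]
  simp only [eval_sub, eval_one, eval_finsetSum, eval_mul, eval_C]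
  rw [← h2]; ring

/-- Two half-line strings glued at `a`. -/
lemma exists_glued_pair {a : ℝ} {A B q s : ℝ[X]}
    (hA : PosSimpleRoots A) (hA0 : A.eval 0 = Real.exp (-a / 2)) (hq0 : q.eval 0 = 0)
    (hq : q.natDegree ≤ A.natDegree) (hAq : ∀ x, A.eval x = 0 → A.derivative.eval x * q.eval x < 0)
    (hB : PosSimpleRoots B) (hB0 : B.eval 0 = Real.exp (a / 2)) (hs0 : s.eval 0 = 0)
    (hs : s.natDegree ≤ B.natDegree) (hBs : ∀ x, B.eval x = 0 → B.derivative.eval x * s.eval x < 0) :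
    ∃ p : DiscretePair, a ∉ p.sigma.support ∧ phi p.sigma a = A ∧ phiL p.sigma a = B ∧
      C (Real.exp (a / 2)) * coefQ p.sigma a = q ∧
      C (Real.exp (-a / 2)) * coefQ (mirror p.sigma) (-a) = s := by
  have hE : Real.exp (a / 2) * Real.exp (-a / 2) = 1 := by
    rw [← Real.exp_add, ← Real.exp_zero]; congr 1; ring
  obtain ⟨ω₁, h1, h2, h3⟩ := exists_string _ a A (C (Real.exp (-a / 2)) * q) rfl hA hA0
    (by simp [hq0]) ((natDegree_C_mul_le _ _).trans hq) (fun x hx => by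
      have := hAq x hx
      have := Real.exp_pos (-a / 2)
      rw [eval_mul, eval_C]
      nlinarith)
  obtain ⟨ω₂, k1, k2, k3⟩ := exists_string _ (-a) B (C (Real.exp (a / 2)) * s) rfl hB
    (by rw [neg_neg, hB0]) (by simp [hs0]) ((natDegree_C_mul_le _ _).trans hs) (fun x hx => by
      have := hBs x hx
      have := Real.exp_pos (a / 2)
      rw [eval_mul, eval_C]
      nlinarith)
  -- Atoms of ω alone suffice: the constructed pair has v = 0 and no mass at `a`.
  set p : DiscretePair := ⟨ω₁ + mirror ω₂, 0, fun _ => le_rfl⟩ with hp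
  have hsigma : ∀ y, p.sigma y = C (ω₁ y + ω₂ (-y)) * X := fun y => by
    rw [sigma_apply]; simp [hp, mirror_apply]
  have z1 : ∀ y, y ≤ a → ω₁ y = 0 := fun y hy => by
    by_contra h; exact (h1 y h).not_ge hy
  have z2 : ∀ y, y ≤ -a → ω₂ y = 0 := fun y hy => by
    by_contra h; exact (k1 y h).not_ge hy
  have c1 : ∀ y, a < y → p.sigma y = stringAtoms ω₁ y := fun y hy => by
    rw [hsigma, z2 _ (by linarith), add_zero, stringAtoms_apply]
  have c2 : ∀ y, -a < y → mirror p.sigma y = stringAtoms ω₂ y := fun y hy => by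
    rw [mirror_apply, hsigma, z1 _ (by linarith), zero_add, neg_neg, stringAtoms_apply]
  have hE' := congrArg C hE
  rw [C_mul, C_1] at hE'
  refine ⟨p, ?_, ?_, ?_, ?_, ?_⟩
  · rw [Finsupp.mem_support_iff, hsigma, z1 a le_rfl, z2 _ le_rfl]; simp
  · rw [phi_congr c1, h2]
  · rw [phiL, phi_congr c2, k2]
  · rw [coefQ_congr c1, h3]; linear_combination q * hE'
  · rw [coefQ_congr c2, k3]; linear_combination s * hE'

section Inverse

variable {ι : Type*} [Fintype ι] [DecidableEq ι] {lam c : ι → ℝ} {a : ℝ} {A B : ℝ[X]}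

/-- The boundary values to be prescribed at `a` in order to obtain the norming constants `ν`. -/
lemma exists_boundary_data (hpos : ∀ i, 0 < lam i) (hinj : Function.Injective lam)
    (hα : 0 ≤ 1 - ∑ i, |c i| ^ 2) (hα0 : 1 - ∑ i, |c i| ^ 2 ≠ 0)
    (h : IsFactorPair lam c a A B) {ν : ι → ℝ} (hν : ∀ i, 0 < ν i) :
    PosSimpleRoots A ∧ PosSimpleRoots B ∧ ∃ q s : ℝ[X],
      q.eval 0 = 0 ∧ q.natDegree ≤ A.natDegree ∧
      (∀ x, A.eval x = 0 → A.derivative.eval x * q.eval x < 0) ∧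
      s.eval 0 = 0 ∧ s.natDegree ≤ B.natDegree ∧
      (∀ x, B.eval x = 0 → B.derivative.eval x * s.eval x < 0) ∧
      rootPoly lam Finset.univ = A * B - A * s - B * q ∧
      ∀ i, c i = 0 → s.eval (lam i) * ν i =
        lam i * (rootPoly lam Finset.univ).derivative.eval (lam i) * q.eval (lam i) := by
  have hl : ∀ i, lam i ≠ 0 := fun i => (hpos i).ne'
  obtain ⟨hQ1, hQ2, -⟩ := greenNum_roots hpos hinj hα
  obtain ⟨A₀, B₀, rfl, rfl, hQ⟩ := h.exists_factors hpos hinj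
  have hAP := posSimpleRoots_hidden_mul hpos hinj hα hQ
  have hBP := posSimpleRoots_hidden_mul (A₀ := B₀) (B₀ := A₀) hpos hinj hα (by rw [← hQ]; ring)
  refine ⟨hAP, hBP, ?_⟩
  set H := hiddenPoly lam c with hH
  set Wn := visiblePoly lam c with hWn
  have hHne : H ≠ 0 := hiddenPoly_ne_zero
  have hH0 : H.eval 0 = 1 := eval_rootPoly_zero
  have hWn0 : Wn.eval 0 = 1 := eval_rootPoly_zero
  have hQx : ∀ x, H.eval x * A₀.eval x * B₀.eval x = (greenNum lam c).eval x := fun x => by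
    rw [← hQ, eval_mul, eval_mul]
  have hQ'x : ∀ x, (H.derivative.eval x * A₀.eval x + H.eval x * A₀.derivative.eval x) * B₀.eval x +
      H.eval x * A₀.eval x * B₀.derivative.eval x = (greenNum lam c).derivative.eval x := fun x => by
    rw [← hQ]; simp [derivative_mul]
  -- At a hidden eigenvalue this is the ratio of the two solutions forced by -λ W'(λ) = κ ν. The
  -- default value 1 of `Function.extend` is never used, since a root of `H` is some `lam i`.
  set κ : ℝ → ℝ := fun x => if H.eval x = 0 then
    -(x * H.derivative.eval x * Wn.eval x) / Function.extend lam ν 1 x else 0 with hκ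
  -- Since `A` and `B` vanish at a hidden eigenvalue, proportionality gives s = -κ q there.
  -- Substituting into V = -A₀ s - B₀ q yields q = V / (κ A₀ - B₀). At other roots of `A` the same
  -- formula with κ = 0 gives q = -V / B₀.
  set u : ℝ → ℝ := fun x => Wn.eval x / (κ x * A₀.eval x - B₀.eval x) with hu
  have hκvis : ∀ x, H.eval x ≠ 0 → κ x = 0 := fun x hx => if_neg hx
  have hκhid : ∀ x, H.eval x = 0 → ∃ n, 0 < n ∧ 0 < x ∧
      κ x = -(x * H.derivative.eval x * Wn.eval x) / n := fun x hx => by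
    obtain ⟨i, -, rfl⟩ := (eval_hiddenPoly_eq_zero hl).1 hx
    exact ⟨ν i, hν i, hpos i, by rw [hκ]; simp only [hx, if_true, hinj.extend_apply]⟩
  -- The derivative condition for `greenNum` at its root x gives κ the sign opposite to A₀ B₀, so
  -- the two terms of κ A₀ - B₀ reinforce each other and the denominator of `u` cannot vanish.
  have hsgn : ∀ x, H.eval x = 0 →
      0 < H.derivative.eval x * A₀.eval x * B₀.eval x * Wn.eval x ∧
      (κ x * A₀.eval x - B₀.eval x) * B₀.eval x < 0 := fun x hx => by
    have h1 := hQ2 x (by rw [← hQx, hx]; ring)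
    rw [← hQ'x, hx] at h1
    have h1' : 0 < H.derivative.eval x * A₀.eval x * B₀.eval x * Wn.eval x := by
      calc _ < _ := h1
        _ = _ := by ring
    refine ⟨h1', ?_⟩
    obtain ⟨n, hn, hx0, hκx⟩ := hκhid x hx
    have h2 : (κ x * A₀.eval x - B₀.eval x) * B₀.eval x =
        -(x / n * (H.derivative.eval x * A₀.eval x * B₀.eval x * Wn.eval x)) - B₀.eval x ^ 2 := by
      rw [hκx]; field_simp
    have h3 : 0 < x / n * (H.derivative.eval x * A₀.eval x * B₀.eval x * Wn.eval x) := by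
      positivity
    rw [h2]
    nlinarith [sq_nonneg (B₀.eval x)]
  obtain ⟨q, hqd, hq0, hq⟩ := exists_interpolation (H * A₀).roots.toFinset
    (fun x hx => (hAP.root_pos (hAP.mem_roots.1 hx)).ne') u
  obtain ⟨s, hsd, hs0, hs⟩ := exists_interpolation (H * B₀).roots.toFinset
    (fun x hx => (hBP.root_pos (hBP.mem_roots.1 hx)).ne')
    (fun x => if H.eval x = 0 then -(κ x * u x) else -(Wn.eval x / A₀.eval x))
  rw [hAP.card_roots] at hqd
  rw [hBP.card_roots] at hsd
  have hq_hid : ∀ x, H.eval x = 0 → q.eval x = u x := fun x hx =>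
    hq x (hAP.mem_roots.2 (by rw [eval_mul, hx, zero_mul]))
  have hs_hid : ∀ x, H.eval x = 0 → s.eval x = -(κ x * u x) := fun x hx => by
    rw [hs x (hBP.mem_roots.2 (by rw [eval_mul, hx, zero_mul])), if_pos hx]
  have hq_vis : ∀ x, H.eval x ≠ 0 → A₀.eval x = 0 → q.eval x = -(Wn.eval x / B₀.eval x) :=
    fun x hx hx0 => by
      rw [hq x (hAP.mem_roots.2 (by rw [eval_mul, hx0, mul_zero])), hu]
      simp only [hκvis x hx, zero_mul, zero_sub, div_neg]
  have hs_vis : ∀ x, H.eval x ≠ 0 → B₀.eval x = 0 → s.eval x = -(Wn.eval x / A₀.eval x) :=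
    fun x hx hx0 => by
      rw [hs x (hBP.mem_roots.2 (by rw [eval_mul, hx0, mul_zero])), if_neg hx]
  refine ⟨q, s, hq0, hqd, fun x hx => ?_, hs0, hsd, fun x hx => ?_, ?_, fun i hi => ?_⟩
  · rw [derivative_mul, eval_add, eval_mul, eval_mul]
    by_cases hHx : H.eval x = 0
    · obtain ⟨h1, h2⟩ := hsgn x hHx
      have hD : κ x * A₀.eval x - B₀.eval x ≠ 0 := left_ne_zero_of_mul h2.ne
      have hB : B₀.eval x ≠ 0 := right_ne_zero_of_mul h2.ne
      rw [hq_hid x hHx, hHx, zero_mul, add_zero]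
      have : H.derivative.eval x * A₀.eval x * u x =
          (H.derivative.eval x * A₀.eval x * B₀.eval x * Wn.eval x) /
            ((κ x * A₀.eval x - B₀.eval x) * B₀.eval x) := by
        simp only [hu]; field_simp
      rw [this]
      exact div_neg_of_pos_of_neg h1 h2
    · have hA : A₀.eval x = 0 := by
        rw [eval_mul] at hx; exact (mul_eq_zero.1 hx).resolve_left hHx
      have h1 := hQ2 x (by rw [← hQx, hA]; ring)
      have h2 := hQ'x x
      rw [hA] at h2
      rw [← h2] at h1
      have hB : B₀.eval x ≠ 0 := by
        intro hB; rw [hB] at h1; simp at h1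
      rw [hq_vis x hHx hA, hA]
      have : (H.derivative.eval x * 0 + H.eval x * A₀.derivative.eval x) *
          -(Wn.eval x / B₀.eval x) =
          -(((H.derivative.eval x * 0 + H.eval x * A₀.derivative.eval x) * B₀.eval x +
            H.eval x * 0 * B₀.derivative.eval x) * Wn.eval x / B₀.eval x ^ 2) := by
        field_simp; ring
      rw [this, neg_lt_zero]
      positivity
  · rw [derivative_mul, eval_add, eval_mul, eval_mul]
    by_cases hHx : H.eval x = 0
    · obtain ⟨h1, h2⟩ := hsgn x hHx
      obtain ⟨n, hn, hx0, hκx⟩ := hκhid x hHx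
      have hD : κ x * A₀.eval x - B₀.eval x ≠ 0 := left_ne_zero_of_mul h2.ne
      have hB : B₀.eval x ≠ 0 := right_ne_zero_of_mul h2.ne
      have hW : Wn.eval x ≠ 0 := right_ne_zero_of_mul h1.ne'
      have hH' : H.derivative.eval x ≠ 0 :=
        left_ne_zero_of_mul (left_ne_zero_of_mul (left_ne_zero_of_mul h1.ne'))
      rw [hs_hid x hHx, hHx, zero_mul, add_zero]
      have : H.derivative.eval x * B₀.eval x * -(κ x * u x) =
          (x / n * (H.derivative.eval x * Wn.eval x * B₀.eval x) ^ 2) /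
            ((κ x * A₀.eval x - B₀.eval x) * B₀.eval x) := by
        simp only [hu]
        set D := κ x * A₀.eval x - B₀.eval x
        rw [hκx]
        field_simp
      rw [this]
      exact div_neg_of_pos_of_neg (by positivity) h2
    · have hB : B₀.eval x = 0 := by
        rw [eval_mul] at hx; exact (mul_eq_zero.1 hx).resolve_left hHx
      have h1 := hQ2 x (by rw [← hQx, hB]; ring)
      have h2 := hQ'x x
      rw [hB] at h2
      rw [← h2] at h1
      have hA : A₀.eval x ≠ 0 := by
        intro hA; rw [hA] at h1; simp at h1
      rw [hs_vis x hHx hB, hB]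
      have : (H.derivative.eval x * 0 + H.eval x * B₀.derivative.eval x) *
          -(Wn.eval x / A₀.eval x) =
          -(((H.derivative.eval x * A₀.eval x + H.eval x * A₀.derivative.eval x) * 0 +
            H.eval x * A₀.eval x * B₀.derivative.eval x) * Wn.eval x / A₀.eval x ^ 2) := by
        field_simp; ring
      rw [this, neg_lt_zero]
      positivity
  -- The Wronskian identity divided by `H`. It is checked at 0 and at all the roots of `greenNum`;
  -- these are enough nodes only because α ≠ 0 gives `greenNum` the same degree as the visible
  -- polynomial.
  · have hWnQ : Wn = A₀ * (H * B₀) - A₀ * s - B₀ * q := by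
      have h0 : (0 : ℝ) ∉ (greenNum lam c).roots.toFinset := fun h0 =>
        (hQ1.root_pos (hQ1.mem_roots.1 h0)).false
      have hA₀ : A₀ ≠ 0 := right_ne_zero_of_mul hAP.ne_zero
      have hB₀ : B₀ ≠ 0 := right_ne_zero_of_mul hBP.ne_zero
      have hdegQ : Wn.natDegree = H.natDegree + A₀.natDegree + B₀.natDegree := by
        rw [hWn, ← natDegree_greenNum hl hα0, ← hQ, natDegree_mul hAP.ne_zero hB₀,
          natDegree_mul hHne hA₀]
      rw [natDegree_mul hHne hA₀] at hqd
      rw [natDegree_mul hHne hB₀] at hsd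
      refine eq_of_natDegree_lt_card_of_eval_eq' _ _
        (insert 0 (greenNum lam c).roots.toFinset) (fun x hx => ?_) ?_
      · simp only [eval_sub, eval_mul]
        rcases Finset.mem_insert.1 hx with rfl | hx
        · have h1 := h.left_zero
          have h2 := h.right_zero
          rw [eval_mul, hH0, one_mul] at h1 h2
          rw [hs0, hq0, h1, h2, hWn0, hH0, one_mul, ← Real.exp_add,
            show -a / 2 + a / 2 = 0 by ring, Real.exp_zero]
          ring
        · have hx0 := hQ1.mem_roots.1 hx
          rw [← hQx] at hx0
          by_cases hHx : H.eval x = 0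
          · have hD : κ x * A₀.eval x - B₀.eval x ≠ 0 := left_ne_zero_of_mul (hsgn x hHx).2.ne
            rw [hq_hid x hHx, hs_hid x hHx, hHx]
            have : (κ x * A₀.eval x - B₀.eval x) * u x = Wn.eval x := mul_div_cancel₀ _ hD
            linear_combination -this
          · have h1 := hQ2 x (by rw [← hQx, hx0])
            rw [← hQ'x] at h1
            rcases mul_eq_zero.1 hx0 with h2 | hB
            · have hA := (mul_eq_zero.1 h2).resolve_left hHx
              have hB : B₀.eval x ≠ 0 := by
                intro hB; rw [hA, hB] at h1; simp at h1
              rw [hq_vis x hHx hA, hA]; field_simp; ring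
            · have hA : A₀.eval x ≠ 0 := by
                intro hA; rw [hA, hB] at h1; simp at h1
              rw [hs_vis x hHx hB, hB]; field_simp; ring
      · rw [Finset.card_insert_of_notMem h0, hQ1.card_roots, natDegree_greenNum hl hα0,
          Nat.lt_succ_iff]
        refine max_le le_rfl ?_
        rw [← hWn, hdegQ]
        refine (natDegree_sub_le _ _).trans (max_le ((natDegree_sub_le _ _).trans (max_le ?_ ?_)) ?_)
        · refine natDegree_mul_le.trans ?_
          rw [natDegree_mul hHne hB₀]; omega
        · refine natDegree_mul_le.trans ?_
          omega
        · refine natDegree_mul_le.trans ?_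
          omega
    rw [← hiddenPoly_mul_visiblePoly (c := c), ← hH, ← hWn]
    linear_combination H * hWnQ
  · have hHx : H.eval (lam i) = 0 := (eval_hiddenPoly_eq_zero hl).2 ⟨i, hi, rfl⟩
    rw [hs_hid _ hHx, hq_hid _ hHx, derivative_hidden_mul (c := c) _ hHx, ← hH, ← hWn, hκ]
    simp only [hHx, if_true, hinj.extend_apply]
    have := (hν i).ne'
    field_simp

/-- The inverse problem. -/
theorem exists_pair_of_isFactorPair (hpos : ∀ i, 0 < lam i) (hinj : Function.Injective lam)
    (hα : 0 ≤ 1 - ∑ i, |c i| ^ 2) (hα0 : 1 - ∑ i, |c i| ^ 2 ≠ 0)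
    (h : IsFactorPair lam c a A B) {ν : ι → ℝ} (hν : ∀ i, 0 < ν i)
    (hνc : ∀ i, ν i * c i ^ 2 = A.eval (lam i) ^ 2) :
    ∃ p : DiscretePair, spectrumH p = (Set.range fun i => (lam i : ℂ)) ∧
      ∀ i, norming p (lam i) = ν i ∧
        c i = (phi p.sigma a).eval (lam i) / √(norming p (lam i)) := by
  have hl : ∀ i, lam i ≠ 0 := fun i => (hpos i).ne'
  obtain ⟨hA, hB, q, s, hq0, hqd, hAq, hs0, hsd, hBs, hW, hsq⟩ :=
    exists_boundary_data hpos hinj hα hα0 h hν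
  obtain ⟨p, hap, hpA, hpB, hpq, hps⟩ := exists_glued_pair hA h.left_zero hq0 hqd hAq hB h.right_zero
    hs0 hsd hBs
  have hchar : charPoly p.sigma = rootPoly lam Finset.univ := by
    rw [charPoly_eq_phi hap, hpA, hpB, hW, ← hpq, ← hps]; ring
  have hspec := spectrumH_eq_of_charPoly hl hchar
  have hroot : ∀ i, (charPoly p.sigma).eval (lam i) = 0 := fun i => by
    rw [eval_charPoly_eq_zero_iff, hspec]; exact ⟨i, rfl⟩
  have hnorm : ∀ i, norming p (lam i) = ν i := by
    intro i
    obtain ⟨κ, hκ0, hκ⟩ := exists_phiL_eq_mul (hroot i)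
    have h1 := neg_mul_derivative_charPoly p hκ
    have h2 := hκ a
    rw [hpA, hpB] at h2
    by_cases hi : c i = 0
    -- At a hidden eigenvalue the values at `a` vanish and carry no information, so the ratio κ is
    -- read from the exponential coefficients instead.
    · have h3 := eval_coefQ_mirror hap (hroot i) hκ
      have h4 := congrArg (eval (lam i)) (phi_eq_coef p.sigma a)
      have h5 := congrArg (eval (lam i)) hpq
      have h6 := congrArg (eval (lam i)) hps
      rw [hpA, h.left_eq_zero i hi] at h4
      simp only [eval_add, eval_mul, eval_C] at h4 h5 h6
      have h7 : s.eval (lam i) = -(κ * q.eval (lam i)) := by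
        rw [← h5, ← h6, h3]; linear_combination -κ * h4
      have h8 := hsq i hi
      have hq : q.eval (lam i) ≠ 0 := by
        have := hAq _ (h.left_eq_zero i hi)
        exact right_ne_zero_of_mul this.ne
      rw [h7, ← hchar] at h8
      have h9 : κ * q.eval (lam i) * (norming p (lam i) - ν i) = 0 := by
        linear_combination -q.eval (lam i) * h1 + h8
      have := (mul_eq_zero.1 h9).resolve_left (mul_ne_zero hκ0 hq)
      linarith
    · have h3 := congrArg (eval (lam i)) h.mul_eq
      rw [eval_hidden_mul_greenNum hl, ← hchar, h1, eval_mul, h2, sq_abs] at h3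
      have h4 := hνc i
      have h5 : κ * c i ^ 2 * (norming p (lam i) - ν i) = 0 := by
        linear_combination -h3 - κ * h4
      have := (mul_eq_zero.1 h5).resolve_left (mul_ne_zero hκ0 (pow_ne_zero 2 hi))
      linarith
  refine ⟨p, hspec, fun i => ⟨hnorm i, ?_⟩⟩
  rw [hnorm, hpA, eq_div_iff (Real.sqrt_pos.2 (hν i)).ne']
  by_cases hi : c i = 0
  · rw [h.left_eq_zero i hi, hi, zero_mul]
  · have h1 : (c i * √(ν i)) ^ 2 = A.eval (lam i) ^ 2 := by
      rw [mul_pow, Real.sq_sqrt (hν i).le, ← hνc i, mul_comm]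
    rcases sq_eq_sq_iff_eq_or_eq_neg.1 h1 with h2 | h2
    · exact h2
    -- The norming constant determines the value of `A` only up to sign; the sign condition of the
    -- factor pair excludes the wrong one.
    · have h3 := h.sign i hi
      have h4 := Real.sqrt_pos.2 (hν i)
      have h5 : A.eval (lam i) = -(c i * √(ν i)) := by linarith
      rw [h5] at h3
      have : 0 ≤ c i ^ 2 * √(ν i) := by positivity
      nlinarith

end Inverse

/-! ### Counting the factorizations -/

lemma eval_mul_eval_pos {p : ℝ[X]} {l u : ℝ} (hlu : l ≤ u) (h : ∀ x ∈ Set.Icc l u, p.eval x ≠ 0) :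
    0 < p.eval l * p.eval u := by
  by_contra hcon
  push Not at hcon
  have hl := h l ⟨le_rfl, hlu⟩
  have hu := h u ⟨hlu, le_rfl⟩
  have hc : ContinuousOn (fun x => p.eval x) (Set.Icc l u) := p.continuous.continuousOn
  rcases hl.lt_or_gt with h1 | h1
  · have h2 : 0 ≤ p.eval u := by nlinarith
    obtain ⟨x, hx, hx0⟩ := intermediate_value_Icc hlu hc ⟨h1.le, h2⟩
    exact h x hx hx0
  · have h2 : p.eval u ≤ 0 := by nlinarith
    obtain ⟨x, hx, hx0⟩ := intermediate_value_Icc' hlu hc ⟨h2, h1.le⟩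
    exact h x hx hx0

section Uniqueness

variable {ι : Type*} [Fintype ι] [DecidableEq ι] {lam c : ι → ℝ} {a : ℝ} {A B A' B' : ℝ[X]}

lemma IsFactorPair.posSimpleRoots (h : IsFactorPair lam c a A B) (hpos : ∀ i, 0 < lam i)
    (hinj : Function.Injective lam) (hα : 0 ≤ 1 - ∑ i, |c i| ^ 2) : PosSimpleRoots A := by
  obtain ⟨A₀, B₀, rfl, rfl, hQ⟩ := h.exists_factors hpos hinj
  exact posSimpleRoots_hidden_mul hpos hinj hα hQ

lemma IsFactorPair.eval_greenNum_eq_zero (h : IsFactorPair lam c a A B) (hpos : ∀ i, 0 < lam i)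
    (hinj : Function.Injective lam) {x : ℝ}
    (hx : (hiddenPoly lam c * greenNum lam c).eval x = 0) : (greenNum lam c).eval x = 0 := by
  obtain ⟨A₀, B₀, -, -, hQ⟩ := h.exists_factors hpos hinj
  rw [eval_mul] at hx
  rcases mul_eq_zero.1 hx with h0 | h0
  · rw [← hQ, eval_mul, eval_mul, h0, zero_mul, zero_mul]
  · exact h0

/-- The roots below the largest eigenvalue with nonvanishing datum are determined by the data. -/
lemma IsFactorPair.lt_of_root (h : IsFactorPair lam c a A B) (h' : IsFactorPair lam c a A' B')
    (hpos : ∀ i, 0 < lam i) (hinj : Function.Injective lam) (hα : 0 ≤ 1 - ∑ i, |c i| ^ 2) {x : ℝ}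
    (hx : A.eval x = 0) (hx' : A'.eval x ≠ 0) : ∀ i, c i ≠ 0 → lam i < x := by
  have hl : ∀ i, lam i ≠ 0 := fun i => (hpos i).ne'
  obtain ⟨-, -, hsep⟩ := greenNum_roots hpos hinj hα
  have hA := h.posSimpleRoots hpos hinj hα
  by_contra! hcon
  obtain ⟨j, hj, hxj⟩ := hcon
  have hne : ∀ i, c i ≠ 0 → lam i ≠ x := by
    rintro i hi rfl
    have := h.sign i hi
    rw [hx, mul_zero] at this
    exact this.false
  -- The points at which the sign of `A` is prescribed; 0 serves as the left endpoint for roots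
  -- below all visible eigenvalues.
  set T := insert 0 ((Finset.univ.filter fun i => c i ≠ 0).image lam) with hT
  have hmemT : ∀ i, c i ≠ 0 → lam i ∈ T := fun i hi =>
    Finset.mem_insert_of_mem (Finset.mem_image_of_mem _ (by simpa using hi))
  have hsign : ∀ t ∈ T, 0 < A.eval t * A'.eval t := by
    intro t ht
    rcases Finset.mem_insert.1 ht with rfl | ht
    · rw [h.left_zero, h'.left_zero]
      positivity
    · obtain ⟨i, hi, rfl⟩ := Finset.mem_image.1 ht
      have hi' : c i ≠ 0 := by simpa using hi
      have h1 := mul_pos (h.sign i hi') (h'.sign i hi')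
      have h2 : 0 < c i ^ 2 := by positivity
      by_contra hcon
      push Not at hcon
      nlinarith
  have hlne : (T.filter (· < x)).Nonempty :=
    ⟨0, Finset.mem_filter.2 ⟨Finset.mem_insert_self _ _, hA.root_pos hx⟩⟩
  have hune : (T.filter (x < ·)).Nonempty :=
    ⟨lam j, Finset.mem_filter.2 ⟨hmemT j hj, lt_of_le_of_ne hxj (hne j hj).symm⟩⟩
  set l := (T.filter (· < x)).max' hlne
  set u := (T.filter (x < ·)).min' hune
  obtain ⟨hlT, hlx⟩ := Finset.mem_filter.1 ((T.filter (· < x)).max'_mem hlne)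
  obtain ⟨huT, hxu⟩ := Finset.mem_filter.1 ((T.filter (x < ·)).min'_mem hune)
  have hQx : (greenNum lam c).eval x = 0 := by
    refine h.eval_greenNum_eq_zero hpos hinj ?_
    rw [← h.mul_eq, eval_mul, hx, zero_mul]
  -- Between consecutive points of `T` there is room for one root only, because two would be
  -- separated by a visible eigenvalue.
  have honly : ∀ y ∈ Set.Icc l u, (hiddenPoly lam c * greenNum lam c).eval y = 0 → y = x := by
    intro y hy hy0
    have hQy := h.eval_greenNum_eq_zero hpos hinj hy0
    by_contra hyx
    rcases lt_or_gt_of_ne hyx with hlt | hlt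
    · obtain ⟨i, hi, h1, h2⟩ := hsep y x hlt hQy hQx
      have := (T.filter (· < x)).le_max' (lam i) (Finset.mem_filter.2 ⟨hmemT i hi, h2⟩)
      exact (hy.1.trans_lt h1).not_ge this
    · obtain ⟨i, hi, h1, h2⟩ := hsep x y hlt hQx hQy
      have := (T.filter (x < ·)).min'_le (lam i) (Finset.mem_filter.2 ⟨hmemT i hi, h1⟩)
      exact (h2.trans_le hy.2).not_ge this
  have h1 : 0 < A'.eval l * A'.eval u := by
    refine eval_mul_eval_pos (hlx.trans hxu).le fun y hy hy0 => hx' ?_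
    rw [← honly y hy (by rw [← h'.mul_eq, eval_mul, hy0, zero_mul]), hy0]
  obtain ⟨R, hR⟩ := dvd_iff_isRoot.2 hx
  have hRx : R.eval x ≠ 0 := by
    have := hA.simple x hx
    rw [hR] at this
    simpa using this
  have h2 : 0 < R.eval l * R.eval u := by
    refine eval_mul_eval_pos (hlx.trans hxu).le fun y hy hy0 => hRx ?_
    rw [← honly y hy (by rw [← h.mul_eq, eval_mul, hR, eval_mul, hy0]; ring), hy0]
  -- `A` changes sign across its simple root `x`, whereas `A'` has no root in the interval; yet the
  -- two agree in sign at both endpoints.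
  have h3 : A.eval l * A.eval u = (l - x) * (u - x) * (R.eval l * R.eval u) := by
    rw [hR]; simp only [eval_mul, eval_sub, eval_X, eval_C]; ring
  have h4 : A.eval l * A.eval u < 0 := by
    rw [h3]
    exact mul_neg_of_neg_of_pos
      (mul_neg_of_neg_of_pos (sub_neg.2 hlx) (sub_pos.2 hxu)) h2
  have h5 := mul_pos (hsign l hlT) (hsign u huT)
  nlinarith

lemma IsFactorPair.ext (h : IsFactorPair lam c a A B) (h' : IsFactorPair lam c a A' B')
    (hpos : ∀ i, 0 < lam i) (hinj : Function.Injective lam) (hα : 0 ≤ 1 - ∑ i, |c i| ^ 2)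
    (hroots : ∀ x, A.eval x = 0 ↔ A'.eval x = 0) : A = A' :=
  (h.posSimpleRoots hpos hinj hα).ext (h'.posSimpleRoots hpos hinj hα) hroots
    (h.left_zero.trans h'.left_zero.symm)

/-- The largest eigenvalue is itself a root of `greenNum` and is shared by all factor pairs. A root
on which two pairs disagree would lie beyond every visible eigenvalue, and nothing visible could
separate it from this one. -/
lemma IsFactorPair.eq_of_hidden_max (h : IsFactorPair lam c a A B)
    (h' : IsFactorPair lam c a A' B') (hpos : ∀ i, 0 < lam i) (hinj : Function.Injective lam)
    (hα : 0 ≤ 1 - ∑ i, |c i| ^ 2) {L : ι} (hL : ∀ i, lam i ≤ lam L) (hcL : c L = 0) : A = A' := by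
  have hl : ∀ i, lam i ≠ 0 := fun i => (hpos i).ne'
  obtain ⟨-, -, hsep⟩ := greenNum_roots hpos hinj hα
  have key : ∀ {A B A' B' : ℝ[X]}, IsFactorPair lam c a A B → IsFactorPair lam c a A' B' →
      ∀ x, A.eval x = 0 → A'.eval x = 0 := by
    intro A B A' B' h h' x hx
    by_contra hx'
    have h1 := h.lt_of_root h' hpos hinj hα hx hx'
    have hQx : (greenNum lam c).eval x = 0 :=
      h.eval_greenNum_eq_zero hpos hinj (by rw [← h.mul_eq, eval_mul, hx, zero_mul])
    have hQL : (greenNum lam c).eval (lam L) = 0 :=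
      h.eval_greenNum_eq_zero hpos hinj
        (by rw [eval_mul, (eval_hiddenPoly_eq_zero hl).2 ⟨L, hcL, rfl⟩, zero_mul])
    rcases lt_trichotomy x (lam L) with hlt | rfl | hlt
    · obtain ⟨i, hi, h2, -⟩ := hsep _ _ hlt hQx hQL
      exact (h1 i hi).not_gt h2
    · exact hx' (h'.left_eq_zero L hcL)
    · obtain ⟨i, -, h2, -⟩ := hsep _ _ hlt hQL hQx
      exact (hL i).not_gt h2
  exact h.ext h' hpos hinj hα fun x => ⟨key h h' x, key h' h x⟩

lemma leadingCoeff_linear {l : ℝ} (hl : l ≠ 0) :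
    (1 - C l⁻¹ * X : ℝ[X]).leadingCoeff = -l⁻¹ := by
  rw [leadingCoeff, natDegree_linear hl]; simp [coeff_one]

/-- If the datum at the largest eigenvalue does not vanish, there is a root beyond it. -/
lemma exists_root_beyond (hpos : ∀ i, 0 < lam i) (hinj : Function.Injective lam)
    (hα : 0 < 1 - ∑ i, |c i| ^ 2) {L : ι} (hL : ∀ i, lam i ≤ lam L) (hcL : c L ≠ 0) :
    ∃ μ, lam L < μ ∧ (greenNum lam c).eval μ = 0 := by
  have hl : ∀ i, lam i ≠ 0 := fun i => (hpos i).ne'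
  have hLmem : L ∈ Finset.univ.filter fun i => c i ≠ 0 := by simpa using hcL
  set R := rootPoly lam ((Finset.univ.filter fun i => c i ≠ 0).erase L) with hR
  -- All roots of `R` lie below `lam L`, so there it already has its sign at +∞.
  have hRpos : 0 < R.eval (lam L) * R.leadingCoeff := by
    rw [hR, rootPoly, eval_prod, leadingCoeff_prod, ← Finset.prod_mul_distrib]
    refine Finset.prod_pos fun i hi => ?_
    rw [leadingCoeff_linear (hl i)]
    have h1 : lam i < lam L := lt_of_le_of_ne (hL i) fun h => Finset.ne_of_mem_erase hi (hinj h)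
    have h2 := hpos i
    simp only [eval_sub, eval_one, eval_mul, eval_C, eval_X]
    have h3 : (1 - (lam i)⁻¹ * lam L) * -(lam i)⁻¹ = (lam L - lam i) * (lam i)⁻¹ ^ 2 := by
      have := hl i
      field_simp; ring
    rw [h3]
    have := sub_pos.2 h1
    positivity
  have hlead : (visiblePoly lam c).leadingCoeff = -(lam L)⁻¹ * R.leadingCoeff := by
    rw [visiblePoly, ← mul_rootPoly_erase hLmem, leadingCoeff_mul, leadingCoeff_linear (hl L)]
  have hder : (visiblePoly lam c).derivative.eval (lam L) = -(lam L)⁻¹ * R.eval (lam L) :=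
    derivative_rootPoly_eval hLmem hl
  have hRl : R.leadingCoeff ≠ 0 := right_ne_zero_of_mul hRpos.ne'
  -- Normalizing by this coefficient gives top coefficient α times a square: `P` tends to +∞, while
  -- it is negative at `lam L`.
  set P := C ((visiblePoly lam c).leadingCoeff) * greenNum lam c with hP
  have hneg : P.eval (lam L) < 0 := by
    rw [hP, eval_mul, eval_C, eval_greenNum hl hcL, hlead, hder]
    have h1 := hpos L
    have h2 : 0 < |c L| := abs_pos.2 hcL
    have : 0 < lam L * |c L| ^ 2 * (lam L)⁻¹ ^ 2 * (R.eval (lam L) * R.leadingCoeff) := by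
      positivity
    nlinarith
  have hPd : P.natDegree = (visiblePoly lam c).natDegree := by
    rw [hP, natDegree_C_mul (leadingCoeff_ne_zero.2 visiblePoly_ne_zero),
      natDegree_greenNum hl hα.ne']
  have hPdeg : 0 < P.degree := by
    rw [← natDegree_pos_iff_degree_pos, hPd, natDegree_visiblePoly hl]
    exact Finset.card_pos.2 ⟨L, hLmem⟩
  have hPlead : 0 ≤ P.leadingCoeff := by
    rw [leadingCoeff, hPd, hP, coeff_C_mul, coeff_greenNum hl]
    nlinarith [mul_nonneg hα.le (mul_self_nonneg (visiblePoly lam c).leadingCoeff)]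
  obtain ⟨M, hM1, hM2⟩ := (((tendsto_atTop_of_leadingCoeff_nonneg P hPdeg hPlead).eventually_gt_atTop
    0).and (eventually_gt_atTop (lam L))).exists
  obtain ⟨μ, hμ, hμ0⟩ := intermediate_value_Icc hM2.le P.continuous.continuousOn ⟨hneg.le, hM1.le⟩
  refine ⟨μ, lt_of_le_of_ne hμ.1 ?_, ?_⟩
  · rintro rfl
    exact hneg.ne hμ0
  · simp only [hP, eval_mul, eval_C] at hμ0
    exact (mul_eq_zero.1 hμ0).resolve_left (leadingCoeff_ne_zero.2 visiblePoly_ne_zero)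

lemma eval_linear_pos {l x : ℝ} (hx : 0 < l) (hlx : x < l) :
    0 < (1 - C l⁻¹ * X : ℝ[X]).eval x := by
  simp only [eval_sub, eval_one, eval_mul, eval_C, eval_X]
  rw [sub_pos, inv_mul_lt_iff₀ hx]
  linarith

/-- The factor 1 - z/μ is 1 at the origin and positive at every eigenvalue, so transferring it
affects neither the normalizations nor the sign conditions. -/
lemma IsFactorPair.move_right {μ : ℝ} (h : IsFactorPair lam c a ((1 - C μ⁻¹ * X) * A) B)
    (hμ0 : 0 < μ) (hμ : ∀ i, lam i < μ) : IsFactorPair lam c a A ((1 - C μ⁻¹ * X) * B) := by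
  have hlin := fun i => eval_linear_pos hμ0 (hμ i)
  refine ⟨by rw [← h.mul_eq]; ring, fun i hi => ?_, fun i hi => ?_, ?_, ?_, fun i hi => ?_⟩
  · have := h.left_eq_zero i hi
    rw [eval_mul] at this
    exact (mul_eq_zero.1 this).resolve_left (hlin i).ne'
  · rw [eval_mul, h.right_eq_zero i hi, mul_zero]
  · simpa using h.left_zero
  · simpa using h.right_zero
  · have := h.sign i hi
    rw [eval_mul, mul_left_comm] at this
    exact (mul_pos_iff_of_pos_left (hlin i)).1 this

lemma IsFactorPair.move_left {μ : ℝ} (h : IsFactorPair lam c a A ((1 - C μ⁻¹ * X) * B))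
    (hμ0 : 0 < μ) (hμ : ∀ i, lam i < μ) : IsFactorPair lam c a ((1 - C μ⁻¹ * X) * A) B := by
  have hlin := fun i => eval_linear_pos hμ0 (hμ i)
  refine ⟨by rw [← h.mul_eq]; ring, fun i hi => ?_, fun i hi => ?_, ?_, ?_, fun i hi => ?_⟩
  · rw [eval_mul, h.left_eq_zero i hi, mul_zero]
  · have := h.right_eq_zero i hi
    rw [eval_mul] at this
    exact (mul_eq_zero.1 this).resolve_left (hlin i).ne'
  · simpa using h.left_zero
  · simpa using h.right_zero
  · rw [eval_mul, mul_left_comm]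
    exact mul_pos (hlin i) (h.sign i hi)

lemma exists_eq_linear_mul {μ : ℝ} (hμ : μ ≠ 0) (hA : A.eval μ = 0) :
    ∃ R : ℝ[X], A = (1 - C μ⁻¹ * X) * R := by
  obtain ⟨R, rfl⟩ := dvd_iff_isRoot.2 hA
  refine ⟨C (-μ) * R, ?_⟩
  have : C μ⁻¹ * C μ = (1 : ℝ[X]) := by rw [← C_mul, inv_mul_cancel₀ hμ, C_1]
  rw [C_neg]
  linear_combination (-X * R) * this

/-- If the datum at the largest eigenvalue does not vanish, there are exactly two factor pairs. -/
lemma IsFactorPair.exists_second (h : IsFactorPair lam c a A B) (hpos : ∀ i, 0 < lam i)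
    (hinj : Function.Injective lam) (hα : 0 < 1 - ∑ i, |c i| ^ 2) {L : ι}
    (hL : ∀ i, lam i ≤ lam L) (hcL : c L ≠ 0) :
    ∃ A₁ B₁ : ℝ[X], IsFactorPair lam c a A₁ B₁ ∧ A₁.eval (lam L) ^ 2 ≠ A.eval (lam L) ^ 2 ∧
      ∀ A' B', IsFactorPair lam c a A' B' → A' = A ∨ A' = A₁ := by
  have hl : ∀ i, lam i ≠ 0 := fun i => (hpos i).ne'
  obtain ⟨hQ, -, hsep⟩ := greenNum_roots hpos hinj hα.le
  obtain ⟨μ, hLμ, hμQ⟩ := exists_root_beyond hpos hinj hα hL hcL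
  have hμ : ∀ i, lam i < μ := fun i => (hL i).trans_lt hLμ
  have hμ0 : 0 < μ := (hpos L).trans hLμ
  have hHμ : (hiddenPoly lam c).eval μ ≠ 0 := fun h0 => by
    obtain ⟨i, -, hi⟩ := (eval_hiddenPoly_eq_zero hl).1 h0
    exact (hμ i).ne' hi
  have hlin0 : (1 - C μ⁻¹ * X : ℝ[X]).eval μ = 0 := by simp [hμ0.ne']
  -- The factor lies strictly between 0 and 1 at the largest eigenvalue, which makes the two
  -- resulting norming constants there different.
  have hlinL : ((1 - C μ⁻¹ * X : ℝ[X]).eval (lam L)) ^ 2 ≠ 1 := by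
    have h1 := eval_linear_pos hμ0 (hμ L)
    have h2 : (1 - C μ⁻¹ * X : ℝ[X]).eval (lam L) < 1 := by
      simp only [eval_sub, eval_one, eval_mul, eval_C, eval_X]
      have := mul_pos (inv_pos.2 hμ0) (hpos L)
      linarith
    intro h3
    nlinarith
  have hnotboth : ∀ {A B : ℝ[X]}, IsFactorPair lam c a A B →
      ¬ (A.eval μ = 0 ∧ B.eval μ = 0) := by
    intro A B h ⟨h1, h2⟩
    have h3 := congrArg (fun p => p.derivative.eval μ) h.mul_eq
    simp only [derivative_mul, eval_add, eval_mul, h1, h2, hμQ] at h3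
    have := mul_ne_zero hHμ (hQ.simple μ hμQ)
    apply this
    linarith
  have hone : ∀ {A B : ℝ[X]}, IsFactorPair lam c a A B → A.eval μ = 0 ∨ B.eval μ = 0 := by
    intro A B h
    have := congrArg (eval μ) h.mul_eq
    rw [eval_mul, eval_mul, hμQ, mul_zero] at this
    exact mul_eq_zero.1 this
  have key : ∀ {A B A' B' : ℝ[X]}, IsFactorPair lam c a A B → IsFactorPair lam c a A' B' →
      ∀ x, x ≠ μ → A.eval x = 0 → A'.eval x = 0 := by
    intro A B A' B' h h' x hxμ hx
    by_contra hx'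
    have h1 := h.lt_of_root h' hpos hinj hα.le hx hx' L hcL
    have hQx : (greenNum lam c).eval x = 0 :=
      h.eval_greenNum_eq_zero hpos hinj (by rw [← h.mul_eq, eval_mul, hx, zero_mul])
    rcases lt_or_gt_of_ne hxμ with hlt | hlt
    · obtain ⟨i, -, h2, -⟩ := hsep _ _ hlt hQx hμQ
      exact (hL i).not_gt (h1.trans h2)
    · obtain ⟨i, -, h2, -⟩ := hsep _ _ hlt hμQ hQx
      exact (hL i).not_gt (hLμ.trans h2)
  -- All roots other than μ are forced, so a factor pair is determined by whether μ is a root of its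
  -- first member.
  have heq : ∀ {A B A' B' : ℝ[X]}, IsFactorPair lam c a A B → IsFactorPair lam c a A' B' →
      (A.eval μ = 0 ↔ A'.eval μ = 0) → A = A' := by
    intro A B A' B' h h' hμA
    refine h.ext h' hpos hinj hα.le fun x => ?_
    rcases eq_or_ne x μ with rfl | hx
    · exact hμA
    · exact ⟨key h h' x hx, key h' h x hx⟩
  have hAL : A.eval (lam L) ≠ 0 := right_ne_zero_of_mul (h.sign L hcL).ne'
  obtain ⟨A₁, B₁, h1, hne, hμ1⟩ : ∃ A₁ B₁ : ℝ[X], IsFactorPair lam c a A₁ B₁ ∧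
      A₁.eval (lam L) ^ 2 ≠ A.eval (lam L) ^ 2 ∧ (A₁.eval μ = 0 ↔ A.eval μ ≠ 0) := by
    rcases hone h with hA | hB
    · obtain ⟨A₁, rfl⟩ := exists_eq_linear_mul hμ0.ne' hA
      have h1 := h.move_right hμ0 hμ
      refine ⟨A₁, _, h1, fun heq => ?_, ?_⟩
      · rw [eval_mul] at heq hAL
        have h2 : A₁.eval (lam L) ^ 2 ≠ 0 := pow_ne_zero 2 (right_ne_zero_of_mul hAL)
        rw [mul_pow] at heq
        exact hlinL (mul_right_cancel₀ h2 (by rw [one_mul]; exact heq.symm))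
      · have h2 : A₁.eval μ ≠ 0 := fun h2 => hnotboth h1 ⟨h2, by rw [eval_mul, hlin0, zero_mul]⟩
        simp [h2, hA]
    · have hA : A.eval μ ≠ 0 := fun hA => hnotboth h ⟨hA, hB⟩
      obtain ⟨B₁, rfl⟩ := exists_eq_linear_mul hμ0.ne' hB
      refine ⟨_, B₁, h.move_left hμ0 hμ, fun heq => ?_, ?_⟩
      · rw [eval_mul, mul_pow] at heq
        exact hlinL (mul_right_cancel₀ (pow_ne_zero 2 hAL) (by rw [one_mul, heq]))
      · rw [eval_mul, hlin0, zero_mul]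
        simp [hA]
  refine ⟨A₁, B₁, h1, hne, fun A' B' h' => ?_⟩
  by_cases hA' : A'.eval μ = 0 ↔ A.eval μ = 0
  · exact Or.inl (heq h' h hA')
  · exact Or.inr (heq h' h1 (by rw [hμ1]; tauto))

end Uniqueness

/-! ### The set of possible norming constants -/

section NormingData

variable {ι : Type*} [Fintype ι]

/-- The norming constants of all the pairs with the spectrum `lam` and the interior data `c`. -/
def normingData (a : ℝ) (lam c : ι → ℝ) : Set (ι → ℝ) :=
  {ν | ∃ p : DiscretePair, spectrumH p = (Set.range fun i => (lam i : ℂ)) ∧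
    ∀ i, norming p (lam i) = ν i ∧ c i = (phi p.sigma a).eval (lam i) / √(norming p (lam i))}

/-- Norming constants that are prescribed where `c` does not vanish, and free and positive
elsewhere. -/
def normingSlice (c d : ι → ℝ) : Set (ι → ℝ) :=
  {ν | ∀ i, (c i ≠ 0 → ν i = d i) ∧ (c i = 0 → 0 < ν i)}

variable [DecidableEq ι] {a : ℝ} {lam c : ι → ℝ}

lemma IsFactorPair.normingSlice_subset {A B : ℝ[X]} (h : IsFactorPair lam c a A B)
    (hpos : ∀ i, 0 < lam i) (hinj : Function.Injective lam) (hα : 0 < 1 - ∑ i, |c i| ^ 2) :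
    normingSlice c (fun i => (A.eval (lam i) / c i) ^ 2) ⊆ normingData a lam c := by
  intro ν hν
  refine exists_pair_of_isFactorPair hpos hinj hα.le hα.ne' h (fun i => ?_) fun i => ?_
  · by_cases hi : c i = 0
    · exact (hν i).2 hi
    · rw [(hν i).1 hi]
      have : A.eval (lam i) ≠ 0 := right_ne_zero_of_mul (h.sign i hi).ne'
      positivity
  · by_cases hi : c i = 0
    · rw [hi, h.left_eq_zero i hi]; simp
    · rw [(hν i).1 hi]; field_simp

lemma exists_isFactorPair_of_mem (hpos : ∀ i, 0 < lam i) (hinj : Function.Injective lam)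
    {ν : ι → ℝ} (hν : ν ∈ normingData a lam c) : ∃ A B : ℝ[X], IsFactorPair lam c a A B ∧
      ν ∈ normingSlice c (fun i => (A.eval (lam i) / c i) ^ 2) ∧ 0 ≤ 1 - ∑ i, |c i| ^ 2 := by
  obtain ⟨p, hp, h⟩ := hν
  obtain ⟨h1, h2, h3⟩ := isFactorPair_of_interior_data hpos hinj hp fun i => (h i).2
  refine ⟨_, _, h1, fun i => ⟨fun hi => ?_, fun hi => ?_⟩, h3⟩
  · have := (h2 i).2
    rw [(h i).1] at this
    simp only [div_pow]
    rw [← this]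
    field_simp
  · rw [← (h i).1]; exact (h2 i).1

/-- Each factor pair accounts for exactly one slice, so the number of slices is the number of
possible `A`. Existence of one pair with the data gives α ≥ 0, and with α ≠ 0 the strict inequality
used in the inverse problem. -/
theorem normingData_eq (hpos : ∀ i, 0 < lam i) (hinj : Function.Injective lam)
    (hne : (normingData a lam c).Nonempty) (hα0 : 1 - ∑ i, |c i| ^ 2 ≠ 0) {L : ι}
    (hL : ∀ i, lam i ≤ lam L) :
    (c L = 0 → ∃ d, normingData a lam c = normingSlice c d) ∧
    (c L ≠ 0 → ∃ d d', d L ≠ d' L ∧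
      normingData a lam c = normingSlice c d ∪ normingSlice c d') := by
  obtain ⟨ν₀, hν₀⟩ := hne
  obtain ⟨A, B, h, -, hα'⟩ := exists_isFactorPair_of_mem hpos hinj hν₀
  have hα : 0 < 1 - ∑ i, |c i| ^ 2 := lt_of_le_of_ne hα' hα0.symm
  refine ⟨fun hcL => ⟨fun i => (A.eval (lam i) / c i) ^ 2, ?_⟩, fun hcL => ?_⟩
  · refine Set.Subset.antisymm (fun ν hν => ?_) (h.normingSlice_subset hpos hinj hα)
    obtain ⟨A', B', h', hν', -⟩ := exists_isFactorPair_of_mem hpos hinj hν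
    rwa [h.eq_of_hidden_max h' hpos hinj hα' hL hcL]
  · obtain ⟨A₁, B₁, h₁, hneq, hall⟩ := h.exists_second hpos hinj hα hL hcL
    refine ⟨fun i => (A.eval (lam i) / c i) ^ 2, fun i => (A₁.eval (lam i) / c i) ^ 2, ?_, ?_⟩
    · intro heq
      simp only [div_pow] at heq
      exact hneq ((div_left_inj' (pow_ne_zero 2 hcL)).1 heq.symm)
    · refine Set.Subset.antisymm (fun ν hν => ?_) (Set.union_subset
        (h.normingSlice_subset hpos hinj hα) (h₁.normingSlice_subset hpos hinj hα))
      obtain ⟨A', B', h', hν', -⟩ := exists_isFactorPair_of_mem hpos hinj hν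
      rcases hall A' B' h' with rfl | rfl
      · exact Or.inl hν'
      · exact Or.inr hν'

end NormingData

/-! ### Reflection of the spectrum -/

section Reflection

/-- The pair with the sign of `omega` changed, whose spectrum is reflected at the origin. -/
noncomputable def DiscretePair.neg (p : DiscretePair) : DiscretePair := ⟨-p.omega, p.v, p.v_nonneg⟩

lemma neg_neg_pair (p : DiscretePair) : p.neg.neg = p := by
  ext <;> simp [DiscretePair.neg]

lemma IsSolution.neg {𝕜 : Type*} [RCLike 𝕜] {p : DiscretePair} {z : 𝕜} {f : ℝ → 𝕜}
    (h : IsSolution p z f) : IsSolution p.neg (-z) f := by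
  have hs : p.neg.supp = p.supp := by ext x; simp [DiscretePair.supp, DiscretePair.neg]
  refine ⟨h.continuous, fun x hx => h.ode x (hs ▸ hx), fun x hx => ?_⟩
  obtain ⟨dl, dr, h1, h2, h3⟩ := h.jump x (hs ▸ hx)
  refine ⟨dl, dr, h1, h2, ?_⟩
  rw [h3]
  simp [DiscretePair.neg]

lemma isSolution_neg_iff {𝕜 : Type*} [RCLike 𝕜] {p : DiscretePair} {z : 𝕜} {f : ℝ → 𝕜} :
    IsSolution p.neg (-z) f ↔ IsSolution p z f :=
  ⟨fun h => by simpa [neg_neg_pair] using h.neg, IsSolution.neg⟩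

lemma neg_mem_spectrumH_neg_iff {p : DiscretePair} {z : ℂ} :
    -z ∈ spectrumH p.neg ↔ z ∈ spectrumH p := by
  simp only [spectrumH, Set.mem_ofPred_eq, isSolution_neg_iff]

lemma phi_neg_eval (p : DiscretePair) (lam x : ℝ) :
    (phi p.neg.sigma x).eval (-lam) = (phi p.sigma x).eval lam := by
  have h := (isPhiPlus_iff p lam fun x => (phi p.sigma x).eval lam).2 rfl
  have h' : IsPhiPlus p.neg (-lam) fun x => (phi p.sigma x).eval lam := by
    refine ⟨?_, h.2⟩
    have := h.1.neg
    simpa using this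
  exact (congrFun ((isPhiPlus_iff _ _ _).1 h') x).symm

/-- Both λ and γ² change sign, so their product does not. -/
lemma norming_neg (p : DiscretePair) (lam : ℝ) : norming p.neg (-lam) = norming p lam := by
  have h1 : p.neg.omega.sum (fun x m => |(phi p.sigma x).eval lam| ^ 2 * m) =
      -p.omega.sum (fun x m => |(phi p.sigma x).eval lam| ^ 2 * m) := by
    simp [DiscretePair.neg, Finsupp.sum, Finsupp.support_neg]
  have h2 : p.neg.v = p.v := rfl
  simp only [norming, gammaSq, phi_neg_eval, h1, h2]
  ring

variable {ι : Type*}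

lemma normingData_subset_neg (a : ℝ) (lam c : ι → ℝ) :
    normingData a lam c ⊆ normingData a (fun i => -lam i) c := by
  rintro ν ⟨p, hp, h⟩
  refine ⟨p.neg, ?_, fun i => ?_⟩
  · ext z
    rw [← neg_neg z, neg_mem_spectrumH_neg_iff, hp]
    simp [neg_eq_iff_eq_neg]
  · rw [phi_neg_eval, norming_neg]; exact h i

lemma normingData_neg (a : ℝ) (lam c : ι → ℝ) :
    normingData a (fun i => -lam i) c = normingData a lam c :=
  Set.Subset.antisymm (by simpa using normingData_subset_neg a (fun i => -lam i) c)
    (normingData_subset_neg a lam c)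

end Reflection

/-! ### Translation to spectral data -/

section SpectralData

variable {N : ℕ} {p : DiscretePair} {a : ℝ} {lam c ν : Fin N → ℝ}

lemma isSpectralData_iff :
    IsSpectralData p lam ν ↔ HasEigenvalues p lam ∧ ∀ i, norming p (lam i) = ν i := by
  simp only [IsSpectralData, isPhiPlus_iff, exists_eq_left, norming, eq_comm]

lemma isInteriorSpectralData_iff :
    IsInteriorSpectralData p a lam c ↔ HasEigenvalues p lam ∧
      ∀ i, c i = (phi p.sigma a).eval (lam i) / √(norming p (lam i)) := by
  simp only [IsInteriorSpectralData, isPhiPlus_iff, exists_eq_left, norming]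

lemma HasEigenvalues.unique {lam' : Fin N → ℝ} (h : HasEigenvalues p lam)
    (h' : HasEigenvalues p lam') : lam = lam' := by
  refine (StrictMono.range_inj h.1 h'.1).1 ?_
  have h1 := h.2.symm.trans h'.2
  have h2 : ∀ l : Fin N → ℝ, (Set.range fun i => (l i : ℂ)) = (fun x : ℝ => (x : ℂ)) '' Set.range l :=
    fun l => Set.range_comp (fun x : ℝ => (x : ℂ)) l
  rw [h2, h2] at h1
  exact Complex.ofReal_injective.image_injective h1

/-- The increasing enumeration of a spectrum is unique, so the first N coordinates are frozen and
all the geometry lies in the norming constants. -/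
lemma spectralFamily_eq (hlam : StrictMono lam) :
    spectralFamily a lam c = {lam} ×ˢ normingData a lam c := by
  ext ⟨l, ν⟩
  simp only [spectralFamily, normingData, Set.mem_ofPred_eq, isSpectralData_iff,
    isInteriorSpectralData_iff, Set.mem_prod, Set.mem_singleton_iff]
  constructor
  · rintro ⟨p, ⟨h1, h2⟩, h3, h4⟩
    obtain rfl := h1.unique h3
    exact ⟨rfl, p, h1.2, fun i => ⟨h4 i, h2 i⟩⟩
  · rintro ⟨rfl, p, h1, h2⟩
    exact ⟨p, ⟨⟨hlam, h1⟩, fun i => (h2 i).2⟩, ⟨hlam, h1⟩, fun i => (h2 i).1⟩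

/-- A pair determines its norming constants, so infinitely many values require infinitely many
pairs. -/
lemma infinite_of_normingData_infinite (hlam : StrictMono lam)
    (h : (normingData a lam c).Infinite) :
    {p : DiscretePair | IsInteriorSpectralData p a lam c}.Infinite := by
  refine Set.Infinite.of_image (fun p i => norming p (lam i)) (h.mono ?_)
  rintro ν ⟨p, h1, h2⟩
  exact ⟨p, isInteriorSpectralData_iff.2 ⟨⟨hlam, h1⟩, fun i => (h2 i).2⟩,
    funext fun i => (h2 i).1⟩

end SpectralData

/-! ### Geometry of the slices -/

section Slices

/-- One chart serves all points: translation by -q₀, restricted to the open set. -/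
lemma isSubmanifold_of_affine {E : Type*} [NormedAddCommGroup E] [NormedSpace ℝ E]
    [FiniteDimensional ℝ E] (W : Submodule ℝ E) {U : Set E} (hU : IsOpen U) (q₀ : E) {S : Set E}
    (hS : ∀ q, q ∈ S ↔ q ∈ U ∧ q - q₀ ∈ W) : IsSubmanifold (Module.finrank ℝ W) S := by
  intro q hq
  refine ⟨W, (Homeomorph.subRight q₀).toOpenPartialHomeomorphOfImageEq U hU _ rfl, rfl,
    ((hS q).1 hq).1, ?_, ?_, ?_⟩
  · exact (contDiff_id.sub contDiff_const).contDiffOn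
  · exact (contDiff_id.add contDiff_const).contDiffOn
  · ext w
    constructor
    · rintro ⟨x, ⟨h1, h2⟩, rfl⟩
      exact ⟨((hS x).1 h1).2, x, h2, rfl⟩
    · rintro ⟨h1, x, h2, rfl⟩
      exact ⟨x, ⟨(hS x).2 ⟨h2, h1⟩, h2⟩, rfl⟩

lemma isOpen_pos {ι : Type*} [Finite ι] (c : ι → ℝ) :
    IsOpen {ν : ι → ℝ | ∀ i, c i = 0 → 0 < ν i} := by
  simp only [Set.ofPred_forall]
  exact isOpen_iInter_of_finite fun i => isOpen_iInter_of_finite fun _ =>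
    isOpen_lt continuous_const (continuous_apply i)

lemma convex_normingSlice {ι : Type*} (c d : ι → ℝ) : Convex ℝ (normingSlice c d) := by
  intro x hx y hy s t hs ht hst i
  refine ⟨fun hi => ?_, fun hi => ?_⟩
  · simp only [Pi.add_apply, Pi.smul_apply, smul_eq_mul, (hx i).1 hi, (hy i).1 hi]
    rw [← add_mul, hst, one_mul]
  · exact (convex_Ioi (0 : ℝ)) ((hx i).2 hi) ((hy i).2 hi) hs ht hst

lemma normingSlice_nonempty {ι : Type*} (c d : ι → ℝ) : (normingSlice c d).Nonempty := by
  classical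
  refine ⟨fun i => if c i = 0 then 1 else d i, fun i => ⟨fun hi => ?_, fun hi => ?_⟩⟩ <;> simp [hi]

lemma normingSlice_infinite {ι : Type*} {c : ι → ℝ} {i : ι} (hi : c i = 0) (d : ι → ℝ) :
    (normingSlice c d).Infinite := by
  classical
  obtain ⟨ν, hν⟩ := normingSlice_nonempty c d
  refine ((Set.Ioi_infinite (0 : ℝ)).image ((Function.update_injective ν i).injOn)).mono ?_
  rintro _ ⟨t, ht, rfl⟩ j
  by_cases hj : j = i
  · subst hj
    simpa [hi] using ht
  · simpa [hj] using hν j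

lemma isConnectedSubmanifold_slice {ι : Type*} [Fintype ι] (lam c d : ι → ℝ) :
    IsConnectedSubmanifold {i | c i = 0}.ncard
      (({lam} : Set (ι → ℝ)) ×ˢ normingSlice c d) := by
  classical
  obtain ⟨ν₀, hν₀⟩ := normingSlice_nonempty c d
  refine ⟨⟨⟨(lam, ν₀), rfl, hν₀⟩,
    ((convex_singleton lam).prod (convex_normingSlice c d)).isPreconnected⟩, ?_⟩
  -- The directions of the slice: the free coordinates, extended by zero to the visible ones and to
  -- the eigenvalue component. Injectivity gives the dimension.
  let F : ({i // c i = 0} → ℝ) →ₗ[ℝ] (ι → ℝ) × (ι → ℝ) :=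
    LinearMap.inr ℝ (ι → ℝ) (ι → ℝ) ∘ₗ Function.ExtendByZero.linearMap ℝ Subtype.val
  have hF : Function.Injective F :=
    LinearMap.inr_injective.comp (Function.extend_injective Subtype.val_injective (0 : ι → ℝ))
  have hdim : Module.finrank ℝ (LinearMap.range F) = {i | c i = 0}.ncard := by
    rw [LinearMap.finrank_range_of_inj hF, Module.finrank_fintype_fun_eq_card,
      ← Nat.card_eq_fintype_card, ← Nat.card_coe_set_eq]
    rfl
  have hmem : ∀ q, q ∈ LinearMap.range F ↔ q.1 = 0 ∧ ∀ i, c i ≠ 0 → q.2 i = 0 := by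
    rintro ⟨l, ν⟩
    constructor
    · rintro ⟨t, ht⟩
      obtain ⟨rfl, rfl⟩ := Prod.mk.inj ht.symm
      refine ⟨rfl, fun i hi => ?_⟩
      exact Function.extend_apply' _ _ _ fun ⟨j, hj⟩ => hi (hj ▸ j.2)
    · rintro ⟨rfl, h⟩
      refine ⟨fun j => ν j, Prod.ext rfl (funext fun i => ?_)⟩
      by_cases hi : c i = 0
      · exact Subtype.val_injective.extend_apply (fun j : {i // c i = 0} => ν j) 0 ⟨i, hi⟩
      · exact (Function.extend_apply' (fun j : {i // c i = 0} => ν j) (0 : ι → ℝ) i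
          fun ⟨j, hj⟩ => hi (hj ▸ j.2)).trans (h i hi).symm
  rw [← hdim]
  refine isSubmanifold_of_affine _ ((isOpen_pos c).preimage continuous_snd) (lam, ν₀) fun q => ?_
  rw [hmem, Set.mem_prod, Set.mem_singleton_iff]
  simp only [normingSlice, Set.mem_ofPred_eq, Set.mem_preimage, Prod.fst_sub, Prod.snd_sub,
    Pi.sub_apply, sub_eq_zero]
  constructor
  · exact fun h => ⟨fun i => (h.2 i).2, h.1, fun i hi => ((h.2 i).1 hi).trans ((hν₀ i).1 hi).symm⟩
  · exact fun h => ⟨h.2.1, fun i => ⟨fun hi => (h.2.2 i hi).trans ((hν₀ i).1 hi), h.1 i⟩⟩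

lemma separatedNhds_slices {ι : Type*} (lam c : ι → ℝ) {d d' : ι → ℝ} {L : ι} (hc : c L ≠ 0)
    (hd : d L ≠ d' L) : SeparatedNhds (({lam} : Set (ι → ℝ)) ×ˢ normingSlice c d)
      (({lam} : Set (ι → ℝ)) ×ˢ normingSlice c d') := by
  have hcont : Continuous fun q : (ι → ℝ) × (ι → ℝ) => q.2 L := by fun_prop
  obtain ⟨u, v, hu, hv, hdu, hdv, huv⟩ := t2_separation hd
  refine ⟨_, _, hu.preimage hcont, hv.preimage hcont, fun q hq => ?_, fun q hq => ?_,
    huv.preimage _⟩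
  · rw [Set.mem_preimage, (hq.2 L).1 hc]; exact hdu
  · rw [Set.mem_preimage, (hq.2 L).1 hc]; exact hdv

lemma geometry_of_normingData {N : ℕ} {a : ℝ} {lam c : Fin N → ℝ} (hlam : StrictMono lam) {L : Fin N}
    (h0 : c L = 0 → ∃ d, normingData a lam c = normingSlice c d)
    (h1 : c L ≠ 0 → ∃ d d', d L ≠ d' L ∧
      normingData a lam c = normingSlice c d ∪ normingSlice c d') :
    (0 < {i | c i = 0}.ncard →
      {p : DiscretePair | IsInteriorSpectralData p a lam c}.Infinite) ∧
    (c L = 0 → IsConnectedSubmanifold {i | c i = 0}.ncard (spectralFamily a lam c)) ∧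
    (c L ≠ 0 → IsUnionOfTwoDisjointSubmanifolds {i | c i = 0}.ncard (spectralFamily a lam c)) := by
  refine ⟨fun hk => infinite_of_normingData_infinite hlam ?_, fun hc => ?_, fun hc => ?_⟩
  · obtain ⟨i, hi⟩ := Set.nonempty_of_ncard_ne_zero hk.ne'
    by_cases hc : c L = 0
    · obtain ⟨d, hd⟩ := h0 hc
      rw [hd]
      exact normingSlice_infinite hi d
    · obtain ⟨d, d', -, hd⟩ := h1 hc
      rw [hd]
      exact (normingSlice_infinite hi d).mono Set.subset_union_left
  · obtain ⟨d, hd⟩ := h0 hc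
    rw [spectralFamily_eq hlam, hd]
    exact isConnectedSubmanifold_slice lam c d
  · obtain ⟨d, d', hne, hd⟩ := h1 hc
    rw [spectralFamily_eq hlam, hd, Set.prod_union]
    exact ⟨_, _, rfl, separatedNhds_slices lam c hc hne, isConnectedSubmanifold_slice lam c d,
      isConnectedSubmanifold_slice lam c d'⟩

end Slices

end InteriorInverse


theorem theorem3p16 (a : ℝ) {N : ℕ} (hN : 0 < N) (lam c : Fin N → ℝ)
    (hdata : ∃ p : InteriorInverse.DiscretePair, InteriorInverse.IsInteriorSpectralData p a lam c)
    (halpha : 1 - ∑ i, |c i| ^ 2 ≠ 0)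
    (hsign : 0 < lam ⟨0, hN⟩ ∨ lam ⟨N - 1, Nat.sub_lt hN Nat.one_pos⟩ < 0)
    (k : ℕ) (hk : {i | c i = 0}.ncard = k) :
    (0 < k →
      {p : InteriorInverse.DiscretePair |
        InteriorInverse.IsInteriorSpectralData p a lam c}.Infinite) ∧
    (0 < lam ⟨0, hN⟩ →
      (c ⟨N - 1, Nat.sub_lt hN Nat.one_pos⟩ = 0 →
        InteriorInverse.IsConnectedSubmanifold k (InteriorInverse.spectralFamily a lam c)) ∧
      (c ⟨N - 1, Nat.sub_lt hN Nat.one_pos⟩ ≠ 0 →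
        InteriorInverse.IsUnionOfTwoDisjointSubmanifolds k
          (InteriorInverse.spectralFamily a lam c))) ∧
    (lam ⟨N - 1, Nat.sub_lt hN Nat.one_pos⟩ < 0 →
      (c ⟨0, hN⟩ = 0 →
        InteriorInverse.IsConnectedSubmanifold k (InteriorInverse.spectralFamily a lam c)) ∧
      (c ⟨0, hN⟩ ≠ 0 →
        InteriorInverse.IsUnionOfTwoDisjointSubmanifolds k
          (InteriorInverse.spectralFamily a lam c))) := by
  subst hk
  obtain ⟨p, hp⟩ := hdata
  obtain ⟨⟨hlam, hspec⟩, hc⟩ := InteriorInverse.isInteriorSpectralData_iff.1 hp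
  have hne : (InteriorInverse.normingData a lam c).Nonempty :=
    ⟨fun i => InteriorInverse.norming p (lam i), p, hspec, fun i => ⟨rfl, hc i⟩⟩
  have hfirst : ∀ i, lam ⟨0, hN⟩ ≤ lam i := fun i => hlam.monotone (Nat.zero_le _)
  have hlast : ∀ i, lam i ≤ lam ⟨N - 1, Nat.sub_lt hN Nat.one_pos⟩ :=
    fun i => hlam.monotone (Nat.le_sub_one_of_lt i.2)
  have hpos (h : 0 < lam ⟨0, hN⟩) := by
    have := InteriorInverse.normingData_eq (fun i => h.trans_le (hfirst i)) hlam.injective hne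
      halpha hlast
    exact InteriorInverse.geometry_of_normingData hlam this.1 this.2
  -- Negation reverses the order, so the first eigenvalue becomes the largest one and takes over the
  -- role of `L`; `normingData_neg` transports the description back.
  have hneg (h : lam ⟨N - 1, Nat.sub_lt hN Nat.one_pos⟩ < 0) := by
    have := InteriorInverse.normingData_eq (lam := fun i => -lam i)
      (fun i => neg_pos.2 ((hlast i).trans_lt h)) (fun i j hij => hlam.injective (neg_injective hij))
      (by rwa [InteriorInverse.normingData_neg]) halpha (fun i => neg_le_neg (hfirst i))
    rw [InteriorInverse.normingData_neg] at this
    exact InteriorInverse.geometry_of_normingData hlam this.1 this.2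
  exact ⟨hsign.elim (fun h => (hpos h).1) fun h => (hneg h).1, fun h => (hpos h).2,
    fun h => (hneg h).2⟩
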